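/- **Setting.** Let $\Theta\subset\mathbb R^d$, with Lebesgue measure and the Euclidean norm. Let $p(\theta)\ge0$ be a prior and $\ell(\theta|\mathbf d,\mathbf f)\ge 0$ a likelihood on $\Theta$, for data $\mathbf d\in\mathbb R^n$ and a forward model $\mathbf f:\Theta\to\mathbb R^n$. Let $\pi$ be the distribution on $\Theta$ with density $p(\theta|\mathbf d)=\ell(\theta|\mathbf d,\mathbf f)\,p(\theta)/Z$, where $Z=\int_\Theta \ell(\theta|\mathbf d,\mathbf f)\,p(\theta)\,d\theta$, and let $g(\theta)=\log(\ell(\theta|\mathbf d,\mathbf f)p(\theta))$. A *model* is a function on $\Theta$: the exact model $g$, or a polynomial of degree at most $2$ approximating it. For each model $M$ a proposal density $q(\theta,\cdot\,|M)$ on $\Theta$ is given, together with a measurable map $r(\theta,z,M)\in\Theta$ such that $r(\theta,z,M)\sim q(\theta,\cdot|M)$ when $z\sim N(0,I_m)$. **Local approximation.** For finite $S\subset\Theta$ and $\theta\in\Theta$, let $B_S(\theta)$ be the set of the $N=(d+1)(d+2)/2$ points of $S$ nearest to $\theta$ (ties broken lexicographically). Let $\tilde f_{S,\theta}$ be the quadratic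 polynomial interpolating $g$ on $B_S(\theta)$, and $\tilde f^{\sim j}_{S,\theta}$ the model fitted in the same way to $B_S(\theta)\setminus\{j\}$, for $j\in B_S(\theta)$. Where the points do not determine a unique interpolating quadratic, the model is the constant equal to the value of $g$ at the nearest of the points used. Put $$\zeta(\theta,y;M,M')=\frac{e^{M'(y)}q(y,\theta|M')}{e^{M(\theta)}q(\theta,y|M)},\qquad r_S(\theta,z)=r(\theta,z,\tilde f_{S,\theta}),\qquad \alpha_S(\theta,y)=\min\bigl(1,\zeta(\theta,y;\tilde f_{S,\theta},\tilde f_{S,y})\bigr).$$ $K_S(\theta,\cdot)$ is the law of the point obtained by drawing $z\sim N(0,I_m)$ and $u\sim U[0,1]$ independently and moving from $\theta$ to $y=r_S(\theta,z)$ if $u<\alpha_S(\theta,y)$, staying at $\theta$ otherwise; $r_\infty,\alpha_\infty,K_\infty$ are the same objects with both local models replaced by $g$. $S$ is an $\epsilon$-cover if $\sup_{\theta\in\Theta}\min_{s\in S}\|\theta-s\|<\epsilon$. A set $B_S(\theta)$ is $\lambda$-poised if quadratic interpolation on it is uniquely solvable and its Lagrange polynomials are bounded by $\lambda$ in absolute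 value on the smallest closed ball centred at $\theta$ that contains it. **Algorithm.** The parameters are $\beta_t$, $\gamma_t\in\mathbb R$ and $\lambda$. Start from any $X_0\in\Theta$ and any finite $S_0\subset\Theta$. Step $t$, from $(\theta,S)=(X_t,S_t)$: draw $z\sim N(0,I_m)$ and keep it fixed. Repeat the following pass. Compute $y=r_S(\theta,z)$. With $\zeta=\zeta(\theta,y;\tilde f_{S,\theta},\tilde f_{S,y})$ and $\Delta(\zeta')=|\min(1,\zeta)-\min(1,\zeta')|+|\min(1,1/\zeta)-\min(1,1/\zeta')|$, compute $$\epsilon^+=\max_{j\in B_S(y)}\Delta\bigl(\zeta(\theta,y;\tilde f_{S,\theta},\tilde f^{\sim j}_{S,y})\bigr),\qquad \epsilon^-=\max_{j\in B_S(\theta)}\Delta\bigl(\zeta(\theta,y;\tilde f^{\sim j}_{S,\theta},\tilde f_{S,y})\bigr).$$ Then, drawing a fresh $u\sim U[0,1]$: * if $u<\beta_t$, add to $S$ either $y$ or $\theta$, each with probability $1/2$; * else, if ($\epsilon^+\ge\epsilon^-$ and $\epsilon^+\ge\gamma_t$) or $B_S(y)$ is not $\lambda$-poised, add $y$ to $S$;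 * else, if ($\epsilon^->\epsilon^+$ and $\epsilon^-\ge\gamma_t$) or $B_S(\theta)$ is not $\lambda$-poised, add $\theta$ to $S$. If $S$ was enlarged, do another pass. Otherwise draw $u'\sim U[0,1]$, set $X_{t+1}=y$ if $u'<\alpha_S(\theta,y)$ and $X_{t+1}=\theta$ otherwise, and set $S_{t+1}=S$. All random draws are independent. **Distance.** For probability measures on $\Theta$, $W_2(\mu,\nu)=\inf\mathbb E\|X-Y\|_2$ over all couplings of $X\sim\mu$, $Y\sim\nu$ (the index $2$ refers to the Euclidean norm in the cost). **Theorem (convergence on a compact state space).** Assume: 1. For every $\delta>0$ there is $\epsilon>0$ such that every $\epsilon$-cover $S$ satisfies $\sup_{\theta\in\Theta}W_2(K_S(\theta,\cdot),K_\infty(\theta,\cdot))<\delta$. 2. There are $0<\eta_0<\infty$ and $1<C<\infty$ such that $\sup_{\|\theta-\theta'\|<\eta}W_2(K_\infty(\theta,\cdot),K_\infty(\theta',\cdot))<C\eta$ for all $0<\eta<\eta_0$. 3. For all $\varphi_0<\infty$ and $\delta>0$ there is $\epsilon>0$ such that all $\epsilon$-covers $S,S'$ satisfy $\sup_{\|z\|\le\varphi_0}\sup_{\theta\in\Theta}\|r_S(\theta,z)-r_{S'}(\theta,z)\|\le\delta$.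 4. $\Theta$ is compact and is the closure of its interior. The density $q(\theta,\theta'|M)=q(\theta,\theta')$ does not depend on the model $M$ (the map $r$ may), is continuous on $\Theta\times\Theta$, $C^\infty$ in $\theta'$ for each $\theta$, and bounded below by a positive constant. The density $p(\cdot|\mathbf d)$ is $C^\infty$ on $\Theta$ and bounded below by a positive constant. (A function is $C^\infty$ on $\Theta$ if it is the restriction of a $C^\infty$ function on $\mathbb R^d$.) Finally $\beta_t\equiv\beta\in(0,1]$, $0<\lambda<\infty$, and $(\gamma_t)$ is arbitrary. Then $$\lim_{t\to\infty}W_2(\mathcal L(X_t),\pi)=0.$$ -/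

import Mathlib

open MeasureTheory ProbabilityTheory Filter Topology
open scoped ENNReal

noncomputable section

namespace LAMCMC

/-- `ℝ^d` with the Euclidean norm. -/
abbrev E (d : ℕ) : Type := EuclideanSpace ℝ (Fin d)

/-! ### Wasserstein distance -/

/-- The Wasserstein distance `inf 𝔼[d(X, Y)]` over all couplings of `μ` and `ν`. For `X ⊆ ℝ^d` with
the Euclidean metric this is the distance written `W₂`, the subscript naming the norm in the cost. -/
def wasserstein {X : Type*} [PseudoEMetricSpace X] [MeasurableSpace X] (μ ν : Measure X) : ℝ≥0∞ :=
  ⨅ (κ : Measure (X × X)) (_ : κ.map Prod.fst = μ ∧ κ.map Prod.snd = ν),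
    ∫⁻ p, edist p.1 p.2 ∂κ

/-- Lebesgue measure on a subset `Θ` of `ℝ^d`. -/
def vol {d : ℕ} (Θ : Set (E d)) : Measure Θ := Measure.comap Subtype.val volume

/-- A real function on `Θ` is `C^∞` if it is the restriction of a `C^∞` function on `ℝ^d`. -/
def SmoothOn {d : ℕ} (Θ : Set (E d)) (h : Θ → ℝ) : Prop :=
  ∃ H : E d → ℝ, ContDiff ℝ ((⊤ : ℕ∞) : WithTop ℕ∞) H ∧ ∀ θ : Θ, h θ = H θ

/-! ### Local quadratic interpolation -/

/-- The coefficients of a polynomial of degree at most two in `d` variables. -/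
abbrev QuadCoef (d : ℕ) : Type := ℝ × (Fin d → ℝ) × (Fin d → Fin d → ℝ)

/-- The quadratic polynomial with given coefficients. -/
def quad {d : ℕ} (c : QuadCoef d) (x : E d) : ℝ :=
  c.1 + ∑ i, c.2.1 i * x i + ∑ i, ∑ j, c.2.2 i j * x i * x j

/-- Polynomial functions on `ℝ^d` of degree at most two. -/
def IsQuadratic {d : ℕ} (P : E d → ℝ) : Prop := ∃ c : QuadCoef d, P = quad c

/-- The dimension `(d + 1)(d + 2) / 2` of the space of such polynomials. -/
def numNodes (d : ℕ) : ℕ := (d + 1) * (d + 2) / 2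

section Approx

variable {d : ℕ} {Θ : Set (E d)}

/-- `s` comes before `t` when points are ordered by distance to `θ`, with ties broken
lexicographically by coordinates. -/
def Before (θ s t : Θ) : Prop :=
  dist s θ < dist t θ ∨
    (dist s θ = dist t θ ∧ toLex (fun i => (s : E d) i) < toLex (fun i => (t : E d) i))

open Classical in
/-- The `k` points of `S` nearest to `θ` (all of `S` if `S` has fewer than `k` points). -/
def nearest (k : ℕ) (θ : Θ) (S : Finset Θ) : Finset Θ :=
  S.filter fun s => (S.filter fun t => Before θ t s).card < k

/-- `P` is a quadratic polynomial that interpolates `g` at the points of `Y`. -/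
def Interpolates (Y : Finset Θ) (g : Θ → ℝ) (P : E d → ℝ) : Prop :=
  IsQuadratic P ∧ ∀ y ∈ Y, P y = g y

open Classical in
/-- The local model fitted near `θ` to the values of `g` on `Y`: the quadratic interpolant where the
points determine it; otherwise (too few points, or points in degenerate position) the constant given
by the value at the point of `Y` nearest to `θ`. -/
def fit (g : Θ → ℝ) (θ : Θ) (Y : Finset Θ) : E d → ℝ :=
  if h : ∃! P : E d → ℝ, Interpolates Y g P then h.choose
  else fun _ => ∑ s ∈ nearest 1 θ Y, g s

/-- `Y` is `Λ`-poised in the smallest closed ball centred at `θ` that contains it: quadratic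
interpolation on `Y` is uniquely solvable for all data, and all Lagrange polynomials of `Y` are
bounded by `Λ` in absolute value on that ball. -/
def Poised (Λ : ℝ) (θ : Θ) (Y : Finset Θ) : Prop :=
  (∀ g : Θ → ℝ, ∃! P : E d → ℝ, Interpolates Y g P) ∧
  ∀ y ∈ Y, ∀ P : E d → ℝ, IsQuadratic P → P y = 1 → (∀ y' ∈ Y, y' ≠ y → P y' = 0) →
    ∀ x : E d, (∃ y' ∈ Y, dist x θ ≤ dist (y' : E d) θ) → |P x| ≤ Λ

/-- `S` is an `ε`-cover of `Θ`: `sup_θ min_{s ∈ S} ‖θ - s‖ < ε`. -/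
def IsCover (ε : ℝ) (S : Finset Θ) : Prop :=
  (⨆ θ : Θ, Metric.infEDist θ (S : Set Θ)) < ENNReal.ofReal ε

end Approx

/-! ### The inference problem and the algorithm -/

/-- A model on `Θ`, as handed to the proposal: either the exact log-posterior (up to an additive
constant) or a local approximation of it. -/
abbrev Model {d : ℕ} (Θ : Set (E d)) : Type := Θ → ℝ

/-- The input of the algorithm: the inference problem, the proposal (as a density `q` and as a map `r`
of the current point and of the proposal noise), and the algorithm parameters. -/
structure Setup (d m n : ℕ) (Θ : Set (E d)) where
  /-- forward model `f` -/
  forward : Θ → E n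
  /-- data `𝐝` -/
  data : E n
  /-- likelihood `ℓ(θ | 𝐝, f)` -/
  likelihood : Θ → E n → (Θ → E n) → ℝ
  /-- prior density `p(θ)` -/
  prior : Θ → ℝ
  /-- proposal map `r(θ, z, model)` -/
  r : Θ → E m → Model Θ → Θ
  /-- proposal density: `q θ θ' M` is `q(θ, θ' | M)` -/
  q : Θ → Θ → Model Θ → ℝ
  /-- random refinement probabilities `β_t` -/
  β : ℕ → ℝ
  /-- cross-validation thresholds `γ_t` -/
  γ : ℕ → ℝ
  /-- poisedness constant `λ` -/
  lam : ℝ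

/-- The uniform distribution on `[0, 1]`. -/
def unif : Measure ℝ := volume.restrict (Set.Icc 0 1)

/-- The randomness used in one step: the proposal noise `z`; for each pass through the refinement
loop, a uniform variable for the decision on random refinement and one for the choice of
the point; the uniform variable of the accept/reject decision. -/
abbrev Noise (m : ℕ) : Type := E m × (ℕ → ℝ × ℝ) × ℝ

/-- The law of the randomness of one step. -/
def noiseLaw (m : ℕ) : Measure (Noise m) :=
  (stdGaussian (E m)).prod ((Measure.infinitePi fun _ : ℕ => unif.prod unif).prod unif)

namespace Setup

variable {d m n : ℕ} {Θ : Set (E d)} (A : Setup d m n Θ)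

/-- The unnormalized posterior density `ℓ(θ | 𝐝, f) p(θ)`. -/
def post (θ : Θ) : ℝ := A.likelihood θ A.data A.forward * A.prior θ

/-- The posterior density `p(θ | 𝐝) = ℓ(θ | 𝐝, f) p(θ) / Z`. -/
def density (θ : Θ) : ℝ := A.post θ / ∫ θ', A.post θ' ∂(vol Θ)

/-- The posterior distribution `π`. -/
def target : Measure Θ := (vol Θ).withDensity fun θ => ENNReal.ofReal (A.density θ)

/-- The exact model: the logarithm of the unnormalized posterior density. -/
def exact : Model Θ := fun θ => Real.log (A.post θ)

/-- The points used by the local approximation at `θ`. -/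
def nodes (S : Finset Θ) (θ : Θ) : Finset Θ := nearest (numNodes d) θ S

/-- `LocApprox(θ, S, ∅)`. -/
def approx (S : Finset Θ) (θ : Θ) : Model Θ := fun x => fit A.exact θ (nodes S θ) x

open Classical in
/-- `LocApprox(θ, S, j)`, where the neighbour `j` is left out. -/
def approxLOO (S : Finset Θ) (θ j : Θ) : Model Θ := fun x => fit A.exact θ ((nodes S θ).erase j) x

/-- The Metropolis-Hastings ratio `ζ` for a move from `θ` to `y`, with the model `M₀` at `θ` and
the model `M₁` at `y`. -/
def ratio (θ y : Θ) (M₀ M₁ : Model Θ) : ℝ :=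
  (Real.exp (M₁ y) * A.q y θ M₁) / (Real.exp (M₀ θ) * A.q θ y M₀)

/-- The discrepancy of acceptance probabilities in both directions for two ratios. -/
def accDiff (ζ ζ' : ℝ) : ℝ := |min 1 ζ - min 1 ζ'| + |min 1 (1 / ζ) - min 1 (1 / ζ')|

/-- The error indicator `ε⁺` at the proposed point `y`. -/
def errPlus (S : Finset Θ) (θ y : Θ) : ℝ :=
  sSup ((fun j => accDiff (A.ratio θ y (A.approx S θ) (A.approx S y))
    (A.ratio θ y (A.approx S θ) (A.approxLOO S y j))) '' (nodes S y : Set Θ))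

/-- The error indicator `ε⁻` at the current point `θ`. -/
def errMinus (S : Finset Θ) (θ y : Θ) : ℝ :=
  sSup ((fun j => accDiff (A.ratio θ y (A.approx S θ) (A.approx S y))
    (A.ratio θ y (A.approxLOO S θ j) (A.approx S y))) '' (nodes S θ : Set Θ))

/-- The proposal map `r_S`. -/
def rS (S : Finset Θ) (θ : Θ) (z : E m) : Θ := A.r θ z (A.approx S θ)

/-- The proposal map `r_∞`. -/
def rInf (θ : Θ) (z : E m) : Θ := A.r θ z A.exact

/-- The acceptance probability `α_S` for a move from `θ` to `y`. -/
def αS (S : Finset Θ) (θ y : Θ) : ℝ := min 1 (A.ratio θ y (A.approx S θ) (A.approx S y))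

/-- The acceptance probability `α_∞`. -/
def αInf (θ y : Θ) : ℝ := min 1 (A.ratio θ y A.exact A.exact)

open Classical in
/-- The point returned by the step with the fixed sample set `S`, from the point `θ`, with proposal
noise `z` and accept/reject variable `u`. -/
def moveS (S : Finset Θ) (θ : Θ) (z : E m) (u : ℝ) : Θ :=
  if u < A.αS S θ (A.rS S θ z) then A.rS S θ z else θ

open Classical in
/-- The point returned by the Metropolis-Hastings step with the exact model. -/
def moveInf (θ : Θ) (z : E m) (u : ℝ) : Θ :=
  if u < A.αInf θ (A.rInf θ z) then A.rInf θ z else θ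

/-- The transition kernel `K_S(θ, ·)`. -/
def KS (S : Finset Θ) (θ : Θ) : Measure Θ :=
  ((stdGaussian (E m)).prod unif).map fun p => A.moveS S θ p.1 p.2

/-- The transition kernel `K_∞(θ, ·)`. -/
def KInf (θ : Θ) : Measure Θ :=
  ((stdGaussian (E m)).prod unif).map fun p => A.moveInf θ p.1 p.2

open Classical in
/-- The sample set after one pass through the refinement loop at time `t`, from the current point `θ`
with the proposal noise `z`; `w` is the fresh randomness of the pass. `RefineNear(x, S)` adds the point `x`
to `S`. -/
def pass (t : ℕ) (θ : Θ) (z : E m) (S : Finset Θ) (w : ℝ × ℝ) : Finset Θ :=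
  let y := A.rS S θ z
  if w.1 < A.β t then
    (if w.2 < 1 / 2 then insert y S else insert θ S)
  else if (A.errMinus S θ y ≤ A.errPlus S θ y ∧ A.γ t ≤ A.errPlus S θ y) ∨
      ¬ Poised A.lam y (nodes S y) then insert y S
  else if (A.errPlus S θ y < A.errMinus S θ y ∧ A.γ t ≤ A.errMinus S θ y) ∨
      ¬ Poised A.lam θ (nodes S θ) then insert θ S
  else S

/-- The sample sets produced by successive passes; the proposal noise is kept fixed. -/
def passes (t : ℕ) (θ : Θ) (z : E m) (S : Finset Θ) (w : ℕ → ℝ × ℝ) : ℕ → Finset Θ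
  | 0 => S
  | k + 1 => A.pass t θ z (passes t θ z S w k) (w k)

open Classical in
/-- One step `K_t` of the algorithm. Passes are repeated as long as refinement occurs, that is, as long
as the sample set gets enlarged; then the accept/reject decision is made with the final
sample set. If the loop did not end, the state would be kept. -/
def step (t : ℕ) (x : Θ × Finset Θ) (w : Noise m) : Θ × Finset Θ :=
  if h : ∃ k, A.passes t x.1 w.1 x.2 w.2.1 (k + 1) = A.passes t x.1 w.1 x.2 w.2.1 k then
    let S' := A.passes t x.1 w.1 x.2 w.2.1 (Nat.find h)
    (A.moveS S' x.1 w.1 w.2.2, S')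
  else x

/-- The run of the algorithm from `x`, driven by the sequence `w` of random inputs. -/
def run (x : Θ × Finset Θ) (w : ℕ → Noise m) : ℕ → Θ × Finset Θ
  | 0 => x
  | t + 1 => A.step t (run x w t) (w t)

/-- The models on which the proposal is used: quadratic polynomials and the exact model. -/
def Admissible (M : Model Θ) : Prop :=
  M = A.exact ∨ ∃ c : QuadCoef d, M = fun x : Θ => quad c (x : E d)

/-- Standing conventions: prior and likelihood are nonnegative, the map `r` is measurable, and for
`z ∼ N(0, I)` the point `r(θ, z, M)` has density `q(θ, · | M)` on `Θ`. -/
structure Standing : Prop where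
  prior_nonneg : ∀ θ, 0 ≤ A.prior θ
  likelihood_nonneg : ∀ θ, 0 ≤ A.likelihood θ A.data A.forward
  measurable_r : Measurable fun x : Θ × E m × QuadCoef d => A.r x.1 x.2.1 fun y => quad x.2.2 y
  measurable_r_exact : Measurable fun x : Θ × E m => A.r x.1 x.2 A.exact
  law_r : ∀ M, A.Admissible M → ∀ θ, (stdGaussian (E m)).map (fun z => A.r θ z M) =
    (vol Θ).withDensity fun y => ENNReal.ofReal (A.q θ y M)

/-- The sufficient conditions on state space, proposal, target and parameters. (Quadratic interpolation of the
log-posterior, the simplified refinement and the poisedness checks are part of the algorithm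
above; the thresholds `γ_t` are arbitrary.) -/
structure Sufficient : Prop where
  compact : IsCompact Θ
  regular : closure (interior Θ) = Θ
  q_indep : ∀ θ y M M', A.q θ y M = A.q θ y M'
  q_smooth : ∀ θ, SmoothOn Θ fun y => A.q θ y A.exact
  q_cont : Continuous fun p : Θ × Θ => A.q p.1 p.2 A.exact
  q_lower : ∃ c > 0, ∀ θ y, c ≤ A.q θ y A.exact
  density_smooth : SmoothOn Θ A.density
  density_lower : ∃ c > 0, ∀ θ, c ≤ A.density θ
  β_const : ∃ b, 0 < b ∧ b ≤ 1 ∧ ∀ t, A.β t = b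
  lam_pos : 0 < A.lam

/-- The convergence assumptions. -/
structure Convergence : Prop where
  kernel_close : ∀ δ : ℝ, 0 < δ → ∃ ε : ℝ, 0 < ε ∧ ∀ S : Finset Θ, IsCover ε S →
    ⨆ θ, wasserstein (A.KS S θ) (A.KInf θ) < ENNReal.ofReal δ
  kernel_lipschitz : ∃ η₀ C : ℝ, 0 < η₀ ∧ 1 < C ∧ ∀ η : ℝ, 0 < η → η < η₀ →
    ⨆ (θ : Θ) (θ' : Θ) (_ : dist θ θ' < η), wasserstein (A.KInf θ) (A.KInf θ') <
      ENNReal.ofReal (C * η)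
  proposal_close : ∀ φ₀ δ : ℝ, 0 < δ → ∃ ε : ℝ, 0 < ε ∧ ∀ S S' : Finset Θ,
    IsCover ε S → IsCover ε S' → ∀ z : E m, ‖z‖ ≤ φ₀ → ∀ θ : Θ,
      dist (A.rS S θ z) (A.rS S' θ z) ≤ δ
  sufficient : A.Sufficient

end Setup

end LAMCMC

end

noncomputable section

/-! ### Positivity and continuity of the posterior, the proposal density and the exact acceptance
ratio -/

namespace LAMCMC

variable {d m n : ℕ} {Θ : Set (E d)}

/-! The Metropolis-Hastings chain with the exact model has transition operator `exactOp`. It leaves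
π invariant by detailed balance, and its accepted moves have a density bounded below, so it
contracts oscillations by a fixed factor (`exactOp_contract`) and its iterates on a continuous
function tend uniformly to the π-mean (`exists_iterate_exactOp_close`). It therefore suffices that
one step of the algorithm acts asymptotically like `exactOp` on expectations of continuous
functions: the number k of chained steps is fixed first, then t tends to infinity. On a compact
space, convergence of these expectations gives Wasserstein convergence through a coupling along a
partition of unity (`wasserstein_le_of_partition`).

That a step is close to the exact one needs two facts. First, the sample set becomes an ε-cover in
probability: with probability bounded below, the first pass of a step inserts the proposed point,
whose density is bounded below, so the chance of still missing a given open set decays geometrically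
(`tendsto_misses`, `exists_tendsto_isCover`). Second, on fine covers the step itself must be nearly
exact. This is not just closeness of K_S to K_∞, because the sample set used in the accept/reject
decision has been refined during the step and depends on the proposal noise z. For bounded z,
however, the proposals from the initial and the final set are close, and the one from the initial
set has law exactly q, which does not depend on the model. What remains is pointwise closeness of
the acceptance probabilities (`αS_close`), which follows from `approx_close`: the local model at y,
evaluated at y, tends to g(y) uniformly over fine covers.

`approx_close` is the core, since an ε-cover may contain badly placed nodes. For d = 1, three
distinct points always interpolate well, by Rolle's theorem. For d ≥ 2, closeness of the kernels for
all covers forces g to be locally a quadratic polynomial, so that every unique interpolant on nearby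
nodes is g itself. Indeed, if the fit at θ had a huge value at θ, moves away from θ would almost
never be accepted and K_S(θ, ·) would displace θ much less than K_∞(θ, ·). Hence the fits on all
node sets of the right size in a small ball are bounded above (`exists_fit_bound`). But if the value
of g at some point is not the quadratic extrapolation of its values at three other collinear points,
there are nearly degenerate node sets with interpolants as large as desired
(`exists_interpolant_gt`).

Laws of the run make sense only once the step is measurable. Finite sets are handled through
enumerations (`MeasOn`, `Enum`), and conditions on interpolation coefficients through projections of
closed sets. -/

theorem vol_apply (hΘ : MeasurableSet Θ) (s : Set Θ) :
    vol Θ s = volume (Subtype.val '' s) :=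
  (MeasurableEmbedding.subtype_coe hΘ).comap_apply volume s

theorem isFiniteMeasure_vol (hΘ : IsCompact Θ) : IsFiniteMeasure (vol Θ) := by
  refine ⟨?_⟩
  rw [vol_apply hΘ.isClosed.measurableSet]
  exact lt_of_le_of_lt (measure_mono (by simp)) hΘ.measure_lt_top

theorem exists_interior_mem_of_isOpen (hreg : closure (interior Θ) = Θ) {s : Set Θ} (hs : IsOpen s)
    (hne : s.Nonempty) : ∃ V : Set (E d), IsOpen V ∧ V.Nonempty ∧ V ⊆ Subtype.val '' s := by
  obtain ⟨U, hU, rfl⟩ := isOpen_induced_iff.1 hs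
  obtain ⟨x, hx⟩ := hne
  have hx' : (x : E d) ∈ closure (interior Θ) := by rw [hreg]; exact x.2
  obtain ⟨y, hyU, hyi⟩ := mem_closure_iff.1 hx' U hU hx
  refine ⟨U ∩ interior Θ, hU.inter isOpen_interior, ⟨y, hyU, hyi⟩, ?_⟩
  rintro z ⟨hzU, hzi⟩
  exact ⟨⟨z, interior_subset hzi⟩, hzU, rfl⟩

theorem vol_pos_of_isOpen (hΘ : IsCompact Θ) (hreg : closure (interior Θ) = Θ) {s : Set Θ}
    (hs : IsOpen s) (hne : s.Nonempty) : 0 < vol Θ s := by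
  obtain ⟨V, hV, hVne, hVs⟩ := exists_interior_mem_of_isOpen hreg hs hne
  rw [vol_apply hΘ.isClosed.measurableSet]
  exact lt_of_lt_of_le (hV.measure_pos volume hVne) (measure_mono hVs)

namespace Setup

variable {A : Setup d m n Θ}

theorem density_continuous (hS : A.Sufficient) : Continuous A.density := by
  obtain ⟨H, hH, hHd⟩ := hS.density_smooth
  have : A.density = fun θ : Θ => H θ := funext hHd
  rw [this]
  exact hH.continuous.comp continuous_subtype_val

/-- The normalizing constant. -/
def normConst (A : Setup d m n Θ) : ℝ := ∫ θ', A.post θ' ∂(vol Θ)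

theorem normConst_pos (hA : A.Standing) (hS : A.Sufficient) (θ₀ : Θ) : 0 < A.normConst := by
  have h0 : 0 ≤ A.normConst :=
    integral_nonneg fun θ => mul_nonneg (hA.likelihood_nonneg θ) (hA.prior_nonneg θ)
  refine lt_of_le_of_ne h0 fun h => ?_
  obtain ⟨c, hc, hcl⟩ := hS.density_lower
  have := hcl θ₀
  unfold density at this
  change c ≤ A.post θ₀ / A.normConst at this
  rw [← h, div_zero] at this
  linarith

theorem post_eq (hA : A.Standing) (hS : A.Sufficient) (θ : Θ) : A.post θ = A.normConst * A.density θ := by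
  have := normConst_pos hA hS θ
  change A.post θ = A.normConst * (A.post θ / A.normConst)
  field_simp

theorem density_pos (hS : A.Sufficient) (θ : Θ) : 0 < A.density θ := by
  obtain ⟨c, hc, hcl⟩ := hS.density_lower
  exact lt_of_lt_of_le hc (hcl θ)

theorem post_pos (hA : A.Standing) (hS : A.Sufficient) (θ : Θ) : 0 < A.post θ := by
  rw [post_eq hA hS]
  exact mul_pos (normConst_pos hA hS θ) (density_pos hS θ)

theorem post_continuous (hA : A.Standing) (hS : A.Sufficient) : Continuous A.post := by
  have : A.post = fun θ => A.normConst * A.density θ := funext (post_eq hA hS)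
  rw [this]
  exact continuous_const.mul (density_continuous hS)

theorem exp_exact (hA : A.Standing) (hS : A.Sufficient) (θ : Θ) :
    Real.exp (A.exact θ) = A.post θ := Real.exp_log (post_pos hA hS θ)

theorem exact_continuous (hA : A.Standing) (hS : A.Sufficient) : Continuous A.exact :=
  (post_continuous hA hS).log fun θ => (post_pos hA hS θ).ne'

/-- The smooth extension of the density need not be positive off Θ, so its logarithm is smooth only
on the open neighbourhood of Θ where it is positive. -/
theorem exact_smooth (hA : A.Standing) (hS : A.Sufficient) :
    ∃ (G : E d → ℝ) (U : Set (E d)), IsOpen U ∧ Θ ⊆ U ∧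
      ContDiffOn ℝ ((⊤ : ℕ∞) : WithTop ℕ∞) G U ∧ ∀ θ : Θ, A.exact θ = G θ := by
  obtain ⟨H, hH, hHd⟩ := hS.density_smooth
  refine ⟨fun x => Real.log (A.normConst * H x), {x | 0 < H x}, isOpen_lt continuous_const hH.continuous,
    fun x hx => ?_, ?_, fun θ => ?_⟩
  · have := density_pos hS ⟨x, hx⟩
    rw [hHd] at this
    exact this
  · rcases isEmpty_or_nonempty Θ with he | ⟨⟨θ₀⟩⟩
    · by_cases h0 : A.normConst = 0
      · simp only [h0, zero_mul]
        exact contDiffOn_const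
      · exact (contDiff_const.mul hH).contDiffOn.log fun x hx => mul_ne_zero h0 (ne_of_gt hx)
    · exact (contDiff_const.mul hH).contDiffOn.log fun x hx =>
        mul_ne_zero (normConst_pos hA hS θ₀).ne' (ne_of_gt hx)
  · rw [exact, post_eq hA hS, hHd]

theorem q_bounds (hS : A.Sufficient) :
    ∃ c C : ℝ, 0 < c ∧ 0 < C ∧ ∀ θ y M, c ≤ A.q θ y M ∧ A.q θ y M ≤ C := by
  have := isCompact_iff_compactSpace.1 hS.compact
  obtain ⟨c, hc, hcl⟩ := hS.q_lower
  obtain ⟨C, hC⟩ := (isCompact_range hS.q_cont).bddAbove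
  refine ⟨c, max C 1, hc, by positivity, fun θ y M => ?_⟩
  rw [hS.q_indep θ y M A.exact]
  exact ⟨hcl θ y, le_max_of_le_left (hC ⟨(θ, y), rfl⟩)⟩

theorem q_pos (hS : A.Sufficient) (θ y : Θ) (M : Model Θ) : 0 < A.q θ y M := by
  obtain ⟨c, C, hc, -, h⟩ := q_bounds hS
  exact lt_of_lt_of_le hc (h θ y M).1

theorem ratio_eq (hS : A.Sufficient) (θ y : Θ) (M M' : Model Θ) :
    A.ratio θ y M M' = Real.exp (M' y) * A.q y θ A.exact / (Real.exp (M θ) * A.q θ y A.exact) := by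
  rw [ratio, hS.q_indep y θ M' A.exact, hS.q_indep θ y M A.exact]

theorem ratio_pos (hS : A.Sufficient) (θ y : Θ) (M M' : Model Θ) : 0 < A.ratio θ y M M' :=
  div_pos (mul_pos (Real.exp_pos _) (q_pos hS _ _ _)) (mul_pos (Real.exp_pos _) (q_pos hS _ _ _))

/-- The effect of the errors of the two models on the acceptance ratio. -/
theorem ratio_eq_exact_mul (hS : A.Sufficient) (θ y : Θ) (M M' : Model Θ) :
    A.ratio θ y M M' = A.ratio θ y A.exact A.exact *
      Real.exp ((M' y - A.exact y) - (M θ - A.exact θ)) := by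
  rw [ratio_eq hS, ratio_eq hS θ y A.exact A.exact, Real.exp_sub, Real.exp_sub, Real.exp_sub]
  have := q_pos hS θ y A.exact
  have := q_pos hS y θ A.exact
  have := Real.exp_pos (M θ)
  have := Real.exp_pos (A.exact θ)
  have := Real.exp_pos (A.exact y)
  field_simp

theorem ratio_exact_continuous (hA : A.Standing) (hS : A.Sufficient) :
    Continuous fun p : Θ × Θ => A.ratio p.1 p.2 A.exact A.exact := by
  have hg := exact_continuous hA hS
  have hq := hS.q_cont
  have hq' : Continuous fun p : Θ × Θ => A.q p.2 p.1 A.exact := hq.comp continuous_swap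
  unfold ratio
  refine Continuous.div ?_ ?_ fun p => (mul_pos (Real.exp_pos _) (q_pos hS _ _ _)).ne'
  · exact (Real.continuous_exp.comp (hg.comp continuous_snd)).mul hq'
  · exact (Real.continuous_exp.comp (hg.comp continuous_fst)).mul hq

theorem ratio_exact_bounds (hA : A.Standing) (hS : A.Sufficient) :
    ∃ c C : ℝ, 0 < c ∧ 0 < C ∧ ∀ θ y, c ≤ A.ratio θ y A.exact A.exact ∧
      A.ratio θ y A.exact A.exact ≤ C := by
  have := isCompact_iff_compactSpace.1 hS.compact
  have hc := ratio_exact_continuous hA hS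
  obtain ⟨C, hC⟩ := (isCompact_range hc).bddAbove
  rcases isEmpty_or_nonempty Θ with he | hne
  · exact ⟨1, 1, one_pos, one_pos, fun θ => he.elim θ⟩
  · obtain ⟨p, -, hp⟩ := isCompact_univ.exists_isMinOn (Set.univ_nonempty (α := Θ × Θ)) hc.continuousOn
    exact ⟨_, max C 1, ratio_pos hS p.1 p.2 _ _, by positivity, fun θ y =>
      ⟨hp (Set.mem_univ (θ, y)), le_max_of_le_left (hC ⟨(θ, y), rfl⟩)⟩⟩

theorem αInf_continuous (hA : A.Standing) (hS : A.Sufficient) :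
    Continuous fun p : Θ × Θ => A.αInf p.1 p.2 :=
  continuous_const.min (ratio_exact_continuous hA hS)

theorem αInf_lower (hA : A.Standing) (hS : A.Sufficient) :
    ∃ a : ℝ, 0 < a ∧ ∀ θ y, a ≤ A.αInf θ y := by
  obtain ⟨c, C, hc, hC, h⟩ := ratio_exact_bounds hA hS
  exact ⟨min 1 c, by positivity, fun θ y => min_le_min le_rfl (h θ y).1⟩

theorem αInf_pos (hS : A.Sufficient) (θ y : Θ) : 0 < A.αInf θ y :=
  lt_min one_pos (ratio_pos hS _ _ _ _)

theorem αInf_le_one (θ y : Θ) : A.αInf θ y ≤ 1 := min_le_left _ _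

theorem αS_pos (hS : A.Sufficient) (S : Finset Θ) (θ y : Θ) : 0 < A.αS S θ y :=
  lt_min one_pos (ratio_pos hS _ _ _ _)

theorem αS_le_one (S : Finset Θ) (θ y : Θ) : A.αS S θ y ≤ 1 := min_le_left _ _

theorem density_integrable (hS : A.Sufficient) : Integrable A.density (vol Θ) := by
  have := isCompact_iff_compactSpace.1 hS.compact
  have := isFiniteMeasure_vol hS.compact
  exact (density_continuous hS).integrable_of_hasCompactSupport (HasCompactSupport.of_compactSpace _)

theorem integral_density (hA : A.Standing) (hS : A.Sufficient) (θ₀ : Θ) :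
    ∫ θ, A.density θ ∂(vol Θ) = 1 := by
  unfold density
  rw [integral_div]
  exact div_self (normConst_pos hA hS θ₀).ne'

theorem isProbabilityMeasure_target (hA : A.Standing) (hS : A.Sufficient) (θ₀ : Θ) :
    IsProbabilityMeasure A.target := by
  refine ⟨?_⟩
  rw [target, withDensity_apply _ MeasurableSet.univ, Measure.restrict_univ,
    ← ofReal_integral_eq_lintegral_ofReal (density_integrable hS)
      (Eventually.of_forall fun θ => (density_pos hS θ).le), integral_density hA hS θ₀,
    ENNReal.ofReal_one]

theorem integral_target (hS : A.Sufficient) (f : Θ → ℝ) :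
    ∫ θ, f θ ∂A.target = ∫ θ, A.density θ * f θ ∂(vol Θ) := by
  rw [target, integral_withDensity_eq_integral_toReal_smul]
  · refine integral_congr_ae (Eventually.of_forall fun θ => ?_)
    simp [ENNReal.toReal_ofReal (density_pos hS θ).le]
  · exact (density_continuous hS).measurable.ennreal_ofReal
  · exact Eventually.of_forall fun θ => ENNReal.ofReal_lt_top

end Setup

end LAMCMC

/-! ### Nearest points and the fitted local model -/

namespace LAMCMC

variable {d m n : ℕ} {Θ : Set (E d)}

/-- The sort key of the order `Before`. -/
def sortKey (θ s : Θ) : ℝ ×ₗ Lex (Fin d → ℝ) :=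
  toLex (dist s θ, toLex fun i => (s : E d) i)

theorem before_iff (θ s t : Θ) : Before θ s t ↔ sortKey θ s < sortKey θ t := by
  rw [sortKey, sortKey, Prod.Lex.toLex_lt_toLex]
  rfl

theorem sortKey_injective (θ : Θ) : Function.Injective (sortKey θ) := by
  intro s t h
  have h2 : (fun i => (s : E d) i) = fun i => (t : E d) i :=
    congrArg (fun p : ℝ ×ₗ Lex (Fin d → ℝ) => ofLex (ofLex p).2) h
  apply Subtype.ext
  ext i
  exact congrFun h2 i

theorem nearest_subset (k : ℕ) (θ : Θ) (S : Finset Θ) : nearest k θ S ⊆ S :=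
  Finset.filter_subset _ _

theorem nearest_one_eq {θ : Θ} {S : Finset Θ} (hS : S.Nonempty) :
    ∃ s ∈ S, nearest 1 θ S = {s} := by
  classical
  obtain ⟨s, hs, hmin⟩ := S.exists_min_image (sortKey θ) hS
  refine ⟨s, hs, ?_⟩
  ext t
  simp only [nearest, Finset.mem_filter, Nat.lt_one_iff, Finset.card_eq_zero, Finset.mem_singleton,
    Finset.filter_eq_empty_iff, before_iff, not_lt]
  constructor
  · rintro ⟨ht, h⟩
    exact sortKey_injective θ (le_antisymm (h hs) (hmin t ht))
  · rintro rfl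
    exact ⟨hs, fun u hu => hmin u hu⟩

theorem nearest_nonempty {k : ℕ} (hk : 0 < k) {θ : Θ} {S : Finset Θ} (hS : S.Nonempty) :
    (nearest k θ S).Nonempty := by
  classical
  obtain ⟨s, hs, hmin⟩ := S.exists_min_image (sortKey θ) hS
  refine ⟨s, ?_⟩
  simp only [nearest, Finset.mem_filter, before_iff]
  refine ⟨hs, ?_⟩
  rw [Finset.filter_false_of_mem fun t ht => not_lt.2 (hmin t ht)]
  simpa using hk

/-- A point at distance at least R would be preceded by all of T, that is, by at least k points. -/
theorem dist_lt_of_mem_nearest {k : ℕ} {θ : Θ} {S T : Finset Θ} {R : ℝ} (hT : T ⊆ S)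
    (hk : k ≤ T.card) (hR : ∀ t ∈ T, dist t θ < R) {s : Θ} (hs : s ∈ nearest k θ S) :
    dist s θ < R := by
  classical
  by_contra! h
  have hs2 := (Finset.mem_filter.1 hs).2
  refine absurd (lt_of_le_of_lt (hk.trans (Finset.card_le_card fun t ht => ?_)) hs2) (lt_irrefl _)
  exact Finset.mem_filter.2 ⟨hT ht, Or.inl ((hR t ht).trans_le h)⟩

/-- Every point of Y precedes every point of F. This allows the nodes at a point to be prescribed
while the rest of the sample set is chosen freely far away. -/
theorem nearest_union_eq [DecidableEq Θ] {θ : Θ} {F Y : Finset Θ} {R : ℝ}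
    (hY : ∀ y ∈ Y, dist y θ < R) (hF : ∀ y ∈ F, R ≤ dist y θ) :
    nearest Y.card θ (F ∪ Y) = Y := by
  classical
  ext s
  constructor
  · intro hs
    have hd := dist_lt_of_mem_nearest Finset.subset_union_right le_rfl hY hs
    rcases Finset.mem_union.1 (nearest_subset _ _ _ hs) with h | h
    · exact absurd hd (not_lt.2 (hF s h))
    · exact h
  · intro hs
    refine Finset.mem_filter.2 ⟨Finset.mem_union_right _ hs, ?_⟩
    refine Finset.card_lt_card (Finset.ssubset_iff_of_subset ?_ |>.2 ⟨s, hs, ?_⟩)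
    · intro t ht
      obtain ⟨ht1, ht2⟩ := Finset.mem_filter.1 ht
      rcases Finset.mem_union.1 ht1 with h | h
      · exfalso
        rcases ht2 with h2 | ⟨h2, -⟩
        · linarith [hF t h, hY s hs]
        · linarith [hF t h, hY s hs]
      · exact h
    · simp [before_iff]

theorem fit_of_existsUnique {g : Θ → ℝ} {θ : Θ} {Y : Finset Θ}
    (h : ∃! P : E d → ℝ, Interpolates Y g P) {P : E d → ℝ} (hP : Interpolates Y g P) :
    fit g θ Y = P := by
  rw [fit, dif_pos h]
  exact h.unique h.choose_spec.1 hP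

theorem fit_fallback {g : Θ → ℝ} {θ : Θ} {Y : Finset Θ} (hY : Y.Nonempty)
    (h : ¬ ∃! P : E d → ℝ, Interpolates Y g P) : ∃ s ∈ Y, fit g θ Y = fun _ => g s := by
  obtain ⟨s, hs, he⟩ := nearest_one_eq (θ := θ) hY
  refine ⟨s, hs, ?_⟩
  rw [fit, dif_neg h]
  funext x
  rw [he, Finset.sum_singleton]

theorem isQuadratic_const (a : ℝ) : IsQuadratic fun _ : E d => a :=
  ⟨(a, 0, 0), by funext x; simp [quad]⟩

theorem isQuadratic_fit (g : Θ → ℝ) (θ : Θ) (Y : Finset Θ) : IsQuadratic (fit g θ Y) := by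
  by_cases h : ∃! P : E d → ℝ, Interpolates Y g P
  · rw [fit, dif_pos h]
    exact h.choose_spec.1.1
  · rw [fit, dif_neg h]
    exact isQuadratic_const _

theorem continuous_quad : Continuous fun p : QuadCoef d × E d => quad p.1 p.2 := by
  unfold quad
  fun_prop

theorem IsQuadratic.continuous {P : E d → ℝ} (hP : IsQuadratic P) : Continuous P := by
  obtain ⟨c, rfl⟩ := hP
  exact continuous_quad.comp (Continuous.prodMk continuous_const continuous_id)

theorem numNodes_pos : 0 < numNodes d := by
  unfold numNodes
  exact Nat.div_pos (by nlinarith [Nat.zero_le d]) two_pos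

end LAMCMC

/-! ### The space of quadratics: dimension, extrapolation along lines, interpolation sets -/

namespace LAMCMC

variable {d m n : ℕ} {Θ : Set (E d)}

/-- The polynomial with given coefficients, as a linear map. -/
def quadL (d : ℕ) : QuadCoef d →ₗ[ℝ] (E d → ℝ) where
  toFun := quad
  map_add' c c' := by
    funext x
    simp only [quad, Prod.fst_add, Prod.snd_add, Pi.add_apply, add_mul, Finset.sum_add_distrib]
    ring
  map_smul' a c := by
    funext x
    simp only [quad, Prod.smul_fst, Prod.smul_snd, Pi.smul_apply, smul_eq_mul, mul_add,
      Finset.mul_sum, RingHom.id_apply]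
    simp only [mul_assoc]

/-- The space of polynomials of degree at most two. -/
def quadSpace (d : ℕ) : Submodule ℝ (E d → ℝ) := LinearMap.range (quadL d)

theorem mem_quadSpace {P : E d → ℝ} : P ∈ quadSpace d ↔ IsQuadratic P := by
  simp only [quadSpace, LinearMap.mem_range, IsQuadratic, eq_comm (a := P)]
  rfl

instance : FiniteDimensional ℝ (quadSpace d) :=
  inferInstanceAs (FiniteDimensional ℝ (LinearMap.range (quadL d)))

/-- Coefficient vectors with upper triangular quadratic part. -/
abbrev UpperCoef (d : ℕ) : Type :=
  ℝ × (Fin d → ℝ) × ({p : Fin d × Fin d // p.1 ≤ p.2} → ℝ)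

/-- The coefficients given by an upper triangular coefficient vector. -/
def upperL (d : ℕ) : UpperCoef d →ₗ[ℝ] QuadCoef d where
  toFun c := (c.1, c.2.1, fun i j => if h : i ≤ j then c.2.2 ⟨(i, j), h⟩ else 0)
  map_add' c c' := by
    refine Prod.ext rfl (Prod.ext rfl ?_)
    funext i j
    by_cases h : i ≤ j <;> simp [h]
  map_smul' a c := by
    refine Prod.ext rfl (Prod.ext rfl ?_)
    funext i j
    by_cases h : i ≤ j <;> simp [h]

theorem quad_zero_right (c : QuadCoef d) : quad c 0 = c.1 := by simp [quad]

theorem quad_single (c : QuadCoef d) (i : Fin d) (t : ℝ) :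
    quad c (EuclideanSpace.single i t) = c.1 + c.2.1 i * t + c.2.2 i i * t * t := by
  simp [quad, Finset.sum_ite_eq']

theorem quad_single_add (c : QuadCoef d) (i j : Fin d) :
    quad c (EuclideanSpace.single i 1 + EuclideanSpace.single j 1) =
      c.1 + (c.2.1 i + c.2.1 j) + (c.2.2 i i + c.2.2 i j + (c.2.2 j i + c.2.2 j j)) := by
  simp [quad, mul_add, Finset.sum_add_distrib]
  ring

/-- A polynomial does not determine a full coefficient matrix, but it does determine an upper
triangular one: the values at 0, ±e_i and e_i + e_j recover every entry. This uniqueness serves the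
dimension count and the measurability of the fitted coefficients. -/
theorem quadL_comp_upperL_injective :
    Function.Injective ((quadL d).comp (upperL d)) := by
  rw [← LinearMap.ker_eq_bot, LinearMap.ker_eq_bot']
  intro c hc
  have h : ∀ x, quad (upperL d c) x = 0 := fun x => congrFun hc x
  have h0 : c.1 = 0 := by have := h 0; rwa [quad_zero_right] at this
  have h1 : ∀ i, c.2.1 i = 0 ∧ c.2.2 ⟨(i, i), le_rfl⟩ = 0 := fun i => by
    have ha := h (EuclideanSpace.single i 1)
    have hb := h (EuclideanSpace.single i (-1))
    rw [quad_single] at ha hb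
    simp only [upperL, LinearMap.coe_mk, AddHom.coe_mk, le_refl, dite_true] at ha hb
    constructor <;> linarith
  refine Prod.ext h0 (Prod.ext (funext fun i => (h1 i).1) (funext ?_))
  rintro ⟨⟨i, j⟩, hij⟩
  rcases eq_or_ne i j with rfl | hne
  · exact (h1 i).2
  · have ha := h (EuclideanSpace.single i 1 + EuclideanSpace.single j 1)
    rw [quad_single_add _ i j] at ha
    have hji : ¬ j ≤ i := fun h' => hne (le_antisymm hij h')
    simp only [upperL, LinearMap.coe_mk, AddHom.coe_mk, le_refl, dite_true, dif_neg hji,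
      dif_pos (show i ≤ j from hij)] at ha
    have := h1 i
    have := h1 j
    change c.2.2 ⟨(i, j), hij⟩ = 0
    linarith [(h1 i).1, (h1 i).2, (h1 j).1, (h1 j).2]

theorem isQuadratic_mul (a a' : ℝ) (b b' : Fin d → ℝ) :
    IsQuadratic fun x : E d => (a + ∑ i, b i * x i) * (a' + ∑ i, b' i * x i) := by
  refine ⟨(a * a', fun i => a * b' i + a' * b i, fun i j => b i * b' j), ?_⟩
  funext x
  simp only [quad, add_mul, mul_add, Finset.sum_add_distrib, Finset.mul_sum,
    Finset.sum_mul]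
  have : ∀ i j, b i * x i * (b' j * x j) = b i * b' j * x i * x j := fun i j => by ring
  simp only [this]
  have h2 : ∀ i, a * (b' i * x i) = a * b' i * x i := fun i => by ring
  have h3 : ∀ i, b i * x i * a' = a' * b i * x i := fun i => by ring
  simp only [h2, h3]
  rw [Finset.sum_comm (f := fun i j => b j * b' i * x j * x i)]
  ring

/-- Folding the lower triangle onto the upper one, x_i x_j with i < j receives the sum of the two
mirrored coefficients. -/
theorem range_quadL_comp_upperL : LinearMap.range ((quadL d).comp (upperL d)) = quadSpace d := by
  refine le_antisymm (LinearMap.range_comp_le_range _ _) ?_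
  rintro _ ⟨c, rfl⟩
  refine ⟨(c.1, c.2.1, fun p => if p.1.1 = p.1.2 then c.2.2 p.1.1 p.1.1 else
    c.2.2 p.1.1 p.1.2 + c.2.2 p.1.2 p.1.1), ?_⟩
  funext x
  simp only [quadL, upperL, LinearMap.comp_apply, LinearMap.coe_mk, AddHom.coe_mk, quad]
  congr 1
  set F : Fin d → Fin d → ℝ := fun i j => c.2.2 i j * x i * x j with hF
  have key : ∀ i j : Fin d, (if h : i ≤ j then (if i = j then c.2.2 i i else
      c.2.2 i j + c.2.2 j i) else 0) * x i * x j =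
      (if i ≤ j then F i j else 0) + (if i < j then F j i else 0) := by
    intro i j
    rcases lt_trichotomy i j with h | rfl | h
    · simp only [h.le, h.ne, h, dite_true, if_true, if_false, hF]; ring
    · simp [hF]
    · simp [not_le.2 h, not_lt.2 h.le]
  simp only [dite_eq_ite] at key ⊢
  simp only [key, Finset.sum_add_distrib]
  -- After the exchange of sums, the mirrored terms fill the lower triangle of the full double sum.
  rw [Finset.sum_comm (f := fun i j => if i < j then F j i else 0), ← Finset.sum_add_distrib]
  refine Finset.sum_congr rfl fun i _ => ?_
  rw [← Finset.sum_add_distrib]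
  refine Finset.sum_congr rfl fun j _ => ?_
  rcases le_or_gt i j with h | h
  · simp [h, not_lt.2 h, hF]
  · simp [h, not_le.2 h, hF]

theorem finrank_quadSpace : Module.finrank ℝ (quadSpace d) = numNodes d := by
  rw [← range_quadL_comp_upperL, LinearMap.finrank_range_of_inj quadL_comp_upperL_injective]
  have hc : Fintype.card {p : Fin d × Fin d // p.1 ≤ p.2} = (d + 1).choose 2 := by
    rw [← Fintype.card_congr (Sym2.sortEquiv (α := Fin d)), Sym2.card, Fintype.card_fin]
  rw [Module.finrank_prod, Module.finrank_prod, Module.finrank_fintype_fun_eq_card,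
    Module.finrank_fintype_fun_eq_card, Module.finrank_self, hc, Fintype.card_fin,
    Nat.choose_two_right, numNodes, Nat.add_sub_cancel]
  have : (d + 1) * (d + 2) = (d + 1) * d + (1 + d) * 2 := by ring
  rw [this, Nat.add_mul_div_right _ _ two_pos]
  omega

theorem IsQuadratic.line {P : E d → ℝ} (hP : IsQuadratic P) (p u : E d) :
    ∃ a b c : ℝ, ∀ t : ℝ, P (p + t • u) = a + b * t + c * t ^ 2 := by
  obtain ⟨c, rfl⟩ := hP
  refine ⟨quad c p, ∑ i, c.2.1 i * u i + ∑ i, ∑ j, (c.2.2 i j * u i * p j + c.2.2 i j * p i * u j),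
    ∑ i, ∑ j, c.2.2 i j * u i * u j, fun t => ?_⟩
  simp only [quad, PiLp.add_apply, PiLp.smul_apply, smul_eq_mul, mul_add, add_mul,
    Finset.sum_add_distrib, Finset.sum_mul]
  have h1 : ∀ i, c.2.1 i * (t * u i) = c.2.1 i * u i * t := fun i => by ring
  have h2 : ∀ i j, c.2.2 i j * (t * u i) * p j = c.2.2 i j * u i * p j * t := fun i j => by ring
  have h3 : ∀ i j, c.2.2 i j * p i * (t * u j) = c.2.2 i j * p i * u j * t := fun i j => by ring
  have h4 : ∀ i j, c.2.2 i j * (t * u i) * (t * u j) = c.2.2 i j * u i * u j * t ^ 2 :=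
    fun i j => by ring
  simp only [h1, h2, h3, h4]
  ring

/-- Extrapolation to `t = 1` of the values of a quadratic function of `t` at `-s`, `0`, `s`. -/
def extrap (s a b c : ℝ) : ℝ := b + (c - a) / (2 * s) + (c - 2 * b + a) / (2 * s ^ 2)

theorem IsQuadratic.extrap {P : E d → ℝ} (hP : IsQuadratic P) (p u : E d) {s : ℝ} (hs : s ≠ 0) :
    P (p + u) = extrap s (P (p - s • u)) (P p) (P (p + s • u)) := by
  obtain ⟨a, b, c, h⟩ := hP.line p u
  have h0 := h 0
  have h1 := h 1
  have h2 := h s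
  have h3 := h (-s)
  rw [zero_smul, add_zero] at h0
  rw [one_smul] at h1
  rw [neg_smul, ← sub_eq_add_neg] at h3
  rw [h0, h1, h2, h3, LAMCMC.extrap]
  field_simp
  ring

/-- Any x lies on a line through a point p of B, and three values near p on this line determine the
value at x. -/
theorem IsQuadratic.eq_zero_of_isOpen {P : E d → ℝ} (hP : IsQuadratic P) {B : Set (E d)}
    (hB : IsOpen B) (hne : B.Nonempty) (h : ∀ x ∈ B, P x = 0) : P = 0 := by
  obtain ⟨p, hp⟩ := hne
  funext x
  have hcont : Continuous fun s : ℝ => p + s • (x - p) := by fun_prop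
  have hcont' : Continuous fun s : ℝ => p - s • (x - p) := by fun_prop
  have e1 : ∀ᶠ s : ℝ in 𝓝 0, p + s • (x - p) ∈ B :=
    hcont.continuousAt.eventually_mem (hB.mem_nhds (by simpa using hp))
  have e2 : ∀ᶠ s : ℝ in 𝓝 0, p - s • (x - p) ∈ B :=
    hcont'.continuousAt.eventually_mem (hB.mem_nhds (by simpa using hp))
  have e3 : ∀ᶠ s : ℝ in 𝓝[≠] 0, s ≠ 0 := eventually_mem_nhdsWithin
  obtain ⟨s, ⟨hs1, hs2⟩, hs0⟩ := (((e1.and e2).filter_mono nhdsWithin_le_nhds).and e3).exists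
  have := hP.extrap p (x - p) hs0
  rw [add_sub_cancel, h _ hs1, h _ hs2, h _ hp] at this
  simpa [LAMCMC.extrap] using this

/-- The quadratic polynomials that vanish on `Y`. -/
def vanishing (Y : Finset (E d)) : Submodule ℝ (E d → ℝ) where
  carrier := {P | IsQuadratic P ∧ ∀ y ∈ Y, P y = 0}
  zero_mem' := ⟨isQuadratic_const 0, fun _ _ => rfl⟩
  add_mem' {P Q} hP hQ := ⟨mem_quadSpace.1 (add_mem (mem_quadSpace.2 hP.1) (mem_quadSpace.2 hQ.1)),
    fun y hy => by simp [hP.2 y hy, hQ.2 y hy]⟩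
  smul_mem' a P hP := ⟨mem_quadSpace.1 (Submodule.smul_mem _ a (mem_quadSpace.2 hP.1)),
    fun y hy => by simp [hP.2 y hy]⟩

theorem mem_vanishing {Y : Finset (E d)} {P : E d → ℝ} :
    P ∈ vanishing Y ↔ IsQuadratic P ∧ ∀ y ∈ Y, P y = 0 := Iff.rfl

theorem vanishing_le (Y : Finset (E d)) : vanishing Y ≤ quadSpace d :=
  fun _ hP => mem_quadSpace.2 hP.1

instance (Y : Finset (E d)) : FiniteDimensional ℝ (vanishing Y) :=
  Submodule.finiteDimensional_of_le (vanishing_le Y)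

/-- Interpolation on `Y` is solvable, `Y` has the right size, and the functional `D` does not vanish on
the polynomials that vanish on `Y`. -/
structure Extendable (D : (E d → ℝ) →ₗ[ℝ] ℝ) (Y : Finset (E d)) : Prop where
  card : Module.finrank ℝ (vanishing Y) + Y.card = numNodes d
  ne : ∃ P ∈ vanishing Y, D P ≠ 0
  interp : ∀ g : E d → ℝ, ∃ P, IsQuadratic P ∧ ∀ y ∈ Y, P y = g y

theorem extendable_empty {D : (E d → ℝ) →ₗ[ℝ] ℝ} {P : E d → ℝ} (hP : IsQuadratic P)
    (hD : D P ≠ 0) : Extendable D ∅ := by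
  refine ⟨?_, ⟨P, ⟨hP, by simp⟩, hD⟩, fun g => ⟨_, isQuadratic_const 0, by simp⟩⟩
  have : vanishing (∅ : Finset (E d)) = quadSpace d := by
    ext P
    simp [mem_vanishing, mem_quadSpace]
  rw [this, finrank_quadSpace, Finset.card_empty, add_zero]

theorem IsQuadratic.add {P Q : E d → ℝ} (hP : IsQuadratic P) (hQ : IsQuadratic Q) :
    IsQuadratic (P + Q) :=
  mem_quadSpace.1 (add_mem (mem_quadSpace.2 hP) (mem_quadSpace.2 hQ))

theorem IsQuadratic.smul {P : E d → ℝ} (a : ℝ) (hP : IsQuadratic P) : IsQuadratic (a • P) :=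
  mem_quadSpace.1 (Submodule.smul_mem _ a (mem_quadSpace.2 hP))

open Classical in
-- The new node lowers the dimension of the vanishing space by one because f does not vanish there.
-- Since D f = 0, a polynomial on which D is nonzero can be corrected by a multiple of f to vanish
-- at the new node without changing its value under D.
theorem Extendable.insert {D : (E d → ℝ) →ₗ[ℝ] ℝ} {Y : Finset (E d)} (h : Extendable D Y)
    {f : E d → ℝ} (hf : f ∈ vanishing Y) (hD : D f = 0) {z : E d} (hz : f z ≠ 0) :
    Extendable D (insert z Y) := by
  have hzY : z ∉ Y := fun hzY => hz (hf.2 z hzY)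
  have hmem : ∀ P, P ∈ vanishing (Insert.insert z Y) ↔ P ∈ vanishing Y ∧ P z = 0 := fun P => by
    simp only [mem_vanishing, Finset.forall_mem_insert]
    tauto
  refine ⟨?_, ?_, fun g => ?_⟩
  · let L : vanishing Y →ₗ[ℝ] ℝ := (LinearMap.proj z).comp (vanishing Y).subtype
    have hL : LinearMap.range L = ⊤ := by
      rw [LinearMap.range_eq_top]
      intro a
      refine ⟨(a / f z) • ⟨f, hf⟩, ?_⟩
      change (a / f z) * f z = a
      field_simp
    have hk : (LinearMap.ker L).map (vanishing Y).subtype = vanishing (Insert.insert z Y) := by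
      ext P
      rw [hmem]
      constructor
      · rintro ⟨Q, hQ, rfl⟩
        exact ⟨Q.2, hQ⟩
      · rintro ⟨h1, h2⟩
        exact ⟨⟨P, h1⟩, h2, rfl⟩
    have h1 := LinearMap.finrank_range_add_finrank_ker L
    rw [hL, finrank_top, Module.finrank_self] at h1
    have h2 : Module.finrank ℝ (vanishing (Insert.insert z Y)) = Module.finrank ℝ (LinearMap.ker L) := by
      rw [← hk]
      exact Submodule.finrank_map_subtype_eq _ _
    have h3 := h.card
    rw [Finset.card_insert_of_notMem hzY, h2]
    omega
  · obtain ⟨P, hP, hDP⟩ := h.ne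
    refine ⟨P + (-(P z / f z)) • f, (hmem _).2
      ⟨add_mem hP (Submodule.smul_mem _ _ hf), ?_⟩, ?_⟩
    · simp only [Pi.add_apply, Pi.smul_apply, smul_eq_mul]
      field_simp
      ring
    · rw [map_add, map_smul, hD, smul_zero, add_zero]
      exact hDP
  · obtain ⟨P, hP, hPg⟩ := h.interp g
    refine ⟨P + ((g z - P z) / f z) • f, hP.add (hf.1.smul _), fun y hy => ?_⟩
    rcases Finset.mem_insert.1 hy with rfl | hy
    · simp only [Pi.add_apply, Pi.smul_apply, smul_eq_mul]
      field_simp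
      ring
    · simp [hPg y hy, hf.2 y hy]

open Classical in
-- While the vanishing space has dimension at least two, D kills some nonzero f in it. This f cannot
-- vanish on the whole open set B, so `Extendable.insert` applies with a node in B. The process ends
-- with a vanishing line on which D is still nonzero.
theorem Extendable.complete {D : (E d → ℝ) →ₗ[ℝ] ℝ} {B : Set (E d)} (hB : IsOpen B)
    (hne : B.Nonempty) (k : ℕ) : ∀ Y : Finset (E d), Extendable D Y →
    Module.finrank ℝ (vanishing Y) = k + 1 →
    ∃ Y', (∀ y ∈ Y', y ∈ Y ∨ y ∈ B) ∧ Y ⊆ Y' ∧ Extendable D Y' ∧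
      Module.finrank ℝ (vanishing Y') = 1 := by
  induction k with
  | zero => exact fun Y hY h1 => ⟨Y, fun y hy => Or.inl hy, subset_rfl, hY, h1⟩
  | succ k ih =>
    intro Y hY hk
    let L : vanishing Y →ₗ[ℝ] ℝ := D.comp (vanishing Y).subtype
    have h1 := LinearMap.finrank_range_add_finrank_ker L
    have h2 : Module.finrank ℝ (LinearMap.range L) ≤ 1 := by
      simpa using Submodule.finrank_le (LinearMap.range L)
    have h3 : LinearMap.ker L ≠ ⊥ := fun h => by
      rw [h, finrank_bot] at h1
      omega
    obtain ⟨f, hfk, hf0⟩ := (Submodule.ne_bot_iff _).1 h3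
    have : ∃ z ∈ B, f.1 z ≠ 0 := by
      by_contra! hcon
      exact hf0 (Subtype.ext (f.2.1.eq_zero_of_isOpen hB hne hcon))
    obtain ⟨z, hzB, hz⟩ := this
    have hY' := hY.insert f.2 hfk hz
    have hzY : z ∉ Y := fun hzY => hz (f.2.2 z hzY)
    have hc := hY.card
    have hc' := hY'.card
    rw [Finset.card_insert_of_notMem hzY] at hc'
    obtain ⟨Y', hY1, hY2, hY3, hY4⟩ := ih _ hY' (by omega)
    refine ⟨Y', fun y hy => ?_, (Finset.subset_insert _ _).trans hY2, hY3, hY4⟩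
    rcases hY1 y hy with h | h
    · rcases Finset.mem_insert.1 h with rfl | h
      · exact Or.inr hzB
      · exact Or.inl h
    · exact Or.inr h

end LAMCMC

/-! ### Node sets with arbitrarily large interpolants -/

namespace LAMCMC

variable {d m n : ℕ} {Θ : Set (E d)}

theorem isQuadratic_inner_mul (u w : E d) (a b : ℝ) :
    IsQuadratic fun y : E d => (a + inner ℝ u y) * (b + inner ℝ w y) := by
  have := isQuadratic_mul a b (fun i => u i) (fun i => w i)
  convert this using 4 <;>
  · rw [PiLp.inner_apply]
    refine Finset.sum_congr rfl fun i _ => ?_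
    simp [mul_comm]

theorem exists_orthogonal (hd : 2 ≤ d) (u : E d) : ∃ v : E d, v ≠ 0 ∧ inner ℝ u v = 0 := by
  have h1 := (Submodule.span ℝ {u}).finrank_add_finrank_orthogonal
  have h2 : Module.finrank ℝ (Submodule.span ℝ {u}) ≤ 1 := by
    simpa using finrank_span_le_card ({u} : Set (E d))
  have h3 : (Submodule.span ℝ {u})ᗮ ≠ ⊥ := fun h => by
    rw [h, finrank_bot, finrank_euclideanSpace, Fintype.card_fin] at h1
    omega
  obtain ⟨v, hv, hv0⟩ := (Submodule.ne_bot_iff _).1 h3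
  exact ⟨v, hv0, Submodule.mem_orthogonal_singleton_iff_inner_right.1 hv⟩

/-- Half the difference of the values at `x + v` and `x - v`. -/
def centralDiff (x v : E d) : (E d → ℝ) →ₗ[ℝ] ℝ :=
  (1 / 2 : ℝ) • (LinearMap.proj (R := ℝ) (φ := fun _ : E d => ℝ) (x + v) -
    LinearMap.proj (R := ℝ) (φ := fun _ : E d => ℝ) (x - v))

theorem centralDiff_apply (x v : E d) (P : E d → ℝ) :
    centralDiff x v P = (P (x + v) - P (x - v)) / 2 := by
  change (1 / 2 : ℝ) * (P (x + v) - P (x - v)) = _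
  ring

open Classical in
-- Three nodes on the line through p and x make every quadratic vanishing on Y vanish at x too,
-- while the central difference in a direction v orthogonal to that line stays nonzero on the
-- generator of the vanishing space. The three nodes are inserted with the help of polynomials in
-- ⟨u, ·⟩ alone, which the central difference along v kills.
theorem exists_extendable (hd : 2 ≤ d) {p x : E d} (hxp : x ≠ p) {s : ℝ} (hs : s ≠ 0)
    {B : Set (E d)} (hB : IsOpen B) (hne : B.Nonempty) :
    ∃ (v : E d) (Y : Finset (E d)), Extendable (centralDiff x v) Y ∧
      Module.finrank ℝ (vanishing Y) = 1 ∧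
      p - s • (x - p) ∈ Y ∧ p ∈ Y ∧ p + s • (x - p) ∈ Y ∧
      ∀ y ∈ Y, y = p - s • (x - p) ∨ y = p ∨ y = p + s • (x - p) ∨ y ∈ B := by
  set u := x - p with hu
  have hu0 : inner ℝ u u ≠ 0 := by rw [Ne, inner_self_eq_zero, hu, sub_eq_zero]; exact hxp
  obtain ⟨v, hv, huv⟩ := exists_orthogonal hd u
  have h0 : Extendable (centralDiff x v) ∅ := by
    -- The starting polynomial is ⟨v, ·⟩, whose central difference is ⟨v, v⟩.
    refine extendable_empty (isQuadratic_inner_mul v 0 0 1) ?_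
    rw [centralDiff_apply]
    have : inner ℝ v v ≠ 0 := by rwa [Ne, inner_self_eq_zero]
    simp only [inner_add_right, inner_sub_right, inner_zero_left]
    intro h
    apply this
    linarith
  have h1 : Extendable (centralDiff x v) (insert (p - s • u) ∅) := by
    refine h0.insert (f := fun y => (1 + inner ℝ 0 y) * (1 + inner ℝ 0 y))
      ⟨isQuadratic_inner_mul _ _ _ _, by simp⟩ ?_ ?_
    · rw [centralDiff_apply]; simp
    · simp
  have h2 : Extendable (centralDiff x v) (insert p (insert (p - s • u) ∅)) := by
    refine h1.insert (f := fun y => (-inner ℝ u (p - s • u) + inner ℝ u y) * (1 + inner ℝ 0 y))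
      ⟨isQuadratic_inner_mul _ _ _ _, by simp⟩ ?_ ?_
    · rw [centralDiff_apply]; simp [inner_add_right, inner_sub_right, huv]
    · simp only [inner_sub_right, inner_smul_right, inner_zero_left]
      intro h
      apply mul_ne_zero hs hu0
      linarith
  have h3 : Extendable (centralDiff x v) (insert (p + s • u) (insert p (insert (p - s • u) ∅))) := by
    refine h2.insert (f := fun y =>
      (-inner ℝ u (p - s • u) + inner ℝ u y) * (-inner ℝ u p + inner ℝ u y))
      ⟨isQuadratic_inner_mul _ _ _ _, by simp⟩ ?_ ?_
    · rw [centralDiff_apply]; simp [inner_add_right, inner_sub_right, huv]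
    · simp only [inner_sub_right, inner_add_right, inner_smul_right]
      have := mul_ne_zero hs hu0
      intro h
      have h' : (s * inner ℝ u u) * (s * inner ℝ u u) = 0 := by linarith
      rcases mul_eq_zero.1 h' with h' | h' <;> exact this h'
  obtain ⟨k, hk⟩ : ∃ k, Module.finrank ℝ
      (vanishing (insert (p + s • u) (insert p (insert (p - s • u) ∅)))) = k + 1 := by
    refine Nat.exists_eq_succ_of_ne_zero fun h => ?_
    obtain ⟨P, hP, hDP⟩ := h3.ne
    have hbot := Submodule.finrank_eq_zero.1 h
    rw [hbot, Submodule.mem_bot] at hP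
    exact hDP (by rw [hP, map_zero])
  obtain ⟨Y, hY1, hY2, hY3, hY4⟩ := Extendable.complete hB hne k _ h3 hk
  refine ⟨v, Y, hY3, hY4, hY2 (by simp), hY2 (by simp), hY2 (by simp), fun y hy => ?_⟩
  have := hY1 y hy
  simp only [Finset.mem_insert, Finset.notMem_empty, or_false] at this
  tauto

/-- The quotient tends to +∞ as t tends to 0 from the side given by the sign of a. -/
theorem exists_lt_div_of_tendsto {f : ℝ → ℝ} {a : ℝ} (hf : Tendsto f (𝓝 0) (𝓝 a)) (ha : a ≠ 0)
    {p : ℝ → Prop} (hp : ∀ᶠ t in 𝓝 0, p t) (M : ℝ) : ∃ t, t ≠ 0 ∧ p t ∧ M < f t / t := by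
  rcases lt_or_gt_of_ne ha with h | h
  · have h1 : Tendsto (fun t => f t * t⁻¹) (𝓝[<] 0) atTop :=
      (hf.mono_left nhdsWithin_le_nhds).neg_mul_atBot h tendsto_inv_nhdsLT_zero
    obtain ⟨t, ⟨h1, h2⟩, h3⟩ := (((h1.eventually_gt_atTop M).and
      (hp.filter_mono nhdsWithin_le_nhds)).and eventually_mem_nhdsWithin).exists
    exact ⟨t, ne_of_lt h3, h2, by rwa [div_eq_mul_inv]⟩
  · have h1 : Tendsto (fun t => f t * t⁻¹) (𝓝[>] 0) atTop :=
      (hf.mono_left nhdsWithin_le_nhds).pos_mul_atTop h tendsto_inv_nhdsGT_zero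
    obtain ⟨t, ⟨h1, h2⟩, h3⟩ := (((h1.eventually_gt_atTop M).and
      (hp.filter_mono nhdsWithin_le_nhds)).and eventually_mem_nhdsWithin).exists
    exact ⟨t, ne_of_gt h3, h2, by rwa [div_eq_mul_inv]⟩

/-- If the values of `g` at four collinear points are not those of a quadratic, there are interpolation
sets near these points and in a given ball for which the interpolant of `g` is as large as we please at a
given point of the ball. -/
theorem exists_interpolant_gt (hd : 2 ≤ d) {p x : E d} (hxp : x ≠ p) {s : ℝ} (hs : s ≠ 0)
    {B : Set (E d)} (hB : IsOpen B) (hne : B.Nonempty) {g : E d → ℝ} (hg : ContinuousAt g x)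
    (hgx : g x ≠ extrap s (g (p - s • (x - p))) (g p) (g (p + s • (x - p))))
    {V : Set (E d)} (hV : V ∈ 𝓝 x) :
    ∃ θ ∈ B, ∀ M : ℝ, ∃ Y : Finset (E d), Y.card = numNodes d ∧
      (∀ y ∈ Y, (y = p - s • (x - p) ∨ y = p ∨ y = p + s • (x - p) ∨ y ∈ B) ∨ y ∈ V) ∧
      (∃ P, IsQuadratic P ∧ (∀ y ∈ Y, P y = g y) ∧ M < P θ) ∧
      ∀ P, IsQuadratic P → (∀ y ∈ Y, P y = 0) → P = 0 := by
  classical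
  obtain ⟨v, Y, hY, hfr, h1, h2, h3, hYB⟩ := exists_extendable hd hxp hs hB hne
  obtain ⟨w, hw, hDw⟩ := hY.ne
  obtain ⟨Q, hQ, hQg⟩ := hY.interp g
  have hw0 : w ≠ 0 := fun h => hDw (by rw [h, map_zero])
  have hspan : ∀ P ∈ vanishing Y, ∃ c : ℝ, c • w = P := fun P hP => by
    obtain ⟨c, hc⟩ := (finrank_eq_one_iff_of_nonzero' (⟨w, hw⟩ : vanishing Y)
      (fun h => hw0 (congrArg Subtype.val h))).1 hfr ⟨P, hP⟩
    exact ⟨c, congrArg Subtype.val hc⟩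
  -- The generator w has three zeros on the line through p and x, so it vanishes on the whole line.
  have hwx : w x = 0 := by
    have := hw.1.extrap p (x - p) hs
    rw [add_sub_cancel, hw.2 _ h1, hw.2 _ h2, hw.2 _ h3] at this
    simpa [extrap] using this
  -- Q extrapolates to x from the values of g at the three collinear nodes, and by `hgx` this misses
  -- g x.
  have hQx : Q x ≠ g x := by
    have := hQ.extrap p (x - p) hs
    rw [add_sub_cancel, hQg _ h1, hQg _ h2, hQg _ h3] at this
    rw [this]
    exact hgx.symm
  obtain ⟨a, b, c, hline⟩ := hw.1.line x v
  have ha : a = 0 := by simpa [hwx] using (hline 0).symm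
  -- On a quadratic the central difference is exactly the linear coefficient along v.
  have hb : b ≠ 0 := by
    rw [centralDiff_apply] at hDw
    have e1 := hline 1
    have e2 := hline (-1)
    rw [one_smul] at e1
    rw [neg_one_smul, ← sub_eq_add_neg] at e2
    rw [e1, e2] at hDw
    intro hb
    apply hDw
    rw [hb]; ring
  obtain ⟨θ, hθB, hθ⟩ : ∃ θ ∈ B, w θ ≠ 0 := by
    by_contra! hcon
    exact hw0 (hw.1.eq_zero_of_isOpen hB hne hcon)
  refine ⟨θ, hθB, fun M => ?_⟩
  have hcont : ContinuousAt (fun t : ℝ => x + t • v) 0 := by fun_prop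
  have hx0 : x + (0 : ℝ) • v = x := by simp
  have hden : Tendsto (fun t : ℝ => b + c * t) (𝓝 0) (𝓝 b) := by
    have : Continuous fun t : ℝ => b + c * t := by fun_prop
    simpa using this.tendsto 0
  have hnum : Tendsto (fun t : ℝ => g (x + t • v) - Q (x + t • v)) (𝓝 0) (𝓝 (g x - Q x)) := by
    have hg' : ContinuousAt g (x + (0 : ℝ) • v) := by rwa [hx0]
    have e1 := (ContinuousAt.comp (f := fun t : ℝ => x + t • v) hg' hcont).tendsto
    have e2 := ((hQ.continuous.continuousAt).comp hcont).tendsto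
    simp only [Function.comp_def, hx0] at e1 e2
    exact e1.sub e2
  -- The last node is z = x + t v. It forces the multiple (g z - Q z) / (t (b + c t)) of w, whose
  -- numerator tends to g x - Q x ≠ 0, so a suitable small t of the right sign pushes the value at θ
  -- above M.
  obtain ⟨t, ht0, ⟨htV, htb⟩, htM⟩ := exists_lt_div_of_tendsto
    ((hnum.mul_const (w θ)).div hden hb)
    (div_ne_zero (mul_ne_zero (sub_ne_zero.2 hQx.symm) hθ) hb)
    ((hcont.eventually_mem (by rwa [hx0])).and (hden.eventually_ne hb)) (M - Q θ)
  set z := x + t • v with hz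
  have hwz : w z = t * (b + c * t) := by rw [hz, hline, ha]; ring
  have hwz0 : w z ≠ 0 := by rw [hwz]; exact mul_ne_zero ht0 htb
  have hzY : z ∉ Y := fun h => hwz0 (hw.2 z h)
  refine ⟨insert z Y, ?_, ?_, ⟨Q + ((g z - Q z) / w z) • w, hQ.add (hw.1.smul _), ?_, ?_⟩, ?_⟩
  · rw [Finset.card_insert_of_notMem hzY]
    have := hY.card
    omega
  · intro y hy
    rcases Finset.mem_insert.1 hy with rfl | hy
    · exact Or.inr htV
    · exact Or.inl (hYB y hy)
  · intro y hy
    rcases Finset.mem_insert.1 hy with rfl | hy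
    · simp only [Pi.add_apply, Pi.smul_apply, smul_eq_mul]
      field_simp
      ring
    · simp [hQg y hy, hw.2 y hy]
  · simp only [Pi.add_apply, Pi.smul_apply, smul_eq_mul]
    have : (g z - Q z) * w θ / (b + c * t) / t = (g z - Q z) / w z * w θ := by
      rw [hwz]; field_simp
    simp only [Pi.div_apply] at htM
    rw [this] at htM
    linarith
  · intro P hP hP0
    obtain ⟨k, rfl⟩ := hspan P ⟨hP, fun y hy => hP0 y (Finset.mem_insert_of_mem hy)⟩
    have := hP0 z (Finset.mem_insert_self _ _)
    simp only [Pi.smul_apply, smul_eq_mul] at this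
    rcases mul_eq_zero.1 this with h | h
    · rw [h, zero_smul]
    · exact absurd h hwz0

end LAMCMC

/-! ### Measurability of functions and selections of finite point sets -/

namespace LAMCMC

variable {d m n : ℕ} {Θ : Set (E d)}

/-- A closed subset of a σ-compact space is σ-compact, so its projection is a countable union of
compact sets. This makes conditions of the form "there are coefficients such that" measurable
without any selection argument. -/
theorem measurableSet_exists_of_isClosed {X K : Type*} [TopologicalSpace X] [TopologicalSpace K]
    [SigmaCompactSpace X] [SigmaCompactSpace K] [T2Space X] [MeasurableSpace X]
    [OpensMeasurableSpace X] {C : Set (K × X)} (hC : IsClosed C) :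
    MeasurableSet {x | ∃ c, (c, x) ∈ C} := by
  have h1 : IsSigmaCompact C := isSigmaCompact_univ.of_isClosed_subset hC (Set.subset_univ _)
  obtain ⟨K', hK, hU⟩ := h1.image continuous_snd
  have : {x | ∃ c, (c, x) ∈ C} = ⋃ n, K' n := by
    rw [hU]
    ext x
    simp
  rw [this]
  exact MeasurableSet.iUnion fun n => (hK n).isClosed.measurableSet

open Classical in
/-- Measurability of a function of a finite set of points, in terms of enumerations of the set. -/
def MeasOn {X β : Type*} [MeasurableSpace X] [MeasurableSpace β] (F : X → Finset Θ → β) : Prop :=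
  ∀ J : Finset ℕ, Measurable fun p : X × (ℕ → Θ) => F p.1 (J.image p.2)

open Classical in
/-- Measurability of a selection of a subset of a finite set of points. -/
def Selects {X : Type*} [MeasurableSpace X] (sel : X → Finset Θ → Finset Θ) : Prop :=
  (∀ x S, sel x S ⊆ S) ∧
    ∀ J : Finset ℕ, ∀ i ∈ J, MeasurableSet {p : X × (ℕ → Θ) | p.2 i ∈ sel p.1 (J.image p.2)}

section

variable {X X' β β' : Type*} [MeasurableSpace X] [MeasurableSpace X'] [MeasurableSpace β]
  [MeasurableSpace β']

open Classical in
theorem Selects.image_filter {sel : X → Finset Θ → Finset Θ} (h : Selects sel) (x : X) (v : ℕ → Θ)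
    (J : Finset ℕ) : (J.filter fun i => v i ∈ sel x (J.image v)).image v = sel x (J.image v) := by
  ext s
  simp only [Finset.mem_image, Finset.mem_filter]
  constructor
  · rintro ⟨i, ⟨-, hi⟩, rfl⟩
    exact hi
  · intro hs
    obtain ⟨i, hi, rfl⟩ := Finset.mem_image.1 (h.1 _ _ hs)
    exact ⟨i, ⟨hi, hs⟩, rfl⟩

open Classical in
-- The set of selected indices takes only finitely many values I ⊆ J, each on a measurable event, so
-- H may be treated with I frozen.
theorem Selects.measurable_index {sel : X → Finset Θ → Finset Θ} (h : Selects sel) (J : Finset ℕ)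
    (H : Finset ℕ → X × (ℕ → Θ) → β) (hH : ∀ I ⊆ J, Measurable (H I)) :
    Measurable fun p : X × (ℕ → Θ) =>
      H (J.filter fun i => p.2 i ∈ sel p.1 (J.image p.2)) p := by
  intro T hT
  have : (fun p : X × (ℕ → Θ) => H (J.filter fun i => p.2 i ∈ sel p.1 (J.image p.2)) p) ⁻¹' T =
      ⋃ I ∈ J.powerset, ((⋂ i ∈ J, {p : X × (ℕ → Θ) | i ∈ I ↔ p.2 i ∈ sel p.1 (J.image p.2)}) ∩
        H I ⁻¹' T) := by
    ext p
    simp only [Set.mem_preimage, Set.mem_iUnion, Set.mem_inter_iff, Set.mem_iInter,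
      Set.mem_ofPred_eq, Finset.mem_powerset, exists_prop]
    constructor
    · intro hp
      exact ⟨_, Finset.filter_subset _ _, fun i hi => by simp [hi], hp⟩
    · rintro ⟨I, hI, h1, h2⟩
      have : (J.filter fun i => p.2 i ∈ sel p.1 (J.image p.2)) = I := by
        ext i
        rw [Finset.mem_filter]
        exact ⟨fun hi => (h1 i hi.1).2 hi.2, fun hi => ⟨hI hi, (h1 i (hI hi)).1 hi⟩⟩
      rw [this]
      exact h2
  rw [this]
  refine Finset.measurableSet_biUnion _ fun I hI => ?_
  refine MeasurableSet.inter (Finset.measurableSet_biInter _ fun i hi => ?_)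
    (hH I (Finset.mem_powerset.1 hI) hT)
  by_cases hiI : i ∈ I
  · simpa [hiI] using h.2 J i hi
  · have : {p : X × (ℕ → Θ) | i ∈ I ↔ p.2 i ∈ sel p.1 (J.image p.2)} =
        {p | p.2 i ∈ sel p.1 (J.image p.2)}ᶜ := by
      ext p
      simp [hiI]
    rw [this]
    exact (h.2 J i hi).compl

theorem MeasOn.comp_sel {F : X → Finset Θ → β} (hF : MeasOn F) {sel : X → Finset Θ → Finset Θ}
    (h : Selects sel) : MeasOn fun x S => F x (sel x S) := by
  classical
  intro J
  have := h.measurable_index J (fun I p => F p.1 (I.image p.2)) fun I _ => hF I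
  convert this using 3 with p
  exact (h.image_filter _ _ _).symm

theorem MeasOn.comp {F : X → Finset Θ → β} (hF : MeasOn F) {h : X' → Finset Θ → X}
    (hh : MeasOn h) : MeasOn fun x S => F (h x S) S :=
  fun J => (hF J).comp ((hh J).prodMk measurable_snd)

theorem MeasOn.comp_left {F : X → Finset Θ → β} (hF : MeasOn F) {h : X' → X}
    (hh : Measurable h) : MeasOn fun x S => F (h x) S :=
  fun J => (hF J).comp ((hh.comp measurable_fst).prodMk measurable_snd)

theorem MeasOn.of_measurable {h : X → β} (hh : Measurable h) :
    MeasOn (Θ := Θ) fun x _ => h x := fun _ => hh.comp measurable_fst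

theorem MeasOn.map {F : X → Finset Θ → β} (hF : MeasOn F) {h : β → β'} (hh : Measurable h) :
    MeasOn fun x S => h (F x S) := fun J => hh.comp (hF J)

theorem MeasOn.prodMk {F : X → Finset Θ → β} (hF : MeasOn F) {G : X → Finset Θ → β'}
    (hG : MeasOn G) : MeasOn fun x S => (F x S, G x S) := fun J => (hF J).prodMk (hG J)

theorem Selects.comp_left {sel : X → Finset Θ → Finset Θ} (h : Selects sel) {f : X' → X}
    (hf : Measurable f) : Selects fun x S => sel (f x) S :=
  ⟨fun _ _ => h.1 _ _, fun J i hi => ((hf.comp measurable_fst).prodMk measurable_snd) (h.2 J i hi)⟩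

theorem Selects.sSup {φ : X × Θ → Finset Θ → ℝ} (hφ : MeasOn φ) {sel : X → Finset Θ → Finset Θ}
    (h : Selects sel) : MeasOn fun x S => sSup ((fun j => φ (x, j) S) '' (sel x S : Set Θ)) := by
  classical
  intro J
  have hmi : ∀ i : ℕ, Measurable fun p : X × (ℕ → Θ) => φ (p.1, p.2 i) (J.image p.2) := fun i =>
    (hφ J).comp (f := fun p : X × (ℕ → Θ) => ((p.1, p.2 i), p.2)) (by fun_prop)
  have := h.measurable_index J
    (fun I p => SupSet.sSup ((fun i => φ (p.1, p.2 i) (J.image p.2)) '' (I : Set ℕ))) fun I _ => ?_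
  · convert this using 3 with p
    conv_lhs => rw [← h.image_filter p.1 p.2 J]
    rw [Finset.coe_image, Set.image_image]
  · rcases I.eq_empty_or_nonempty with rfl | hne
    · simp
    · have : (fun p : X × (ℕ → Θ) =>
          SupSet.sSup ((fun i => φ (p.1, p.2 i) (J.image p.2)) '' (I : Set ℕ))) =
          fun p => I.sup' hne fun i => φ (p.1, p.2 i) (J.image p.2) := by
        funext p
        exact (Finset.sup'_eq_csSup_image I hne _).symm
      rw [this]
      have h2 := Finset.measurable_sup' hne (f := fun i (p : X × (ℕ → Θ)) =>
        φ (p.1, p.2 i) (J.image p.2)) fun i _ => hmi i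
      convert h2 using 1
      funext p
      rw [Finset.sup'_apply]

open Classical in
-- An enumeration may repeat points, so each point is counted at its first index only.
theorem sum_image_eq_sum_first {M : Type*} [AddCommMonoid M] (J : Finset ℕ) (v : ℕ → Θ)
    (f : Θ → M) : ∑ s ∈ J.image v, f s =
      ∑ i ∈ J, if ∀ j ∈ J, j < i → v j ≠ v i then f (v i) else 0 := by
  rw [← Finset.sum_filter]
  have himg : J.image v = (J.filter fun i => ∀ j ∈ J, j < i → v j ≠ v i).image v := by
    ext s
    simp only [Finset.mem_image, Finset.mem_filter]
    constructor
    · rintro ⟨i, hi, rfl⟩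
      have hne : (J.filter fun j => v j = v i).Nonempty := ⟨i, by simp [hi]⟩
      have hm := Finset.min'_mem _ hne
      rw [Finset.mem_filter] at hm
      refine ⟨_, ⟨hm.1, fun j hj hlt he => ?_⟩, hm.2⟩
      refine absurd hlt (not_lt.2 (Finset.min'_le _ _ ?_))
      rw [Finset.mem_filter]
      exact ⟨hj, he.trans hm.2⟩
    · rintro ⟨i, ⟨hi, -⟩, rfl⟩
      exact ⟨i, hi, rfl⟩
  rw [himg, Finset.sum_image]
  intro i hi j hj hij
  rw [Finset.coe_filter, Set.mem_ofPred_eq] at hi hj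
  rcases lt_trichotomy i j with h | h | h
  · exact absurd hij (hj.2 i hi.1 h)
  · exact h
  · exact absurd hij.symm (hi.2 j hj.1 h)

theorem MeasOn.sum {M : Type*} [AddCommMonoid M] [MeasurableSpace M] [MeasurableAdd₂ M]
    {f : X × Θ → M} (hf : Measurable f) : MeasOn fun (x : X) (S : Finset Θ) => ∑ s ∈ S, f (x, s) := by
  classical
  intro J
  have : (fun p : X × (ℕ → Θ) => ∑ s ∈ J.image p.2, f (p.1, s)) = fun p => ∑ i ∈ J,
      if ∀ j ∈ J, j < i → p.2 j ≠ p.2 i then f (p.1, p.2 i) else 0 :=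
    funext fun p => sum_image_eq_sum_first J p.2 fun s => f (p.1, s)
  rw [this]
  refine Finset.measurable_sum _ fun i _ => Measurable.ite ?_ (by fun_prop) measurable_const
  simp only [Set.ofPred_forall]
  refine Finset.measurableSet_biInter _ fun j _ => MeasurableSet.iInter fun _ => ?_
  exact (measurableSet_eq_fun (by fun_prop) (by fun_prop)).compl

theorem measurableSet_before : MeasurableSet {p : Θ × Θ × Θ | Before p.1 p.2.1 p.2.2} := by
  have h1 : Measurable fun p : Θ × Θ × Θ => dist p.2.1 p.1 := by fun_prop
  have h2 : Measurable fun p : Θ × Θ × Θ => dist p.2.2 p.1 := by fun_prop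
  have hc : ∀ i, Measurable fun s : Θ => (s : E d) i := fun i => by fun_prop
  have hs : ∀ i, Measurable fun p : Θ × Θ × Θ => (p.2.1 : E d) i := fun i =>
    (hc i).comp (by fun_prop)
  have ht : ∀ i, Measurable fun p : Θ × Θ × Θ => (p.2.2 : E d) i := fun i =>
    (hc i).comp (by fun_prop)
  refine (measurableSet_lt h1 h2).union ((measurableSet_eq_fun h1 h2).inter ?_)
  have : {p : Θ × Θ × Θ | toLex (fun i => (p.2.1 : E d) i) < toLex fun i => (p.2.2 : E d) i} =
      ⋃ i, ((⋂ j, ⋂ _ : j < i, {p : Θ × Θ × Θ | (p.2.1 : E d) j = (p.2.2 : E d) j}) ∩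
        {p | (p.2.1 : E d) i < (p.2.2 : E d) i}) := by
    ext p
    simp only [Set.mem_iUnion, Set.mem_inter_iff, Set.mem_iInter, Set.mem_ofPred_eq]
    rfl
  change MeasurableSet {p : Θ × Θ × Θ | toLex (fun i => (p.2.1 : E d) i) <
    toLex fun i => (p.2.2 : E d) i}
  rw [this]
  exact MeasurableSet.iUnion fun i => (MeasurableSet.iInter fun j => MeasurableSet.iInter fun _ =>
    measurableSet_eq_fun (hs j) (ht j)).inter (measurableSet_lt (hs i) (ht i))

theorem selects_nearest (k : ℕ) : Selects fun (θ : Θ) S => nearest k θ S := by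
  classical
  refine ⟨fun θ S => nearest_subset k θ S, fun J i hi => ?_⟩
  have h1 : MeasOn fun (x : Θ × Θ) (S : Finset Θ) =>
      ∑ t ∈ S, if Before x.1 t x.2 then 1 else 0 := by
    refine MeasOn.sum (f := fun p : (Θ × Θ) × Θ => if Before p.1.1 p.2 p.1.2 then 1 else 0) ?_
    refine Measurable.ite ?_ measurable_const measurable_const
    have : Measurable fun p : (Θ × Θ) × Θ => (p.1.1, p.2, p.1.2) := by fun_prop
    exact this measurableSet_before
  have h2 := (h1 J).comp (g := fun p : (Θ × Θ) × (ℕ → Θ) => ∑ t ∈ J.image p.2,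
    if Before p.1.1 t p.1.2 then 1 else 0) (f := fun p : Θ × (ℕ → Θ) => ((p.1, p.2 i), p.2))
    (by fun_prop)
  have h3 := h2 (measurableSet_Iio (a := k))
  convert h3 using 1
  ext p
  simp only [nearest, Set.mem_ofPred_eq, Finset.mem_filter, Set.mem_preimage, Function.comp_apply,
    Set.mem_Iio, Finset.card_filter]
  exact and_iff_right (Finset.mem_image_of_mem _ hi)

end

end LAMCMC

/-! ### Measurability of the fitted coefficients and of poisedness -/

namespace LAMCMC

variable {d m n : ℕ} {Θ : Set (E d)}

/-- The polynomial with given upper triangular coefficients. -/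
def uquad (c : UpperCoef d) (x : E d) : ℝ := quad (upperL d c) x

theorem uquad_injective : Function.Injective (uquad (d := d)) := quadL_comp_upperL_injective

theorem continuous_upperL : Continuous (upperL d) := (upperL d).continuous_of_finiteDimensional

theorem continuous_uquad : Continuous fun p : UpperCoef d × E d => uquad p.1 p.2 :=
  continuous_quad.comp (((continuous_upperL (d := d)).comp continuous_fst).prodMk continuous_snd)

theorem IsQuadratic.exists_uquad {P : E d → ℝ} (hP : IsQuadratic P) : ∃ c, P = uquad c := by
  have := mem_quadSpace.2 hP
  rw [← range_quadL_comp_upperL] at this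
  obtain ⟨c, rfl⟩ := this
  exact ⟨c, rfl⟩

theorem isQuadratic_uquad (c : UpperCoef d) : IsQuadratic (uquad c) := ⟨_, rfl⟩

theorem uquad_smul (a : ℝ) (c : UpperCoef d) (x : E d) : uquad (a • c) x = a * uquad c x :=
  congrFun (((quadL d).comp (upperL d)).map_smul a c) x

theorem uquad_sub (c c' : UpperCoef d) (x : E d) : uquad (c - c') x = uquad c x - uquad c' x :=
  congrFun (((quadL d).comp (upperL d)).map_sub c c') x

theorem uquad_const (a : ℝ) : uquad ((a, 0, 0) : UpperCoef d) = fun _ => a := by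
  funext x
  simp [uquad, upperL, quad]

/-- The upper triangular coefficients of the fitted model. -/
def fitCoef (g : Θ → ℝ) (θ : Θ) (Y : Finset Θ) : UpperCoef d :=
  (isQuadratic_fit g θ Y).exists_uquad.choose

theorem fit_eq_uquad (g : Θ → ℝ) (θ : Θ) (Y : Finset Θ) : fit g θ Y = uquad (fitCoef g θ Y) :=
  (isQuadratic_fit g θ Y).exists_uquad.choose_spec

/-- There is no nonzero quadratic polynomial that vanishes on `Y`. -/
def Unisolvent (Y : Finset Θ) : Prop := ¬ ∃ c : UpperCoef d, ‖c‖ = 1 ∧ ∀ y ∈ Y, uquad c y = 0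

theorem Unisolvent.eq_zero {Y : Finset Θ} (h : Unisolvent Y) {c : UpperCoef d}
    (hc : ∀ y ∈ Y, uquad c y = 0) : c = 0 := by
  by_contra hne
  refine h ⟨‖c‖⁻¹ • c, ?_, fun y hy => by rw [uquad_smul, hc y hy, mul_zero]⟩
  rw [norm_smul, norm_inv, norm_norm, inv_mul_cancel₀ (norm_ne_zero_iff.2 hne)]

theorem existsUnique_interpolates_iff (g : Θ → ℝ) (Y : Finset Θ) :
    (∃! P : E d → ℝ, Interpolates Y g P) ↔
      (∃ c : UpperCoef d, ∀ y ∈ Y, uquad c y = g y) ∧ Unisolvent Y := by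
  constructor
  · rintro ⟨P, ⟨hP, hPg⟩, huniq⟩
    obtain ⟨c, rfl⟩ := hP.exists_uquad
    refine ⟨⟨c, hPg⟩, ?_⟩
    rintro ⟨c', hc', h0⟩
    have := huniq (uquad (c - c')) ⟨isQuadratic_uquad _, fun y hy => by
      rw [uquad_sub, h0 y hy, sub_zero, hPg y hy]⟩
    have h2 := uquad_injective this
    rw [sub_eq_self.1 h2, norm_zero] at hc'
    exact zero_ne_one hc'
  · rintro ⟨⟨c, hc⟩, hu⟩
    refine ⟨uquad c, ⟨isQuadratic_uquad _, hc⟩, ?_⟩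
    rintro _ ⟨hP, hPg⟩
    obtain ⟨c', rfl⟩ := hP.exists_uquad
    rw [sub_eq_zero.1 (hu.eq_zero (c := c' - c) fun y hy => by
      rw [uquad_sub, hPg y hy, hc y hy, sub_self])]

open Classical in
-- Interpolating the indicators of single nodes suffices, by linear combination. This turns a
-- quantifier over all data into finitely many conditions that are closed in the nodes and
-- coefficients.
theorem forall_existsUnique_iff (Y : Finset Θ) :
    (∀ g : Θ → ℝ, ∃! P : E d → ℝ, Interpolates Y g P) ↔
      (∀ y ∈ Y, ∃ c : UpperCoef d, uquad c y = 1 ∧ ∀ y' ∈ Y, y' = y ∨ uquad c y' = 0) ∧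
        Unisolvent Y := by
  simp only [existsUnique_interpolates_iff]
  constructor
  · intro h
    refine ⟨fun y hy => ?_, (h 0).2⟩
    obtain ⟨c, hc⟩ := (h fun y' => if y' = y then 1 else 0).1
    refine ⟨c, by simpa using hc y hy, fun y' hy' => ?_⟩
    by_cases h' : y' = y
    · exact Or.inl h'
    · right
      simpa [h'] using hc y' hy'
  · rintro ⟨h, hu⟩ g
    refine ⟨?_, hu⟩
    choose! c hc1 hc2 using h
    refine ⟨∑ y ∈ Y, g y • c y, fun y hy => ?_⟩
    have hsum : ∀ (T : Finset Θ) (f : Θ → UpperCoef d) (x : E d),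
        uquad (∑ t ∈ T, f t) x = ∑ t ∈ T, uquad (f t) x := fun T f x => by
      have := congrFun (map_sum ((quadL d).comp (upperL d)) f T) x
      rw [Finset.sum_apply] at this
      exact this
    rw [hsum, Finset.sum_eq_single y]
    · rw [uquad_smul, hc1 y hy, mul_one]
    · intro y' hy' hne
      rw [uquad_smul, (hc2 y' hy' y hy).resolve_left hne.symm, mul_zero]
    · exact fun h => absurd hy h

variable {g : Θ → ℝ}

theorem isClosed_interp (hg : Continuous g) (J : Finset ℕ) :
    IsClosed {p : UpperCoef d × (Θ × (ℕ → Θ)) | ∀ j ∈ J, uquad p.1 (p.2.2 j) = g (p.2.2 j)} := by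
  simp only [Set.ofPred_forall]
  exact isClosed_biInter fun j _ => isClosed_eq (continuous_uquad.comp (f := fun p :
      UpperCoef d × (Θ × (ℕ → Θ)) => (p.1, (p.2.2 j : E d))) (by fun_prop))
      (hg.comp (by fun_prop))

section

variable [CompactSpace Θ]

/-- The normalization ‖c‖ = 1 expresses that c is nonzero by a closed condition, so that the
projection argument applies. -/
theorem measOn_unisolvent : MeasOn fun (_ : Θ) (Y : Finset Θ) => Unisolvent Y := by
  classical
  intro J
  have h : IsClosed (⋂ j ∈ J, {p : UpperCoef d × (Θ × (ℕ → Θ)) | uquad p.1 (p.2.2 j) = 0}) :=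
    isClosed_biInter fun j _ => isClosed_eq (continuous_uquad.comp (f := fun p :
      UpperCoef d × (Θ × (ℕ → Θ)) => (p.1, (p.2.2 j : E d))) (by fun_prop)) continuous_const
  have h1 : IsClosed {p : UpperCoef d × (Θ × (ℕ → Θ)) | ‖p.1‖ = 1} :=
    isClosed_eq (by fun_prop) continuous_const
  refine measurableSet_setOfPred.1 ?_
  have : {p : Θ × (ℕ → Θ) | Unisolvent (J.image p.2)} = {x | ∃ c, (c, x) ∈
      {p : UpperCoef d × (Θ × (ℕ → Θ)) | ‖p.1‖ = 1} ∩
      ⋂ j ∈ J, {p : UpperCoef d × (Θ × (ℕ → Θ)) | uquad p.1 (p.2.2 j) = 0}}ᶜ := by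
    ext p
    simp [Unisolvent]
  rw [this]
  exact (measurableSet_exists_of_isClosed (h1.inter h)).compl

theorem measOn_existsUnique (hg : Continuous g) :
    MeasOn fun (_ : Θ) (Y : Finset Θ) => ∃! P : E d → ℝ, Interpolates Y g P := by
  classical
  intro J
  simp only [existsUnique_interpolates_iff]
  refine Measurable.and (measurableSet_setOfPred.1 ?_) (measOn_unisolvent J)
  convert measurableSet_exists_of_isClosed (isClosed_interp hg J) using 1
  ext p
  simp

/-- Where the interpolant is unique, its coefficients lie in a closed set C exactly when some
interpolating coefficient vector lies in C, and this is a projection of a closed set. Elsewhere the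
fallback constant is a measurable sum. -/
theorem measOn_fitCoef (hg : Continuous g) :
    MeasOn fun (θ : Θ) (Y : Finset Θ) => fitCoef g θ Y := by
  classical
  have hfb : MeasOn fun (θ : Θ) (Y : Finset Θ) => ∑ s ∈ nearest 1 θ Y, g s :=
    (MeasOn.sum (f := fun p : Θ × Θ => g p.2) (hg.measurable.comp measurable_snd)).comp_sel
      (selects_nearest 1)
  intro J
  refine measurable_of_isClosed fun C hC => ?_
  have hD := measurableSet_setOfPred.2 (measOn_existsUnique hg J)
  have hcl : IsClosed {p : UpperCoef d × (Θ × (ℕ → Θ)) | p.1 ∈ C ∧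
      ∀ j ∈ J, uquad p.1 (p.2.2 j) = g (p.2.2 j)} :=
    (hC.preimage continuous_fst).inter (isClosed_interp hg J)
  have hf : Measurable fun p : Θ × (ℕ → Θ) =>
      ((∑ s ∈ nearest 1 p.1 (J.image p.2), g s, 0, 0) : UpperCoef d) :=
    (hfb J).prodMk measurable_const
  have hset := (hD.inter (measurableSet_exists_of_isClosed hcl)).union
    (hD.compl.inter (hf hC.measurableSet))
  convert hset using 1
  ext p
  simp only [Set.mem_preimage, Set.mem_union, Set.mem_inter_iff, Set.mem_ofPred_eq, Set.mem_compl_iff]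
  by_cases h : ∃! P : E d → ℝ, Interpolates (J.image p.2) g P
  · simp only [h, true_and, not_true, false_and, or_false]
    constructor
    · intro hc
      refine ⟨_, hc, fun j hj => ?_⟩
      rw [← fit_eq_uquad, fit, dif_pos h]
      exact h.choose_spec.1.2 _ (Finset.mem_image_of_mem _ hj)
    · rintro ⟨c, hc, hci⟩
      have := fit_of_existsUnique (θ := p.1) h (P := uquad c) ⟨isQuadratic_uquad c, by
        simpa using hci⟩
      rw [fit_eq_uquad] at this
      rwa [uquad_injective this]
  · simp only [h, false_and, not_false_iff, true_and, false_or]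
    have : fitCoef g p.1 (J.image p.2) = (∑ s ∈ nearest 1 p.1 (J.image p.2), g s, 0, 0) := by
      apply uquad_injective
      rw [← fit_eq_uquad, fit, dif_neg h, uquad_const]
    rw [this]

theorem measOn_poised (lam : ℝ) : MeasOn fun (θ : Θ) (Y : Finset Θ) => Poised lam θ Y := by
  classical
  intro J
  have hev : ∀ j : ℕ, Continuous fun p : UpperCoef d × (Θ × (ℕ → Θ)) =>
      uquad p.1 (p.2.2 j : E d) := fun j => continuous_uquad.comp
        (f := fun p : UpperCoef d × (Θ × (ℕ → Θ)) => (p.1, (p.2.2 j : E d))) (by fun_prop)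
  have hcl : ∀ i, IsClosed {p : UpperCoef d × (Θ × (ℕ → Θ)) | uquad p.1 (p.2.2 i) = 1 ∧
      ∀ j ∈ J, p.2.2 j = p.2.2 i ∨ uquad p.1 (p.2.2 j) = 0} := fun i => by
    have h : IsClosed (⋂ j ∈ J, {p : UpperCoef d × (Θ × (ℕ → Θ)) |
        p.2.2 j = p.2.2 i ∨ uquad p.1 (p.2.2 j) = 0}) :=
      isClosed_biInter fun j _ => (isClosed_eq (f := fun p : UpperCoef d × (Θ × (ℕ → Θ)) => p.2.2 j)
        (by fun_prop) (by fun_prop)).union (isClosed_eq (hev j) continuous_const)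
    have h1 : IsClosed {p : UpperCoef d × (Θ × (ℕ → Θ)) | uquad p.1 (p.2.2 i) = 1} :=
      isClosed_eq (hev i) continuous_const
    convert h1.inter h using 1
    ext p
    simp
  -- The strict violation |P x| > λ is not closed; it is exhausted by the closed conditions |P x| ≥
  -- λ + 1/(k + 1).
  have hcl2 : ∀ i (j k : ℕ), IsClosed {p : (UpperCoef d × E d) × (Θ × (ℕ → Θ)) |
      (uquad p.1.1 (p.2.2 i) = 1 ∧
      ∀ j ∈ J, p.2.2 j = p.2.2 i ∨ uquad p.1.1 (p.2.2 j) = 0) ∧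
      dist p.1.2 (p.2.1 : E d) ≤ dist (p.2.2 j : E d) (p.2.1 : E d) ∧
      lam + 1 / ((k : ℝ) + 1) ≤ |uquad p.1.1 p.1.2|} := fun i j k => by
    refine IsClosed.inter ?_ (IsClosed.inter ?_ ?_)
    · exact (hcl i).preimage (f := fun p : (UpperCoef d × E d) × (Θ × (ℕ → Θ)) => (p.1.1, p.2))
        (by fun_prop)
    · exact isClosed_le
        (f := fun p : (UpperCoef d × E d) × (Θ × (ℕ → Θ)) => dist p.1.2 (p.2.1 : E d))
        (g := fun p => dist (p.2.2 j : E d) (p.2.1 : E d)) (by fun_prop) (by fun_prop)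
    · exact isClosed_le continuous_const (continuous_uquad.comp continuous_fst).abs
  have h1 : Measurable fun p : Θ × (ℕ → Θ) => ∀ y ∈ J.image p.2, ∃ c : UpperCoef d,
      uquad c y = 1 ∧ ∀ y' ∈ J.image p.2, y' = y ∨ uquad c y' = 0 := by
    refine measurableSet_setOfPred.1 ?_
    convert Finset.measurableSet_biInter J fun i _ => measurableSet_exists_of_isClosed (hcl i) using 1
    ext p
    simp
  have h2 : Measurable fun p : Θ × (ℕ → Θ) => ∃ i ∈ J, ∃ j ∈ J, ∃ k : ℕ, ∃ c : UpperCoef d × E d,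
      (uquad c.1 (p.2 i) = 1 ∧
      ∀ j ∈ J, p.2 j = p.2 i ∨ uquad c.1 (p.2 j) = 0) ∧
      dist c.2 (p.1 : E d) ≤ dist (p.2 j : E d) (p.1 : E d) ∧
      lam + 1 / ((k : ℝ) + 1) ≤ |uquad c.1 c.2| := by
    refine measurableSet_setOfPred.1 ?_
    convert Finset.measurableSet_biUnion J fun i _ => Finset.measurableSet_biUnion J fun j _ =>
      MeasurableSet.iUnion fun k => measurableSet_exists_of_isClosed (hcl2 i j k) using 1
    ext p
    simp
  have h3 := (h1.and (measOn_unisolvent J)).and h2.not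
  refine (congrArg Measurable (funext fun p => propext ?_)).mpr h3
  dsimp only
  rw [Poised, forall_existsUnique_iff]
  refine and_congr_right fun _ => ?_
  constructor
  · rintro h ⟨i, hi, j, hj, k, c, ⟨hc1, hc2⟩, hd, hl⟩
    have := h (p.2 i) (Finset.mem_image_of_mem _ hi) (uquad c.1) (isQuadratic_uquad _) hc1
      (fun y' hy' hne => by
        obtain ⟨j, hj, rfl⟩ := Finset.mem_image.1 hy'
        exact (hc2 j hj).resolve_left hne) c.2 ⟨_, Finset.mem_image_of_mem _ hj, hd⟩
    have : 0 < 1 / ((k : ℝ) + 1) := by positivity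
    linarith
  · intro h y hy P hP hP1 hP0 x hx
    obtain ⟨c, rfl⟩ := hP.exists_uquad
    obtain ⟨i, hi, rfl⟩ := Finset.mem_image.1 hy
    obtain ⟨y', hy', hd⟩ := hx
    obtain ⟨j, hj, rfl⟩ := Finset.mem_image.1 hy'
    by_contra! hlt
    obtain ⟨k, hk⟩ := exists_nat_one_div_lt (sub_pos.2 hlt)
    refine h ⟨i, hi, j, hj, k, (c, x), ⟨hP1, fun j' hj' => ?_⟩, hd, by linarith⟩
    by_cases he : p.2 j' = p.2 i
    · exact Or.inl he
    · exact Or.inr (hP0 _ (Finset.mem_image_of_mem _ hj') he)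

end

end LAMCMC

/-! ### Measurability of the ingredients of one step -/

namespace LAMCMC

variable {d m n : ℕ} {Θ : Set (E d)}

namespace Setup

variable {A : Setup d m n Θ}

theorem approx_eq (S : Finset Θ) (θ : Θ) :
    A.approx S θ = fun x : Θ => uquad (fitCoef A.exact θ (nodes S θ)) x := by
  funext x
  rw [approx, fit_eq_uquad]

theorem admissible_approx (S : Finset Θ) (θ : Θ) : A.Admissible (A.approx S θ) :=
  Or.inr ⟨upperL d (fitCoef A.exact θ (nodes S θ)), approx_eq S θ⟩

theorem selects_nodes : Selects fun (θ : Θ) S => nodes S θ := selects_nearest _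

open Classical in
theorem selects_nodes_erase : Selects fun (x : Θ × Θ) S => (nodes S x.1).erase x.2 := by
  have h := (selects_nodes (Θ := Θ)).comp_left (measurable_fst (α := Θ) (β := Θ))
  refine ⟨fun x S => (Finset.erase_subset _ _).trans (h.1 x S), fun J i hi => ?_⟩
  have h2 : MeasurableSet {p : (Θ × Θ) × (ℕ → Θ) | p.2 i = p.1.2} :=
    measurableSet_eq_fun (by fun_prop) (by fun_prop)
  convert h2.compl.inter (h.2 J i hi) using 1
  ext p
  simp

section

variable [CompactSpace Θ]

theorem measOn_approx (hA : A.Standing) (hS : A.Sufficient) :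
    MeasOn fun (p : Θ × Θ) S => A.approx S p.1 p.2 := by
  have h1 := ((measOn_fitCoef (exact_continuous hA hS)).comp_sel selects_nodes).comp_left
    (measurable_fst (α := Θ) (β := Θ))
  have h2 : MeasOn fun (p : Θ × Θ) (_ : Finset Θ) => (p.2 : E d) :=
    MeasOn.of_measurable (by fun_prop)
  have h3 := (h1.prodMk h2).map continuous_uquad.measurable
  convert h3 using 3 with p S
  exact congrFun (approx_eq S p.1) p.2

open Classical in
theorem measOn_approxLOO (hA : A.Standing) (hS : A.Sufficient) :
    MeasOn fun (p : (Θ × Θ) × Θ) S => A.approxLOO S p.1.1 p.1.2 p.2 := by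
  have h0 : MeasOn fun (x : Θ × Θ) (Y : Finset Θ) => fitCoef A.exact x.1 Y :=
    (measOn_fitCoef (exact_continuous hA hS)).comp_left measurable_fst
  have h1 := (h0.comp_sel selects_nodes_erase).comp_left
    (measurable_fst (α := Θ × Θ) (β := Θ))
  have h2 : MeasOn fun (p : (Θ × Θ) × Θ) (_ : Finset Θ) => (p.2 : E d) :=
    MeasOn.of_measurable (by fun_prop)
  have h3 := (h1.prodMk h2).map continuous_uquad.measurable
  convert h3 using 3 with p S
  rw [approxLOO, fit_eq_uquad]

theorem measOn_rS (hA : A.Standing) (hS : A.Sufficient) :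
    MeasOn fun (p : Θ × E m) S => A.rS S p.1 p.2 := by
  have h1 := ((measOn_fitCoef (exact_continuous hA hS)).comp_sel selects_nodes).comp_left
    (measurable_fst (α := Θ) (β := E m))
  have h2 : MeasOn fun (p : Θ × E m) (_ : Finset Θ) => p := MeasOn.of_measurable measurable_id
  have h4 : Measurable fun x : (Θ × E m) × UpperCoef d =>
      A.r x.1.1 x.1.2 fun y => quad (upperL d x.2) y :=
    hA.measurable_r.comp (f := fun x : (Θ × E m) × UpperCoef d => (x.1.1, x.1.2, upperL d x.2))
      (Measurable.prodMk (by fun_prop) (Measurable.prodMk (by fun_prop)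
        (continuous_upperL.measurable.comp measurable_snd)))
  have h3 := (h2.prodMk h1).map h4
  convert h3 using 3 with p S
  rw [rS, approx_eq]
  rfl

omit [CompactSpace Θ] in
theorem measurable_ratio_aux (hS : A.Sufficient) : Measurable fun x : (Θ × Θ) × ℝ × ℝ =>
    Real.exp x.2.2 * A.q x.1.2 x.1.1 A.exact / (Real.exp x.2.1 * A.q x.1.1 x.1.2 A.exact) := by
  have h1 : Measurable fun x : (Θ × Θ) × ℝ × ℝ => A.q x.1.2 x.1.1 A.exact :=
    hS.q_cont.measurable.comp (f := fun x : (Θ × Θ) × ℝ × ℝ => (x.1.2, x.1.1)) (by fun_prop)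
  have h2 : Measurable fun x : (Θ × Θ) × ℝ × ℝ => A.q x.1.1 x.1.2 A.exact :=
    hS.q_cont.measurable.comp (f := fun x : (Θ × Θ) × ℝ × ℝ => (x.1.1, x.1.2)) (by fun_prop)
  exact ((Real.measurable_exp.comp (by fun_prop)).mul h1).div
    ((Real.measurable_exp.comp (by fun_prop)).mul h2)

omit [CompactSpace Θ] in
theorem MeasOn.ratio {X : Type*} [MeasurableSpace X] (hS : A.Sufficient) {f : X → Θ × Θ}
    (hf : Measurable f) {M M' : X → Finset Θ → Model Θ}
    (hM : MeasOn fun x S => M x S (f x).1) (hM' : MeasOn fun x S => M' x S (f x).2) :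
    MeasOn fun x S => A.ratio (f x).1 (f x).2 (M x S) (M' x S) := by
  have h := ((MeasOn.of_measurable hf).prodMk (hM.prodMk hM')).map (measurable_ratio_aux hS)
  convert h using 3 with p S
  exact ratio_eq hS _ _ _ _

theorem measOn_ratio (hA : A.Standing) (hS : A.Sufficient) :
    MeasOn fun (p : Θ × Θ) S => A.ratio p.1 p.2 (A.approx S p.1) (A.approx S p.2) :=
  MeasOn.ratio hS measurable_id ((measOn_approx hA hS).comp_left (h := fun p : Θ × Θ => (p.1, p.1))
    (by fun_prop)) ((measOn_approx hA hS).comp_left (h := fun p : Θ × Θ => (p.2, p.2)) (by fun_prop))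

theorem measOn_αS (hA : A.Standing) (hS : A.Sufficient) :
    MeasOn fun (p : Θ × Θ) S => A.αS S p.1 p.2 :=
  (measOn_ratio hA hS).map (measurable_const.min measurable_id)

omit [CompactSpace Θ] in
theorem measurable_accDiff : Measurable fun p : ℝ × ℝ => accDiff p.1 p.2 := by
  unfold accDiff
  fun_prop

theorem measOn_errPlus (hA : A.Standing) (hS : A.Sufficient) :
    MeasOn fun (p : Θ × Θ) S => A.errPlus S p.1 p.2 := by
  have h1 := (measOn_ratio hA hS).comp_left (measurable_fst (α := Θ × Θ) (β := Θ))
  have h2 : MeasOn fun (p : (Θ × Θ) × Θ) S =>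
      A.ratio p.1.1 p.1.2 (A.approx S p.1.1) (A.approxLOO S p.1.2 p.2) :=
    MeasOn.ratio hS measurable_fst
      ((measOn_approx hA hS).comp_left (h := fun p : (Θ × Θ) × Θ => (p.1.1, p.1.1)) (by fun_prop))
      ((measOn_approxLOO hA hS).comp_left (h := fun p : (Θ × Θ) × Θ => ((p.1.2, p.2), p.1.2))
        (by fun_prop))
  exact Selects.sSup ((h1.prodMk h2).map measurable_accDiff)
    (selects_nodes.comp_left (measurable_snd (α := Θ) (β := Θ)))

theorem measOn_errMinus (hA : A.Standing) (hS : A.Sufficient) :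
    MeasOn fun (p : Θ × Θ) S => A.errMinus S p.1 p.2 := by
  have h1 := (measOn_ratio hA hS).comp_left (measurable_fst (α := Θ × Θ) (β := Θ))
  have h2 : MeasOn fun (p : (Θ × Θ) × Θ) S =>
      A.ratio p.1.1 p.1.2 (A.approxLOO S p.1.1 p.2) (A.approx S p.1.2) :=
    MeasOn.ratio hS measurable_fst
      ((measOn_approxLOO hA hS).comp_left (h := fun p : (Θ × Θ) × Θ => ((p.1.1, p.2), p.1.1))
        (by fun_prop))
      ((measOn_approx hA hS).comp_left (h := fun p : (Θ × Θ) × Θ => (p.1.2, p.1.2)) (by fun_prop))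
  exact Selects.sSup ((h1.prodMk h2).map measurable_accDiff)
    (selects_nodes.comp_left (measurable_fst (α := Θ) (β := Θ)))

theorem measOn_poised_nodes : MeasOn fun (θ : Θ) S => Poised A.lam θ (nodes S θ) :=
  (measOn_poised A.lam).comp_sel selects_nodes

/-- The point at which a pass refines: the proposed point, the current point, or none. -/
def refine (A : Setup d m n Θ) (t : ℕ) (p : (Θ × E m) × ℝ × ℝ) (S : Finset Θ) : Fin 3 :=
  open Classical in
  if p.2.1 < A.β t then (if p.2.2 < 1 / 2 then 0 else 1)
  else if (A.errMinus S p.1.1 (A.rS S p.1.1 p.1.2) ≤ A.errPlus S p.1.1 (A.rS S p.1.1 p.1.2) ∧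
      A.γ t ≤ A.errPlus S p.1.1 (A.rS S p.1.1 p.1.2)) ∨
      ¬ Poised A.lam (A.rS S p.1.1 p.1.2) (nodes S (A.rS S p.1.1 p.1.2)) then 0
  else if (A.errPlus S p.1.1 (A.rS S p.1.1 p.1.2) < A.errMinus S p.1.1 (A.rS S p.1.1 p.1.2) ∧
      A.γ t ≤ A.errMinus S p.1.1 (A.rS S p.1.1 p.1.2)) ∨
      ¬ Poised A.lam p.1.1 (nodes S p.1.1) then 1
  else 2

omit [CompactSpace Θ] in
open Classical in
theorem pass_eq (t : ℕ) (θ : Θ) (z : E m) (S : Finset Θ) (w : ℝ × ℝ) :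
    A.pass t θ z S w = if A.refine t ((θ, z), w) S = 0 then insert (A.rS S θ z) S
      else if A.refine t ((θ, z), w) S = 1 then insert θ S else S := by
  unfold pass refine
  dsimp only
  by_cases h1 : w.1 < A.β t
  · by_cases h2 : w.2 < 1 / 2
    · rw [if_pos h1, if_pos h2, if_pos h1, if_pos h2, if_pos rfl]
    · rw [if_pos h1, if_neg h2, if_pos h1, if_neg h2]
      rfl
  · rw [if_neg h1, if_neg h1]
    split_ifs with h2 h3 <;> simp_all

theorem measOn_refine (hA : A.Standing) (hS : A.Sufficient) (t : ℕ) : MeasOn (A.refine t) := by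
  classical
  intro J
  have hr := ((measOn_rS hA hS).comp_left (measurable_fst (α := Θ × E m) (β := ℝ × ℝ)))
  have hx : MeasOn fun (p : (Θ × E m) × ℝ × ℝ) (_ : Finset Θ) => p.1.1 :=
    MeasOn.of_measurable (by fun_prop)
  have hm := (measOn_errMinus hA hS).comp (hx.prodMk hr) J
  have hp := (measOn_errPlus hA hS).comp (hx.prodMk hr) J
  have hy := (measOn_poised_nodes (A := A)).comp hr J
  have hθ := (measOn_poised_nodes (A := A)).comp hx J
  unfold refine
  refine Measurable.ite (measurableSet_lt (by fun_prop) measurable_const)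
    (Measurable.ite (measurableSet_lt (by fun_prop) measurable_const) measurable_const
      measurable_const) (Measurable.ite ?_ measurable_const (Measurable.ite ?_ measurable_const
      measurable_const))
  · exact ((measurableSet_le hm hp).inter (measurableSet_le measurable_const hp)).union
      (measurableSet_setOfPred.2 hy).compl
  · exact ((measurableSet_lt hp hm).inter (measurableSet_le measurable_const hm)).union
      (measurableSet_setOfPred.2 hθ).compl

theorem measOn_moveS (hA : A.Standing) (hS : A.Sufficient) :
    MeasOn fun (p : (Θ × E m) × ℝ) S => A.moveS S p.1.1 p.1.2 p.2 := by
  classical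
  intro J
  have hr := ((measOn_rS hA hS).comp_left (measurable_fst (α := Θ × E m) (β := ℝ)))
  have hx : MeasOn fun (p : (Θ × E m) × ℝ) (_ : Finset Θ) => p.1.1 :=
    MeasOn.of_measurable (by fun_prop)
  have ha := (measOn_αS hA hS).comp (hx.prodMk hr) J
  exact Measurable.ite (measurableSet_lt (by fun_prop) ha) (hr J) (hx J)

end

end Setup

/-! ### Enumerated sample sets -/

/-- A finite set of points given by an enumeration with a length. -/
abbrev Enum (Θ : Set (E d)) : Type := (ℕ → Θ) × ℕ

open Classical in
/-- The set of the points of an enumeration. -/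
def Enum.toFinset (a : Enum Θ) : Finset Θ := (Finset.range a.2).image a.1

/-- The enumeration with one more point. -/
def Enum.push (a : Enum Θ) (y : Θ) : Enum Θ := (Function.update a.1 a.2 y, a.2 + 1)

open Classical in
theorem Enum.toFinset_push (a : Enum Θ) (y : Θ) : (a.push y).toFinset = insert y a.toFinset := by
  ext s
  simp only [toFinset, push, Finset.mem_image, Finset.mem_range, Finset.mem_insert]
  constructor
  · rintro ⟨i, hi, rfl⟩
    rcases Nat.lt_succ_iff_lt_or_eq.1 hi with h | rfl
    · exact Or.inr ⟨i, h, by rw [Function.update_of_ne h.ne]⟩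
    · exact Or.inl (by simp)
  · rintro (rfl | ⟨i, hi, rfl⟩)
    · exact ⟨a.2, Nat.lt_succ_self _, by simp⟩
    · exact ⟨i, by omega, by rw [Function.update_of_ne hi.ne]⟩

theorem Enum.measurable_push : Measurable fun p : Enum Θ × Θ => p.1.push p.2 := by
  refine Measurable.prodMk (measurable_pi_lambda _ fun i => ?_) (by fun_prop)
  simp only [Function.update_apply]
  exact Measurable.ite (measurableSet_eq_fun measurable_const (by fun_prop)) (by fun_prop)
    (by fun_prop)

theorem Enum.exists_toFinset_eq [Nonempty Θ] (S : Finset Θ) : ∃ a : Enum Θ, a.toFinset = S := by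
  classical
  induction S using Finset.induction_on with
  | empty => exact ⟨(fun _ => Classical.arbitrary Θ, 0), rfl⟩
  | insert y S _ ih =>
    obtain ⟨a, rfl⟩ := ih
    exact ⟨a.push y, a.toFinset_push y⟩

theorem MeasOn.measurable {X β : Type*} [MeasurableSpace X] [MeasurableSpace β]
    {F : X → Finset Θ → β} (hF : MeasOn F) :
    Measurable fun p : X × Enum Θ => F p.1 p.2.toFinset := by
  classical
  have h : Measurable fun p : (X × (ℕ → Θ)) × ℕ => F p.1.1 ((Finset.range p.2).image p.1.2) :=
    measurable_from_prod_countable_left fun k => hF (Finset.range k)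
  exact h.comp (g := fun p : (X × (ℕ → Θ)) × ℕ => F p.1.1 ((Finset.range p.2).image p.1.2))
    (f := fun p : X × Enum Θ => ((p.1, p.2.1), p.2.2)) (by fun_prop)

theorem Enum.measurableSet_toFinset_eq :
    MeasurableSet {p : Enum Θ × Enum Θ | p.1.toFinset = p.2.toFinset} := by
  have h : ∀ i j : ℕ, MeasurableSet {p : Enum Θ × Enum Θ | j < p.2.2 ∧ p.1.1 i = p.2.1 j} :=
    fun i j => (measurableSet_lt (g := fun p : Enum Θ × Enum Θ => p.2.2) measurable_const
      (by fun_prop)).inter (measurableSet_eq_fun (f := fun p : Enum Θ × Enum Θ => p.1.1 i)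
      (g := fun p => p.2.1 j) (by fun_prop) (by fun_prop))
  have hsub : MeasurableSet {p : Enum Θ × Enum Θ | p.1.toFinset ⊆ p.2.toFinset} := by
    have : {p : Enum Θ × Enum Θ | p.1.toFinset ⊆ p.2.toFinset} =
        ⋂ i : ℕ, ({p : Enum Θ × Enum Θ | i < p.1.2}ᶜ ∪
          ⋃ j : ℕ, {p : Enum Θ × Enum Θ | j < p.2.2 ∧ p.1.1 i = p.2.1 j}) := by
      ext p
      simp only [toFinset, Finset.subset_iff, Finset.mem_image, Finset.mem_range, Set.mem_ofPred_eq,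
        Set.mem_iInter, Set.mem_union, Set.mem_compl_iff, Set.mem_iUnion]
      constructor
      · intro h i
        by_cases hi : i < p.1.2
        · obtain ⟨j, hj, he⟩ := h ⟨i, hi, rfl⟩
          exact Or.inr ⟨j, hj, he.symm⟩
        · exact Or.inl hi
      · rintro h _ ⟨i, hi, rfl⟩
        rcases h i with h | ⟨j, hj, he⟩
        · exact absurd hi h
        · exact ⟨j, hj, he.symm⟩
    rw [this]
    exact MeasurableSet.iInter fun i => (measurableSet_lt measurable_const (by fun_prop)).compl.union
      (MeasurableSet.iUnion fun j => h i j)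
  have : {p : Enum Θ × Enum Θ | p.1.toFinset = p.2.toFinset} =
      {p : Enum Θ × Enum Θ | p.1.toFinset ⊆ p.2.toFinset} ∩
      Prod.swap ⁻¹' {p : Enum Θ × Enum Θ | p.1.toFinset ⊆ p.2.toFinset} := by
    ext p
    exact Finset.Subset.antisymm_iff
  rw [this]
  exact hsub.inter (measurable_swap hsub)

/-! ### The algorithm on enumerated sample sets -/

namespace Setup

variable {A : Setup d m n Θ}

/-- A pass of the refinement loop. -/
def lpass (A : Setup d m n Θ) (t : ℕ) (p : (Θ × E m) × ℝ × ℝ) (a : Enum Θ) : Enum Θ :=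
  if A.refine t p a.toFinset = 0 then a.push (A.rS a.toFinset p.1.1 p.1.2)
  else if A.refine t p a.toFinset = 1 then a.push p.1.1 else a

theorem toFinset_lpass (t : ℕ) (p : (Θ × E m) × ℝ × ℝ) (a : Enum Θ) :
    (A.lpass t p a).toFinset = A.pass t p.1.1 p.1.2 a.toFinset p.2 := by
  rw [pass_eq, lpass]
  split_ifs <;> simp [Enum.toFinset_push]

/-- Successive passes of the refinement loop. -/
def lpasses (A : Setup d m n Θ) (t : ℕ) (x : Θ × Enum Θ) (w : Noise m) : ℕ → Enum Θ
  | 0 => x.2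
  | k + 1 => A.lpass t ((x.1, w.1), w.2.1 k) (lpasses A t x w k)

theorem toFinset_lpasses (t : ℕ) (x : Θ × Enum Θ) (w : Noise m) (k : ℕ) :
    (A.lpasses t x w k).toFinset = A.passes t x.1 w.1 x.2.toFinset w.2.1 k := by
  induction k with
  | zero => rfl
  | succ k ih => rw [lpasses, toFinset_lpass, ih, passes]

/-- The loop ends with the given pass. -/
def LStop (A : Setup d m n Θ) (t : ℕ) (x : Θ × Enum Θ) (w : Noise m) (k : ℕ) : Prop :=
  (A.lpasses t x w (k + 1)).toFinset = (A.lpasses t x w k).toFinset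

open Classical in
/-- One step of the algorithm. -/
def lstep (A : Setup d m n Θ) (t : ℕ) (x : Θ × Enum Θ) (w : Noise m) : Θ × Enum Θ :=
  if h : ∃ k, A.LStop t x w k then
    (A.moveS (A.lpasses t x w (Nat.find h)).toFinset x.1 w.1 w.2.2, A.lpasses t x w (Nat.find h))
  else x

open Classical in
-- `lpass` may push a point that is already listed, which lengthens the enumeration but not the set.
-- The two loops stop together because `LStop` compares the underlying sets.
theorem step_eq (t : ℕ) (x : Θ × Enum Θ) (w : Noise m) :
    A.step t (x.1, x.2.toFinset) w = ((A.lstep t x w).1, (A.lstep t x w).2.toFinset) := by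
  have hiff : ∀ k, A.LStop t x w k ↔ A.passes t x.1 w.1 x.2.toFinset w.2.1 (k + 1) =
      A.passes t x.1 w.1 x.2.toFinset w.2.1 k := fun k => by
    rw [LStop, toFinset_lpasses, toFinset_lpasses]
  unfold step lstep
  by_cases h : ∃ k, A.LStop t x w k
  · have h' := h.imp fun k => (hiff k).1
    have hf : Nat.find h' = Nat.find h := Nat.find_congr' fun {k} => (hiff k).symm
    rw [dif_pos h, dif_pos h']
    simp only [toFinset_lpasses, hf]
  · have h' := fun h' : ∃ k, A.passes t x.1 w.1 x.2.toFinset w.2.1 (k + 1) =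
      A.passes t x.1 w.1 x.2.toFinset w.2.1 k => h (h'.imp fun k => (hiff k).2)
    rw [dif_neg h, dif_neg h']

/-- The run of the algorithm. -/
def lrun (A : Setup d m n Θ) (x : Θ × Enum Θ) (w : ℕ → Noise m) : ℕ → Θ × Enum Θ
  | 0 => x
  | t + 1 => A.lstep t (lrun A x w t) (w t)

theorem run_eq (x : Θ × Enum Θ) (w : ℕ → Noise m) (t : ℕ) :
    A.run (x.1, x.2.toFinset) w t = ((A.lrun x w t).1, (A.lrun x w t).2.toFinset) := by
  induction t with
  | zero => rfl
  | succ t ih => rw [run, lrun, ih, step_eq]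

section

variable [CompactSpace Θ]

theorem measurable_lpass (hA : A.Standing) (hS : A.Sufficient) (t : ℕ) :
    Measurable fun p : ((Θ × E m) × ℝ × ℝ) × Enum Θ => A.lpass t p.1 p.2 := by
  have h1 := (measOn_refine hA hS t).measurable
  have h2 := ((measOn_rS hA hS).comp_left (measurable_fst (α := Θ × E m) (β := ℝ × ℝ))).measurable
  exact Measurable.ite (measurableSet_eq_fun h1 measurable_const)
    (Enum.measurable_push.comp (measurable_snd.prodMk h2))
    (Measurable.ite (measurableSet_eq_fun h1 measurable_const)
    (Enum.measurable_push.comp (f := fun p : ((Θ × E m) × ℝ × ℝ) × Enum Θ => (p.2, p.1.1.1))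
      (by fun_prop)) measurable_snd)

theorem measurable_lpasses (hA : A.Standing) (hS : A.Sufficient) (t k : ℕ) :
    Measurable fun p : (Θ × Enum Θ) × Noise m => A.lpasses t p.1 p.2 k := by
  induction k with
  | zero => exact measurable_snd.comp measurable_fst
  | succ k ih =>
    exact (measurable_lpass hA hS t).comp (f := fun p : (Θ × Enum Θ) × Noise m =>
      (((p.1.1, p.2.1), p.2.2.1 k), A.lpasses t p.1 p.2 k)) (Measurable.prodMk (by fun_prop) ih)

theorem measurableSet_lStop (hA : A.Standing) (hS : A.Sufficient) (t k : ℕ) :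
    MeasurableSet {p : (Θ × Enum Θ) × Noise m | A.LStop t p.1 p.2 k} :=
  ((measurable_lpasses hA hS t (k + 1)).prodMk (measurable_lpasses hA hS t k))
    Enum.measurableSet_toFinset_eq

theorem measurable_lstep (hA : A.Standing) (hS : A.Sufficient) (t : ℕ) :
    Measurable fun p : (Θ × Enum Θ) × Noise m => A.lstep t p.1 p.2 := by
  classical
  have hG : MeasurableSet {p : (Θ × Enum Θ) × Noise m | ∃ k, A.LStop t p.1 p.2 k} := by
    rw [Set.ofPred_exists]
    exact MeasurableSet.iUnion fun k => measurableSet_lStop hA hS t k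
  -- The non-terminating case is added as an alternative so that the least index is defined
  -- everywhere, as `Measurable.find` needs.
  have hp : ∀ k, MeasurableSet {p : (Θ × Enum Θ) × Noise m |
      A.LStop t p.1 p.2 k ∨ ¬ ∃ k, A.LStop t p.1 p.2 k} := fun k =>
    (measurableSet_lStop hA hS t k).union hG.compl
  have hex : ∀ p : (Θ × Enum Θ) × Noise m,
      ∃ k, A.LStop t p.1 p.2 k ∨ ¬ ∃ k, A.LStop t p.1 p.2 k := fun p => by
    by_cases h : ∃ k, A.LStop t p.1 p.2 k
    · exact h.imp fun k hk => Or.inl hk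
    · exact ⟨0, Or.inr h⟩
  have hf : ∀ k, Measurable fun p : (Θ × Enum Θ) × Noise m =>
      (A.moveS (A.lpasses t p.1 p.2 k).toFinset p.1.1 p.2.1 p.2.2.2, A.lpasses t p.1 p.2 k) :=
    fun k => ((measOn_moveS hA hS).measurable.comp (f := fun p : (Θ × Enum Θ) × Noise m =>
      (((p.1.1, p.2.1), p.2.2.2), A.lpasses t p.1 p.2 k))
      (Measurable.prodMk (by fun_prop) (measurable_lpasses hA hS t k))).prodMk
      (measurable_lpasses hA hS t k)
  have h1 : Measurable fun p : (Θ × Enum Θ) × Noise m => if ∃ k, A.LStop t p.1 p.2 k then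
      (A.moveS (A.lpasses t p.1 p.2 (Nat.find (hex p))).toFinset p.1.1 p.2.1 p.2.2.2,
        A.lpasses t p.1 p.2 (Nat.find (hex p))) else p.1 :=
    Measurable.ite hG (Measurable.find hf hp hex) measurable_fst
  convert h1 using 2 with p
  unfold lstep
  split_ifs with h
  · have : ∀ k, (A.LStop t p.1 p.2 k ∨ ¬ ∃ k, A.LStop t p.1 p.2 k) ↔ A.LStop t p.1 p.2 k :=
      fun k => by simp [h]
    simp only [this]
  · rfl

theorem measurable_lrun (hA : A.Standing) (hS : A.Sufficient) (x : Θ × Enum Θ) (t : ℕ) :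
    Measurable fun w : ℕ → Noise m => A.lrun x w t := by
  induction t with
  | zero => exact measurable_const
  | succ t ih =>
    exact (measurable_lstep hA hS t).comp (f := fun w : ℕ → Noise m => (A.lrun x w t, w t))
      (ih.prodMk (measurable_pi_apply t))

end

end Setup

end LAMCMC

namespace LAMCMC

variable {d m n : ℕ} {Θ : Set (E d)}

/-! ### Covers and nets -/

theorem IsCover.exists_dist_lt {ε : ℝ} {S : Finset Θ} (h : IsCover ε S) (θ : Θ) :
    ∃ s ∈ S, dist θ s < ε := by
  have h1 : Metric.infEDist θ (S : Set Θ) < ENNReal.ofReal ε :=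
    lt_of_le_of_lt (le_iSup (fun θ : Θ => Metric.infEDist θ (S : Set Θ)) θ) h
  obtain ⟨s, hs, hd⟩ := Metric.infEDist_lt_iff.1 h1
  exact ⟨s, hs, edist_lt_ofReal.1 hd⟩

theorem isCover_of_dist_lt {ε r : ℝ} (hε : 0 < ε) (hr : r < ε) {S : Finset Θ}
    (h : ∀ θ : Θ, ∃ s ∈ S, dist θ s < r) : IsCover ε S := by
  refine lt_of_le_of_lt (iSup_le fun θ => ?_) ((ENNReal.ofReal_lt_ofReal_iff hε).2 hr)
  obtain ⟨s, hs, hd⟩ := h θ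
  refine (Metric.infEDist_le_edist_of_mem (Finset.mem_coe.2 hs)).trans ?_
  rw [edist_dist]
  exact ENNReal.ofReal_le_ofReal hd.le

theorem IsCover.mono {ε : ℝ} {S S' : Finset Θ} (h : IsCover ε S) (hS : S ⊆ S') : IsCover ε S' :=
  lt_of_le_of_lt (iSup_mono fun _ => Metric.infEDist_anti (Finset.coe_subset.2 hS)) h

theorem infinite_ball (hd : 1 ≤ d) (hreg : closure (interior Θ) = Θ) (x : Θ) {R : ℝ} (hR : 0 < R) :
    (Metric.ball x R).Infinite := by
  obtain ⟨V, hV, ⟨v, hv⟩, hVs⟩ := exists_interior_mem_of_isOpen hreg Metric.isOpen_ball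
    ⟨x, Metric.mem_ball_self hR⟩
  have : Nonempty (Fin d) := ⟨⟨0, hd⟩⟩
  have : (𝓝[≠] v).NeBot := Module.punctured_nhds_neBot ℝ (E d) v
  have hinf : V.Infinite := infinite_of_mem_nhds v (hV.mem_nhds hv)
  exact (hinf.mono hVs).of_image _

theorem exists_net [CompactSpace Θ] (hd : 1 ≤ d) (hreg : closure (interior Θ) = Θ) (k : ℕ) {R : ℝ}
    (hR : 0 < R) : ∃ F : Finset Θ, ∀ x : Θ, ∃ T ⊆ F, T.card = k ∧ ∀ t ∈ T, dist t x < R := by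
  classical
  obtain ⟨C, -, hCf, hC⟩ := (isCompact_univ (X := Θ)).finite_cover_balls (half_pos hR)
  have hT : ∀ c : Θ, ∃ T : Finset Θ, T.card = k ∧ ∀ t ∈ T, dist t c < R / 2 := fun c => by
    obtain ⟨T, hT, hk⟩ := (infinite_ball hd hreg c (half_pos hR)).exists_subset_card_eq k
    exact ⟨T, hk, fun t ht => hT ht⟩
  choose T hT1 hT2 using hT
  refine ⟨hCf.toFinset.biUnion T, fun x => ?_⟩
  obtain ⟨c, hc, hx⟩ := Set.mem_iUnion₂.1 (hC (Set.mem_univ x))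
  refine ⟨T c, Finset.subset_biUnion_of_mem T (hCf.mem_toFinset.2 hc), hT1 c, fun t ht => ?_⟩
  have h1 := hT2 c t ht
  have h2 : dist x c < R / 2 := hx
  have := dist_triangle_right t x c
  linarith

theorem exists_pos_le_dist (F : Finset Θ) :
    ∃ s > 0, ∀ x ∈ F, ∀ y ∈ F, x ≠ y → s ≤ dist x y := by
  classical
  rcases (F ×ˢ F).filter (fun p => p.1 ≠ p.2) |>.eq_empty_or_nonempty with h | h
  · refine ⟨1, one_pos, fun x hx y hy hne => ?_⟩
    have : (x, y) ∈ (F ×ˢ F).filter (fun p => p.1 ≠ p.2) := by simp [hx, hy, hne]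
    rw [h] at this
    simp at this
  · obtain ⟨p, hp, hmin⟩ := Finset.exists_min_image _ (fun p : Θ × Θ => dist p.1 p.2) h
    refine ⟨dist p.1 p.2, dist_pos.2 (Finset.mem_filter.1 hp).2, fun x hx y hy hne => ?_⟩
    exact hmin (x, y) (by simp [hx, hy, hne])

/-- A finite net F has enough points within R/2 of every θ, at mutual distance at least s. In a
cover finer than s/2, distinct net points have distinct neighbours in S, so S has enough points
within R of θ. -/
theorem IsCover.nodes_near [CompactSpace Θ] (hd : 1 ≤ d) (hreg : closure (interior Θ) = Θ) {R : ℝ}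
    (hR : 0 < R) : ∃ ε > 0, ∀ S : Finset Θ, IsCover ε S → ∀ θ : Θ,
      (Setup.nodes S θ).Nonempty ∧ ∀ s ∈ Setup.nodes S θ, dist s θ < R := by
  classical
  obtain ⟨F, hF⟩ := exists_net hd hreg (numNodes d) (half_pos hR)
  obtain ⟨s, hs, hsep⟩ := exists_pos_le_dist F
  refine ⟨min (s / 2) (R / 2), by positivity, fun S hS θ => ⟨?_, ?_⟩⟩
  · obtain ⟨t, ht, -⟩ := hS.exists_dist_lt θ
    exact nearest_nonempty numNodes_pos ⟨t, ht⟩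
  · choose f hf1 hf2 using hS.exists_dist_lt
    obtain ⟨T, hTF, hTc, hT⟩ := hF θ
    have hinj : Set.InjOn f T := by
      intro x hx y hy hxy
      by_contra hne
      have h1 := hsep x (hTF hx) y (hTF hy) hne
      have h2 := hf2 x
      have h3 := hf2 y
      rw [← hxy] at h3
      have := dist_triangle_right x y (f x)
      have := min_le_left (s / 2) (R / 2)
      linarith
    intro u hu
    refine dist_lt_of_mem_nearest (T := T.image f) (fun t ht => ?_) ?_ (fun t ht => ?_) hu
    · obtain ⟨x, -, rfl⟩ := Finset.mem_image.1 ht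
      exact hf1 x
    · rw [Finset.card_image_of_injOn hinj, hTc]
    · obtain ⟨x, hx, rfl⟩ := Finset.mem_image.1 ht
      have h1 := hf2 x
      have h2 := hT x hx
      have := dist_triangle_left (f x) θ x
      have := min_le_right (s / 2) (R / 2)
      linarith

/-! ### The kernels and the distance to the starting point -/

instance : IsProbabilityMeasure unif := ⟨by simp [unif]⟩

theorem unif_lt {a : ℝ} (h1 : a ≤ 1) : unif {u | u < a} = ENNReal.ofReal a := by
  have hset : MeasurableSet {u : ℝ | u < a} := measurableSet_Iio
  rw [unif, Measure.restrict_apply hset]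
  have : {u : ℝ | u < a} ∩ Set.Icc 0 1 = Set.Ico 0 a := by
    ext u
    simp only [Set.mem_inter_iff, Set.mem_ofPred_eq, Set.mem_Icc, Set.mem_Ico]
    constructor
    · rintro ⟨h, h0, -⟩; exact ⟨h0, h⟩
    · rintro ⟨h0, h⟩; exact ⟨h, h0, by linarith⟩
  rw [this, Real.volume_Ico, sub_zero]

/-- The distance to θ is 1-Lipschitz. Through this, closeness of the kernels becomes a comparison of
mean displacements. -/
theorem lintegral_edist_le_add_wasserstein {X : Type*} [PseudoEMetricSpace X] [MeasurableSpace X]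
    [OpensMeasurableSpace X] (θ : X) (μ ν : Measure X) :
    ∫⁻ x, edist θ x ∂ν ≤ ∫⁻ x, edist θ x ∂μ + wasserstein μ ν := by
  rw [← tsub_le_iff_left]
  refine le_iInf₂ fun κ hκ => ?_
  rw [tsub_le_iff_left]
  have hm : Measurable fun x => edist θ x := measurable_edist_right
  have h1 : Measurable fun p : X × X => edist θ p.1 := hm.comp measurable_fst
  rw [← hκ.1, ← hκ.2, lintegral_map hm measurable_fst, lintegral_map hm measurable_snd,
    ← lintegral_add_left h1]
  exact lintegral_mono fun p => edist_triangle _ _ _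

namespace Setup

variable {A : Setup d m n Θ}

theorem measurable_rInf (hA : A.Standing) (θ : Θ) : Measurable fun z => A.rInf θ z :=
  hA.measurable_r_exact.comp (f := fun z => (θ, z)) (by fun_prop)

theorem map_rInf (hA : A.Standing) (θ : Θ) : (stdGaussian (E m)).map (A.rInf θ) =
    (vol Θ).withDensity fun y => ENNReal.ofReal (A.q θ y A.exact) :=
  hA.law_r A.exact (Or.inl rfl) θ

theorem map_rS (hA : A.Standing) (hS : A.Sufficient) (S : Finset Θ) (θ : Θ) :
    (stdGaussian (E m)).map (A.rS S θ) =
      (vol Θ).withDensity fun y => ENNReal.ofReal (A.q θ y A.exact) := by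
  have := hA.law_r _ (admissible_approx S θ) θ
  simp only [hS.q_indep θ _ (A.approx S θ) A.exact] at this
  exact this

theorem measurable_moveInf (hA : A.Standing) (hS : A.Sufficient) (θ : Θ) :
    Measurable fun p : E m × ℝ => A.moveInf θ p.1 p.2 := by
  have hr : Measurable fun p : E m × ℝ => A.rInf θ p.1 := (measurable_rInf hA θ).comp measurable_fst
  have ha : Measurable fun p : E m × ℝ => A.αInf θ (A.rInf θ p.1) :=
    (αInf_continuous hA hS).measurable.comp (f := fun p : E m × ℝ => (θ, A.rInf θ p.1))
      (measurable_const.prodMk hr)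
  exact Measurable.ite (measurableSet_lt measurable_snd ha) hr measurable_const

theorem measurable_moveS [CompactSpace Θ] (hA : A.Standing) (hS : A.Sufficient) (S : Finset Θ)
    (θ : Θ) : Measurable fun p : E m × ℝ => A.moveS S θ p.1 p.2 := by
  have : Nonempty Θ := ⟨θ⟩
  obtain ⟨a, rfl⟩ := Enum.exists_toFinset_eq S
  exact (measOn_moveS hA hS).measurable.comp
    (f := fun p : E m × ℝ => (((θ, p.1), p.2), a)) (by fun_prop)

/-- Of two fixed points at distance D, at least one is D/2 or more away from θ, and its ball of
radius D/4 then stays at distance at least D/4 from θ. -/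
theorem exists_lintegral_edist_pos [CompactSpace Θ] (hd : 1 ≤ d) (hS : A.Sufficient) (θ₀ : Θ) :
    ∃ c : ℝ, 0 < c ∧ ∀ θ : Θ, ENNReal.ofReal c ≤ ∫⁻ y, edist θ y ∂(vol Θ) := by
  have := isFiniteMeasure_vol hS.compact
  obtain ⟨p, -, hp⟩ := (infinite_ball hd hS.regular θ₀ one_pos).exists_notMem_finset {θ₀}
  rw [Finset.mem_singleton] at hp
  set D := dist p θ₀ with hD
  have hD0 : 0 < D := dist_pos.2 hp
  have hball : ∀ c θ : Θ, D / 2 ≤ dist θ c →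
      ENNReal.ofReal (D / 4) * vol Θ (Metric.ball c (D / 4)) ≤ ∫⁻ y, edist θ y ∂(vol Θ) := by
    intro c θ h
    rw [← setLIntegral_const]
    refine (setLIntegral_mono' Metric.isOpen_ball.measurableSet fun y hy => ?_).trans
      (setLIntegral_le_lintegral (Metric.ball c (D / 4)) _)
    rw [edist_dist]
    refine ENNReal.ofReal_le_ofReal ?_
    have h1 : dist y c < D / 4 := hy
    have := dist_triangle θ y c
    linarith
  have hv : ∀ c : Θ, 0 < vol Θ (Metric.ball c (D / 4)) := fun c =>
    vol_pos_of_isOpen hS.compact hS.regular Metric.isOpen_ball ⟨c, Metric.mem_ball_self (by positivity)⟩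
  set v := min (vol Θ (Metric.ball p (D / 4))) (vol Θ (Metric.ball θ₀ (D / 4))) with hvdef
  have hv0 : 0 < v := lt_min (hv _) (hv _)
  have hvt : v ≠ ∞ := ne_top_of_le_ne_top (measure_ne_top _ _) (min_le_left _ _)
  refine ⟨D / 4 * v.toReal, mul_pos (by positivity) (ENNReal.toReal_pos hv0.ne' hvt), fun θ => ?_⟩
  rw [ENNReal.ofReal_mul (by positivity), ENNReal.ofReal_toReal hvt]
  by_cases h : D / 2 ≤ dist θ p
  · exact (mul_le_mul_right (min_le_left _ _) _).trans (hball p θ h)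
  · refine (mul_le_mul_right (min_le_right _ _) _).trans (hball θ₀ θ ?_)
    have := dist_triangle_left p θ₀ θ
    linarith

/-- The proposal density and the acceptance probability of the exact chain are both bounded below,
so its mean displacement dominates a multiple of the mean distance under Lebesgue measure. -/
theorem exists_le_lintegral_KInf [CompactSpace Θ] (hd : 1 ≤ d) (hA : A.Standing) (hS : A.Sufficient)
    (θ₀ : Θ) : ∃ c : ℝ, 0 < c ∧ ∀ θ : Θ, ENNReal.ofReal c ≤ ∫⁻ y, edist θ y ∂(A.KInf θ) := by
  obtain ⟨c, hc, hcl⟩ := exists_lintegral_edist_pos hd hS θ₀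
  obtain ⟨a, ha, hal⟩ := αInf_lower hA hS
  obtain ⟨cq, Cq, hcq, -, hq⟩ := q_bounds hS
  refine ⟨a * (cq * c), by positivity, fun θ => ?_⟩
  have hm : Measurable fun x : Θ => edist θ x := measurable_edist_right
  have hqm : Measurable fun y => ENNReal.ofReal (A.q θ y A.exact) :=
    (hS.q_cont.measurable.comp (f := fun y => (θ, y)) (by fun_prop)).ennreal_ofReal
  calc ENNReal.ofReal (a * (cq * c))
      ≤ ENNReal.ofReal a * (ENNReal.ofReal cq * ∫⁻ y, edist θ y ∂(vol Θ)) := by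
        rw [ENNReal.ofReal_mul ha.le, ENNReal.ofReal_mul hcq.le]
        gcongr
        exact hcl θ
    _ ≤ ENNReal.ofReal a * ∫⁻ y, ENNReal.ofReal (A.q θ y A.exact) * edist θ y ∂(vol Θ) := by
        rw [← lintegral_const_mul _ hm]
        gcongr with y
        exact (hq θ y A.exact).1
    _ = ENNReal.ofReal a * ∫⁻ z, edist θ (A.rInf θ z) ∂(stdGaussian (E m)) := by
        rw [← lintegral_map hm (measurable_rInf hA θ), map_rInf hA,
          lintegral_withDensity_eq_lintegral_mul _ hqm hm]
        rfl
    _ ≤ ∫⁻ z, ∫⁻ u, edist θ (A.moveInf θ z u) ∂unif ∂(stdGaussian (E m)) := by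
        have h1 : Measurable fun z => edist θ (A.rInf θ z) := hm.comp (measurable_rInf hA θ)
        rw [← lintegral_const_mul _ h1]
        refine lintegral_mono fun z => ?_
        calc ENNReal.ofReal a * edist θ (A.rInf θ z)
            ≤ edist θ (A.rInf θ z) * unif {u | u < A.αInf θ (A.rInf θ z)} := by
              rw [unif_lt (αInf_le_one _ _), mul_comm]
              gcongr
              exact hal _ _
          _ = ∫⁻ u in {u | u < A.αInf θ (A.rInf θ z)}, edist θ (A.rInf θ z) ∂unif := by
              rw [setLIntegral_const]
          _ ≤ ∫⁻ u in {u | u < A.αInf θ (A.rInf θ z)}, edist θ (A.moveInf θ z u) ∂unif := by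
              refine setLIntegral_mono' (measurableSet_lt measurable_id measurable_const)
                fun u hu => ?_
              rw [moveInf, if_pos (show u < A.αInf θ (A.rInf θ z) from hu)]
          _ ≤ _ := setLIntegral_le_lintegral _ _
    _ = ∫⁻ y, edist θ y ∂(A.KInf θ) := by
        have h1 : Measurable fun p : E m × ℝ => edist θ (A.moveInf θ p.1 p.2) :=
          hm.comp (measurable_moveInf hA hS θ)
        rw [KInf, lintegral_map hm (measurable_moveInf hA hS θ), lintegral_prod _ h1.aemeasurable]

/-- A proposal either lies within r of θ, or is accepted with probability at most τ and then moves
the point by at most D. -/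
theorem lintegral_KS_le [CompactSpace Θ] (hA : A.Standing) (hS : A.Sufficient) (S : Finset Θ) (θ : Θ)
    {r τ D : ℝ} (hD : ∀ y : Θ, dist θ y ≤ D) (hτ : ∀ y, r ≤ dist y θ → A.αS S θ y ≤ τ) :
    ∫⁻ y, edist θ y ∂(A.KS S θ) ≤ ENNReal.ofReal r + ENNReal.ofReal D * ENNReal.ofReal τ := by
  have hm : Measurable fun x : Θ => edist θ x := measurable_edist_right
  have h1 : Measurable fun p : E m × ℝ => edist θ (A.moveS S θ p.1 p.2) :=
    hm.comp (measurable_moveS hA hS S θ)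
  rw [KS, lintegral_map hm (measurable_moveS hA hS S θ), lintegral_prod _ h1.aemeasurable]
  refine (lintegral_mono (g := fun _ => ENNReal.ofReal r + ENNReal.ofReal D * ENNReal.ofReal τ)
    fun z => ?_).trans (by simp)
  by_cases h : r ≤ dist (A.rS S θ z) θ
  · refine le_trans ?_ le_add_self
    calc ∫⁻ u, edist θ (A.moveS S θ z u) ∂unif
        ≤ ∫⁻ u, ({u | u < A.αS S θ (A.rS S θ z)}.indicator fun _ => ENNReal.ofReal D) u ∂unif := by
          refine lintegral_mono fun u => ?_
          by_cases hu : u < A.αS S θ (A.rS S θ z)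
          · rw [Set.indicator_of_mem (by exact hu), edist_dist]
            exact ENNReal.ofReal_le_ofReal (hD _)
          · simp [moveS, hu]
      _ = ENNReal.ofReal D * ENNReal.ofReal (A.αS S θ (A.rS S θ z)) := by
          have h2 : MeasurableSet {u | u < A.αS S θ (A.rS S θ z)} := measurableSet_Iio
          rw [lintegral_indicator_const h2, unif_lt (αS_le_one _ _ _)]
      _ ≤ _ := by
          gcongr
          exact hτ _ h
  · refine le_trans ?_ le_self_add
    refine (lintegral_mono (g := fun _ => ENNReal.ofReal r) fun u => ?_).trans (by simp)
    push Not at h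
    dsimp only
    rw [moveS]
    split_ifs
    · rw [edist_comm, edist_dist]
      exact ENNReal.ofReal_le_ofReal h.le
    · simp

/-- F has finitely many subsets. On each, either a single polynomial serves all x, or the fit is one
of finitely many values of g. -/
theorem exists_fit_le [CompactSpace Θ] {g : Θ → ℝ} (F : Finset Θ) :
    ∃ M : ℝ, ∀ T ⊆ F, ∀ x : Θ, fit g x T x ≤ M := by
  classical
  have h : ∀ T : Finset Θ, ∃ M : ℝ, ∀ x : Θ, fit g x T x ≤ M := fun T => by
    by_cases hT : ∃! P : E d → ℝ, Interpolates T g P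
    · obtain ⟨P, hP⟩ := hT.exists
      obtain ⟨M, hM⟩ := (isCompact_range (hP.1.continuous.comp
        (continuous_subtype_val (p := fun x => x ∈ Θ)))).bddAbove
      refine ⟨M, fun x => ?_⟩
      rw [fit_of_existsUnique hT hP]
      exact hM ⟨x, rfl⟩
    · refine ⟨∑ s ∈ T, |g s|, fun x => ?_⟩
      rw [fit, dif_neg hT]
      exact (Finset.sum_le_sum fun s _ => le_abs_self (g s)).trans
        (Finset.sum_le_sum_of_subset_of_nonneg (nearest_subset _ _ _) fun _ _ _ => abs_nonneg _)
  choose B hB using h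
  obtain ⟨M, hM⟩ := (F.powerset.image B).exists_le
  exact ⟨M, fun T hT x =>
    (hB T x).trans (hM _ (Finset.mem_image_of_mem _ (Finset.mem_powerset.2 hT)))⟩

/-- Under the convergence assumptions, a local model near a point, on any admissible set of nodes, is
bounded above. -/
theorem exists_fit_bound [CompactSpace Θ] (hd : 1 ≤ d) (hA : A.Standing) (hC : A.Convergence) :
    ∃ h₀ > 0, ∀ h, 0 < h → h < h₀ → ∀ y₀ : Θ, ∃ M : ℝ, ∀ Y : Finset Θ, Y.card = numNodes d →
      (∀ y ∈ Y, dist y y₀ < h) → ∀ θ : Θ, dist θ y₀ < h → fit A.exact θ Y θ ≤ M := by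
  classical
  rcases isEmpty_or_nonempty Θ with he | ⟨⟨θ₀⟩⟩
  · exact ⟨1, one_pos, fun _ _ _ y => he.elim y⟩
  have hS := hC.sufficient
  obtain ⟨c, hc, hcl⟩ := exists_le_lintegral_KInf hd hA hS θ₀
  obtain ⟨ε, hε, hker⟩ := hC.kernel_close (c / 4) (by positivity)
  obtain ⟨cq, Cq, hcq, hCq, hq⟩ := q_bounds hS
  obtain ⟨D, hDb⟩ := (Metric.isBounded_iff.1 (isCompact_univ (X := Θ)).isBounded)
  have hD : ∀ x y : Θ, dist x y ≤ max D 1 := fun x y =>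
    le_max_of_le_left (hDb (Set.mem_univ x) (Set.mem_univ y))
  have hD0 : 0 < max D 1 := by positivity
  -- The bound ε/6 makes the sample set built below an ε-cover; c/32 makes the radius 8h contribute
  -- at most c/4 to the mean displacement.
  refine ⟨min (ε / 6) (c / 32), by positivity, fun h hh hh₀ y₀ => ?_⟩
  have hh1 : 6 * h < ε := by have := hh₀.trans_le (min_le_left _ _); linarith
  have hh2 : 8 * h ≤ c / 4 := by have := hh₀.trans_le (min_le_right _ _); linarith
  obtain ⟨F, hF⟩ := exists_net hd hS.regular (numNodes d) hh
  obtain ⟨MF, hMF⟩ := exists_fit_le (g := A.exact) F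
  -- The bound comes from solving D τ ≥ c/2 for the value of the fit at θ, where D is the bound `max
  -- D 1` on distances and τ is the acceptance bound introduced below.
  refine ⟨MF - Real.log (c / (2 * max D 1 * (Cq / cq))), fun Y hYc hY θ hθ => ?_⟩
  -- Y is completed to a cover by net points so far from y₀ that the nodes at θ remain exactly Y.
  set F' := F.filter fun x => 4 * h ≤ dist x y₀ with hF'
  set S := F' ∪ Y with hSdef
  have hnodes : nodes S θ = Y := by
    rw [nodes, ← hYc]
    refine nearest_union_eq (R := 2 * h) (fun y hy => ?_) fun y hy => ?_
    · have := dist_triangle_right y θ y₀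
      linarith [hY y hy]
    · have := dist_triangle y θ y₀
      linarith [(Finset.mem_filter.1 hy).2]
  have hcover : IsCover ε S := by
    refine isCover_of_dist_lt hε hh1 fun x => ?_
    by_cases hx : dist x y₀ < 5 * h
    · obtain ⟨y, hy⟩ := Finset.card_pos.1 (hYc ▸ numNodes_pos (d := d))
      refine ⟨y, Finset.mem_union_right _ hy, ?_⟩
      have := dist_triangle_right x y y₀
      linarith [hY y hy]
    · obtain ⟨T, hTF, hTc, hT⟩ := hF x
      obtain ⟨t, ht⟩ := Finset.card_pos.1 (hTc ▸ numNodes_pos (d := d))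
      have h1 := hT t ht
      rw [dist_comm] at h1
      have := dist_triangle x t y₀
      exact ⟨t, Finset.mem_union_left _ (Finset.mem_filter.2 ⟨hTF ht, by linarith⟩), by linarith⟩
  -- Far from θ the nodes all come from the net F, so the fits there are bounded independently of Y.
  have hfar : ∀ x, 8 * h ≤ dist x θ → A.approx S x x ≤ MF := fun x hx => by
    refine hMF _ (fun s hs => ?_) x
    obtain ⟨T, hTF, hTc, hT⟩ := hF x
    have hxy := dist_triangle_right x θ y₀
    have hTS : T ⊆ S := fun t ht => by
      have h1 := hT t ht
      have := dist_triangle_left x y₀ t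
      exact Finset.mem_union_left _ (Finset.mem_filter.2 ⟨hTF ht, by linarith⟩)
    have hsx := dist_lt_of_mem_nearest hTS hTc.ge hT hs
    rcases Finset.mem_union.1 (nearest_subset _ _ _ hs) with h' | h'
    · exact (Finset.mem_filter.1 h').1
    · have := hY s h'
      have := dist_triangle_left x y₀ s
      linarith
  set τ := Real.exp (MF - A.approx S θ θ) * (Cq / cq) with hτ
  have hα : ∀ x, 8 * h ≤ dist x θ → A.αS S θ x ≤ τ := fun x hx => by
    refine (min_le_right _ _).trans ?_
    rw [ratio_eq hS, hτ, Real.exp_sub, div_mul_div_comm]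
    gcongr
    · exact (q_pos hS _ _ _).le
    · exact hfar x hx
    · exact (hq _ _ _).2
    · exact (hq _ _ _).1
  have hW := lt_of_le_of_lt (le_iSup (fun θ => wasserstein (A.KS S θ) (A.KInf θ)) θ)
    (hker S hcover)
  -- The mean displacement c of the exact chain is at most 8h + D τ plus the kernel error c/4. Since
  -- 8h ≤ c/4, τ cannot be small, and so the fit at θ cannot be large.
  have h1 := (hcl θ).trans ((lintegral_edist_le_add_wasserstein θ (A.KS S θ) _).trans
    (add_le_add (lintegral_KS_le hA hS S θ (hD θ) hα) hW.le))
  have hτ0 : 0 < τ := by positivity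
  rw [← ENNReal.ofReal_mul hD0.le, ← ENNReal.ofReal_add (by positivity) (by positivity),
    ← ENNReal.ofReal_add (by positivity) (by positivity),
    ENNReal.ofReal_le_ofReal_iff (by positivity)] at h1
  have h2 : c / (2 * max D 1 * (Cq / cq)) ≤ Real.exp (MF - A.approx S θ θ) := by
    rw [div_le_iff₀ (by positivity)]
    rw [hτ] at h1
    nlinarith
  have h3 := Real.log_le_log (by positivity) h2
  rw [Real.log_exp] at h3
  have h4 : A.approx S θ θ = fit A.exact θ Y θ := by rw [approx, hnodes]
  linarith

end Setup

end LAMCMC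

namespace LAMCMC

variable {d m n : ℕ} {Θ : Set (E d)}

/-! ### Functions that are quadratic on lines -/

/-- The right-hand side is the limit of the extrapolation formula as s tends to 0. Clearing
denominators gives a function F that vanishes near 0, and F''(0) = 0 is the claim; φ' need be
differentiable only at 0. -/
theorem sub_eq_of_extrap_eventually {φ φ' : ℝ → ℝ} {c K : ℝ}
    (h1 : ∀ᶠ s in 𝓝 0, HasDerivAt φ (φ' s) s) (h2 : HasDerivAt φ' c 0)
    (hK : ∀ᶠ s in 𝓝 (0 : ℝ), s ≠ 0 → K = extrap s (φ (-s)) (φ 0) (φ s)) :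
    K = φ 0 + φ' 0 + c / 2 := by
  set F : ℝ → ℝ := fun s => φ s * (s + 1) + φ (-s) * (1 - s) - 2 * (K - φ 0) * s ^ 2 - 2 * φ 0
    with hF
  set F' : ℝ → ℝ := fun s => φ' s * (s + 1) + φ s - φ' (-s) * (1 - s) - φ (-s) -
    4 * (K - φ 0) * s with hF'
  have hneg : Tendsto (fun s : ℝ => -s) (𝓝 0) (𝓝 0) := by simpa using tendsto_neg (0 : ℝ)
  have hF0 : ∀ᶠ s in 𝓝 (0 : ℝ), F s = 0 := by
    filter_upwards [hK] with s hs
    rcases eq_or_ne s 0 with rfl | hs0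
    · simp [hF]; ring
    · have := hs hs0
      rw [extrap] at this
      have h3 : (K - φ 0) * (2 * s ^ 2) = (φ s - φ (-s)) * s + (φ s - 2 * φ 0 + φ (-s)) := by
        rw [this]; field_simp; ring
      simp only [hF]
      linarith
  have hd : ∀ᶠ s in 𝓝 (0 : ℝ), HasDerivAt F (F' s) s := by
    filter_upwards [h1, hneg.eventually h1] with s hs hs'
    have e1 := hs.mul ((hasDerivAt_id s).add_const 1)
    have e2 := (hs'.comp s (hasDerivAt_neg s)).mul ((hasDerivAt_id s).const_sub 1)
    have e3 := (((hasDerivAt_id s).pow 2).const_mul (2 * (K - φ 0)))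
    have e4 : HasDerivAt F _ s := ((e1.add e2).sub e3).sub_const (2 * φ 0)
    refine e4.congr_deriv ?_
    simp [hF']
    ring
  have hF'0 : ∀ᶠ s in 𝓝 (0 : ℝ), F' s = 0 := by
    filter_upwards [hd, hF0.eventually_nhds] with s hs hs0
    have h0 : HasDerivAt (fun _ : ℝ => (0 : ℝ)) (F' s) s := hs.congr_of_eventuallyEq
      (by filter_upwards [hs0] with t ht; exact ht.symm)
    exact h0.unique (hasDerivAt_const s 0)
  have h10 : HasDerivAt φ (φ' 0) 0 := h1.self_of_nhds
  have h2' : HasDerivAt (fun s => φ' (-s)) (c * -1) 0 := by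
    have h20 : HasDerivAt φ' c (-0) := by rwa [neg_zero]
    exact h20.comp 0 (hasDerivAt_neg (0 : ℝ))
  have h1' : HasDerivAt (fun s => φ (-s)) (φ' 0 * -1) 0 := by
    have h20 : HasDerivAt φ (φ' 0) (-0) := by rwa [neg_zero]
    exact h20.comp 0 (hasDerivAt_neg (0 : ℝ))
  have e1 := h2.mul ((hasDerivAt_id (0 : ℝ)).add_const 1)
  have e2 := h2'.mul ((hasDerivAt_id (0 : ℝ)).const_sub 1)
  have e3 := (hasDerivAt_id (0 : ℝ)).const_mul (4 * (K - φ 0))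
  have e4 := (((e1.add h10).sub e2).sub h1').sub e3
  have e5 : HasDerivAt (fun _ : ℝ => (0 : ℝ)) _ 0 := e4.congr_of_eventuallyEq (by
    filter_upwards [hF'0] with t ht
    exact ht.symm)
  have := e5.unique (hasDerivAt_const (0 : ℝ) (0 : ℝ))
  simp only [id_eq, neg_zero] at this
  linarith

theorem euclidean_sum_single (x : E d) : x = ∑ i, x i • EuclideanSpace.single i (1 : ℝ) := by
  have := (EuclideanSpace.basisFun (Fin d) ℝ).sum_repr x
  simpa using this.symm

theorem isQuadratic_linear (L : E d →L[ℝ] ℝ) : IsQuadratic fun x => L x := by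
  refine ⟨(0, fun i => L (EuclideanSpace.single i 1), 0), funext fun x => ?_⟩
  conv_lhs => rw [euclidean_sum_single x]
  simp [quad, mul_comm]

theorem isQuadratic_bilinear (B : E d →L[ℝ] E d →L[ℝ] ℝ) : IsQuadratic fun x => B x x := by
  refine ⟨(0, 0, fun i j => B (EuclideanSpace.single i 1) (EuclideanSpace.single j 1)),
    funext fun x => ?_⟩
  conv_lhs => rw [euclidean_sum_single x]
  simp only [map_sum, map_smul, sum_apply, smul_apply,
    smul_eq_mul, quad, Pi.zero_apply, zero_mul, Finset.sum_const_zero, add_zero, zero_add,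
    Finset.mul_sum]
  rw [Finset.sum_comm]
  refine Finset.sum_congr rfl fun i _ => Finset.sum_congr rfl fun j _ => ?_
  ring

theorem isQuadratic_taylor (a : ℝ) (L : E d →L[ℝ] ℝ) (B : E d →L[ℝ] E d →L[ℝ] ℝ) (p : E d) :
    IsQuadratic fun x => a + L (x - p) + B (x - p) (x - p) / 2 := by
  have h := ((isQuadratic_const (d := d) (a - L p + B p p / 2)).add
    (isQuadratic_linear (L - (1 / 2 : ℝ) • (B.flip p + B p)))).add
    ((isQuadratic_bilinear B).smul (1 / 2))
  convert h using 1
  funext x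
  simp
  ring

/-! ### Local quadraticity of the log-posterior and accuracy of the models in dimension at least two
-/

namespace Setup

variable {A : Setup d m n Θ}

/-- Otherwise `exists_interpolant_gt` yields nodes in the same ball whose unique interpolant exceeds
M at a point of the ball. -/
theorem extrap_eq_of_bound [CompactSpace Θ] (hd : 2 ≤ d) {G : E d → ℝ}
    (hG : ∀ θ : Θ, A.exact θ = G θ) {y₀ : Θ} {h M : ℝ}
    (hM : ∀ Y : Finset Θ, Y.card = numNodes d →
      (∀ y ∈ Y, dist y y₀ < h) → ∀ θ : Θ, dist θ y₀ < h → fit A.exact θ Y θ ≤ M)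
    {p x : E d} (hxp : x ≠ p) {s : ℝ} (hs : s ≠ 0) (hGx : ContinuousAt G x)
    (hx : x ∈ interior Θ ∩ Metric.ball (y₀ : E d) h)
    (hp : p ∈ interior Θ ∩ Metric.ball (y₀ : E d) h)
    (hp1 : p - s • (x - p) ∈ interior Θ ∩ Metric.ball (y₀ : E d) h)
    (hp2 : p + s • (x - p) ∈ interior Θ ∩ Metric.ball (y₀ : E d) h) :
    G x = extrap s (G (p - s • (x - p))) (G p) (G (p + s • (x - p))) := by
  classical
  by_contra hne
  have hO : IsOpen (interior Θ ∩ Metric.ball (y₀ : E d) h) := isOpen_interior.inter Metric.isOpen_ball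
  obtain ⟨θ, hθ, H⟩ := exists_interpolant_gt hd hxp hs hO ⟨p, hp⟩ hGx hne (hO.mem_nhds hx)
  obtain ⟨Y, hYc, hY, ⟨P, hP, hPG, hPM⟩, huniq⟩ := H M
  have hYΘ : ∀ y ∈ Y, y ∈ interior Θ ∩ Metric.ball (y₀ : E d) h := fun y hy => by
    rcases hY y hy with (rfl | rfl | rfl | h') | h' <;> assumption
  set Y' : Finset Θ := Y.subtype (· ∈ Θ) with hY'
  have hc : Y'.card = numNodes d := by
    rw [hY', Finset.card_subtype, Finset.filter_true_of_mem fun y hy =>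
      interior_subset (hYΘ y hy).1, hYc]
  have hmem : ∀ y : Θ, y ∈ Y' ↔ (y : E d) ∈ Y := fun y => Finset.mem_subtype
  have hint : Interpolates Y' A.exact P := ⟨hP, fun y hy => by
    rw [hPG y ((hmem y).1 hy), hG]⟩
  have hex : ∃! P : E d → ℝ, Interpolates Y' A.exact P := by
    refine ⟨P, hint, fun Q hQ => ?_⟩
    have h0 := huniq (Q + (-1 : ℝ) • P) (hQ.1.add (hP.smul _)) fun y hy => by
      have hyΘ := interior_subset (hYΘ y hy).1
      have := hQ.2 ⟨y, hyΘ⟩ ((hmem _).2 hy)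
      simp only [Pi.add_apply, Pi.smul_apply, smul_eq_mul]
      rw [hPG y hy, this, hG]
      ring
    funext z
    have := congrFun h0 z
    simp only [Pi.add_apply, Pi.smul_apply, smul_eq_mul, Pi.zero_apply] at this
    linarith
  have := hM Y' hc (fun y hy => (hYΘ y ((hmem y).1 hy)).2) ⟨θ, interior_subset hθ.1⟩ hθ.2
  rw [fit_of_existsUnique hex hint] at this
  exact absurd hPM (not_lt.2 this)

/-- In dimension at least two, the convergence assumptions force the log-posterior to be locally a
quadratic polynomial. -/
theorem exists_locally_quadratic [CompactSpace Θ] (hd : 2 ≤ d) (hA : A.Standing)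
    (hC : A.Convergence) : ∃ h > 0, ∀ y₀ : Θ, ∃ P : E d → ℝ, IsQuadratic P ∧
      ∀ x : Θ, dist x y₀ < h → A.exact x = P x := by
  have hS := hC.sufficient
  obtain ⟨h₀, hh₀, hb⟩ := exists_fit_bound (by omega) hA hC
  obtain ⟨G, U, hU, hΘU, hGU, hG⟩ := exact_smooth hA hS
  refine ⟨h₀ / 2, by positivity, fun y₀ => ?_⟩
  obtain ⟨M, hM⟩ := hb (h₀ / 2) (by positivity) (by linarith) y₀
  set O := interior Θ ∩ Metric.ball (y₀ : E d) (h₀ / 2) with hOdef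
  have hO : IsOpen O := isOpen_interior.inter Metric.isOpen_ball
  -- Since y₀ may be a boundary point, the expansion is made at a nearby interior point p.
  obtain ⟨p, hpb, hpi⟩ := mem_closure_iff.1 (show (y₀ : E d) ∈ closure (interior Θ) by
    rw [hS.regular]; exact y₀.2) _ Metric.isOpen_ball (Metric.mem_ball_self (half_pos hh₀))
  have hp : p ∈ O := ⟨hpi, hpb⟩
  have hGat : ∀ x ∈ O, ContDiffAt ℝ 2 G x := fun x hx =>
    (hGU.contDiffAt (hU.mem_nhds (hΘU (interior_subset hx.1)))).of_le
      (WithTop.coe_le_coe.2 (le_top : (2 : ℕ∞) ≤ ⊤))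
  set L := fderiv ℝ G p
  set B := fderiv ℝ (fderiv ℝ G) p
  -- For fixed x the extrapolation identity holds at every small step s ≠ 0; letting s tend to 0
  -- turns it into the second-order Taylor formula at p without remainder.
  have key : ∀ x ∈ O, G x = G p + L (x - p) + B (x - p) (x - p) / 2 := by
    intro x hx
    rcases eq_or_ne x p with rfl | hxp
    · simp
    set u := x - p with hu
    have hline : Continuous fun s : ℝ => p + s • u := by fun_prop
    have hline' : Continuous fun s : ℝ => p - s • u := by fun_prop
    have e1 : ∀ᶠ s : ℝ in 𝓝 0, p + s • u ∈ O :=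
      hline.continuousAt.eventually_mem (hO.mem_nhds (by simpa using hp))
    have e2 : ∀ᶠ s : ℝ in 𝓝 0, p - s • u ∈ O :=
      hline'.continuousAt.eventually_mem (hO.mem_nhds (by simpa using hp))
    have hder : ∀ s : ℝ, HasDerivAt (fun s : ℝ => p + s • u) u s := fun s => by
      have := ((hasDerivAt_id s).smul_const u).const_add p
      simpa using this
    have hd1 : ∀ᶠ s : ℝ in 𝓝 0, HasDerivAt (fun s : ℝ => G (p + s • u))
        (fderiv ℝ G (p + s • u) u) s := by
      filter_upwards [e1] with s hs
      exact (((hGat _ hs).differentiableAt (by norm_num)).hasFDerivAt).comp_hasDerivAt s (hder s)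
    have hd2 : HasDerivAt (fun s : ℝ => fderiv ℝ G (p + s • u) u) (B u u) 0 := by
      have h2 : DifferentiableAt ℝ (fderiv ℝ G) p :=
        ((hGat p hp).fderiv_right (m := 1) (by norm_num)).differentiableAt (by norm_num)
      have h3 : HasFDerivAt (fderiv ℝ G) B (p + (0 : ℝ) • u) := by
        simpa using h2.hasFDerivAt
      have h4 := h3.comp_hasDerivAt (0 : ℝ) (hder 0)
      exact h4.clm_apply (hasDerivAt_const 0 u) |>.congr_deriv (by simp)
    have := sub_eq_of_extrap_eventually (K := G x) hd1 hd2 (by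
      filter_upwards [e1, e2] with s hs1 hs2 hs0
      have := extrap_eq_of_bound hd hG hM hxp hs0 (hGat x hx).continuousAt hx hp hs2 hs1
      rw [← hu] at this
      simpa only [neg_smul, ← sub_eq_add_neg, zero_smul, add_zero] using this)
    simpa using this
  refine ⟨_, isQuadratic_taylor (G p) L B p, fun x hx => ?_⟩
  by_contra hne
  -- The set of disagreement is relatively open in Θ. If nonempty it would contain an interior point
  -- of Θ, because Θ is the closure of its interior.
  have hW : IsOpen {x : Θ | dist x y₀ < h₀ / 2 ∧
      A.exact x ≠ G p + L ((x : E d) - p) + B ((x : E d) - p) ((x : E d) - p) / 2} := by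
    refine (isOpen_lt (f := fun x : Θ => dist x y₀) (by fun_prop) continuous_const).inter
      (isOpen_ne_fun (exact_continuous hA hS) ?_)
    exact (isQuadratic_taylor (G p) L B p).continuous.comp continuous_subtype_val
  obtain ⟨V, hV, ⟨v, hv⟩, hVs⟩ := exists_interior_mem_of_isOpen hS.regular hW ⟨x, hx, hne⟩
  obtain ⟨w, ⟨hw1, hw2⟩, rfl⟩ := hVs hv
  refine hw2 ((hG w).trans (key w ⟨?_, hw1⟩))
  refine mem_interior.2 ⟨V, fun z hz => ?_, hV, hv⟩
  obtain ⟨z', -, rfl⟩ := hVs hz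
  exact z'.2

/-- A fallback fit equals the log-posterior at a nearby node, so uniform continuity handles it. Only
unique interpolants on nearby nodes need an argument. -/
theorem approx_close_of_fit [CompactSpace Θ] (hd : 1 ≤ d) (hA : A.Standing) (hS : A.Sufficient)
    {s : ℝ} (hs : 0 < s) (hfit : ∃ R > 0, ∀ (y : Θ) (Y : Finset Θ), (∀ t ∈ Y, dist t y < R) →
      ∀ P : E d → ℝ, Interpolates Y A.exact P → (∃! P : E d → ℝ, Interpolates Y A.exact P) →
        |P y - A.exact y| ≤ s) :
    ∃ ε > 0, ∀ S : Finset Θ, IsCover ε S → ∀ y : Θ, |A.approx S y y - A.exact y| ≤ s := by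
  obtain ⟨R, hR, hfit⟩ := hfit
  have huc := CompactSpace.uniformContinuous_of_continuous (exact_continuous hA hS)
  obtain ⟨δ, hδ, hδs⟩ := Metric.uniformContinuous_iff.1 huc s hs
  obtain ⟨ε, hε, hn⟩ := IsCover.nodes_near hd hS.regular (lt_min hR hδ)
  refine ⟨ε, hε, fun S hSc y => ?_⟩
  obtain ⟨hne, hnear⟩ := hn S hSc y
  by_cases h : ∃! P : E d → ℝ, Interpolates (nodes S y) A.exact P
  · obtain ⟨P, hP⟩ := h.exists
    rw [approx, fit_of_existsUnique h hP]
    exact hfit y _ (fun t ht => (hnear t ht).trans_le (min_le_left _ _)) P hP h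
  · obtain ⟨t, ht, he⟩ := fit_fallback (θ := y) hne h
    rw [approx, he]
    have := hδs ((hnear t ht).trans_le (min_le_right _ _))
    rw [Real.dist_eq] at this
    exact this.le

/-- When the nodes lie where the log-posterior is a quadratic polynomial, uniqueness makes the
interpolant equal to that polynomial. -/
theorem approx_close_of_two_le [CompactSpace Θ] (hd : 2 ≤ d) (hA : A.Standing) (hC : A.Convergence)
    {s : ℝ} (hs : 0 < s) :
    ∃ ε > 0, ∀ S : Finset Θ, IsCover ε S → ∀ y : Θ, |A.approx S y y - A.exact y| ≤ s := by
  refine approx_close_of_fit (by omega) hA hC.sufficient hs ?_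
  obtain ⟨h, hh, hq⟩ := exists_locally_quadratic hd hA hC
  refine ⟨h, hh, fun y Y hY P hP hex => ?_⟩
  obtain ⟨Q, hQ, hQe⟩ := hq y
  have : P = Q := hex.unique hP ⟨hQ, fun t ht => (hQe t (hY t ht)).symm⟩
  rw [this, hQe y (by simpa using hh), sub_self, abs_zero]
  exact hs.le

end Setup

end LAMCMC

/-! ### Accuracy of the local models in dimension one -/

namespace LAMCMC

variable {d m n : ℕ} {Θ : Set (E d)}

/-- Rolle's theorem, used twice, gives a zero of φ''. Bounding only the oscillation of φ'' therefore
suffices, and the unknown leading coefficient of an interpolant drops out. Two mean value estimates,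
from a zero of φ' and from a zero of φ, give the bound. -/
theorem abs_le_of_three_zeros {φ φ' φ'' : ℝ → ℝ} {l r M : ℝ}
    (h1 : ∀ t ∈ Set.Ioo l r, HasDerivAt φ (φ' t) t)
    (h2 : ∀ t ∈ Set.Ioo l r, HasDerivAt φ' (φ'' t) t)
    (hM : ∀ t ∈ Set.Ioo l r, ∀ u ∈ Set.Ioo l r, |φ'' t - φ'' u| ≤ M) {a b c y : ℝ}
    (ha : a ∈ Set.Ioo l r) (hb : b ∈ Set.Ioo l r) (hc : c ∈ Set.Ioo l r) (hy : y ∈ Set.Ioo l r)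
    (hab : a < b) (hbc : b < c) (h0a : φ a = 0) (h0b : φ b = 0) (h0c : φ c = 0) :
    |φ y| ≤ M * (r - l) ^ 2 := by
  have hord := Set.ordConnected_Ioo (a := l) (b := r)
  have hroll : ∀ {f f' : ℝ → ℝ} {u v : ℝ}, (∀ t ∈ Set.Ioo l r, HasDerivAt f (f' t) t) →
      u ∈ Set.Ioo l r → v ∈ Set.Ioo l r → u < v → f u = f v → ∃ t ∈ Set.Ioo u v, f' t = 0 := by
    intro f f' u v hf hu hv huv he
    have hsub : Set.Icc u v ⊆ Set.Ioo l r := hord.out hu hv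
    exact exists_hasDerivAt_eq_zero huv
      (fun t ht => (hf t (hsub ht)).continuousAt.continuousWithinAt) he
      fun t ht => hf t (hsub (Set.Ioo_subset_Icc_self ht))
  obtain ⟨ξ, hξ, hξ0⟩ := hroll h1 ha hb hab (h0a.trans h0b.symm)
  obtain ⟨ζ, hζ, hζ0⟩ := hroll h1 hb hc hbc (h0b.trans h0c.symm)
  have hξI : ξ ∈ Set.Ioo l r := hord.out ha hb (Set.Ioo_subset_Icc_self hξ)
  have hζI : ζ ∈ Set.Ioo l r := hord.out hb hc (Set.Ioo_subset_Icc_self hζ)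
  obtain ⟨η, hη, hη0⟩ := hroll h2 hξI hζI (hξ.2.trans hζ.1) (hξ0.trans hζ0.symm)
  have hηI : η ∈ Set.Ioo l r := hord.out hξI hζI (Set.Ioo_subset_Icc_self hη)
  have hM0 : 0 ≤ M := (abs_nonneg _).trans (hM a ha a ha)
  have hlen : ∀ u ∈ Set.Ioo l r, ∀ v ∈ Set.Ioo l r, |u - v| ≤ r - l := fun u hu v hv => by
    rw [abs_le]
    constructor <;> linarith [hu.1, hu.2, hv.1, hv.2]
  have hrl : 0 ≤ r - l := by linarith [ha.1, ha.2]
  have hb2 : ∀ t ∈ Set.Ioo l r, ‖φ'' t‖ ≤ M := fun t ht => by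
    have := hM t ht η hηI
    rwa [hη0, sub_zero] at this
  have hb1 : ∀ t ∈ Set.Ioo l r, ‖φ' t‖ ≤ M * (r - l) := fun t ht => by
    have := (convex_Ioo l r).norm_image_sub_le_of_norm_hasDerivWithin_le
      (fun x hx => (h2 x hx).hasDerivWithinAt) hb2 hξI ht
    rw [hξ0, sub_zero] at this
    exact this.trans (mul_le_mul_of_nonneg_left (hlen t ht ξ hξI) hM0)
  have := (convex_Ioo l r).norm_image_sub_le_of_norm_hasDerivWithin_le
      (fun x hx => (h1 x hx).hasDerivWithinAt) hb1 ha hy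
  rw [h0a, sub_zero] at this
  refine this.trans ((mul_le_mul_of_nonneg_left (hlen y hy a ha) (by positivity)).trans_eq (by ring))

/-- Uniqueness makes evaluation at Y injective on the space of quadratics. -/
theorem numNodes_le_card {g : Θ → ℝ} {Y : Finset Θ}
    (h : ∃! P : E d → ℝ, Interpolates Y g P) : numNodes d ≤ Y.card := by
  obtain ⟨P, hP, huniq⟩ := h
  let L : quadSpace d →ₗ[ℝ] (Y → ℝ) :=
    (LinearMap.pi fun y : Y => LinearMap.proj (R := ℝ) (φ := fun _ : E d => ℝ) (y.1 : E d)).comp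
      (quadSpace d).subtype
  have hL : Function.Injective L := by
    rw [← LinearMap.ker_eq_bot, LinearMap.ker_eq_bot']
    intro Q hQ
    have hQ0 : ∀ y ∈ Y, Q.1 (y : E d) = 0 := fun y hy => congrFun hQ ⟨y, hy⟩
    have := huniq (P + Q.1) ⟨hP.1.add (mem_quadSpace.1 Q.2), fun y hy => by
      rw [Pi.add_apply, hQ0 y hy, add_zero, hP.2 y hy]⟩
    exact Subtype.ext (by simpa using this)
  have := LinearMap.finrank_le_finrank_of_injective hL
  rwa [finrank_quadSpace, Module.finrank_fintype_fun_eq_card, Fintype.card_coe] at this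

theorem exists_lt_lt_of_two_lt_card {T : Finset ℝ} (h : 2 < T.card) :
    ∃ a ∈ T, ∃ b ∈ T, ∃ c ∈ T, a < b ∧ b < c := by
  classical
  have hne : T.Nonempty := Finset.card_pos.1 (by omega)
  have : ∃ b ∈ T, b ∉ ({T.min' hne, T.max' hne} : Finset ℝ) := by
    by_contra! hcon
    have := Finset.card_le_card (show T ⊆ {T.min' hne, T.max' hne} from hcon)
    have := Finset.card_le_two (a := T.min' hne) (b := T.max' hne)
    omega
  obtain ⟨b, hb, hbn⟩ := this
  simp only [Finset.mem_insert, Finset.mem_singleton, not_or] at hbn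
  exact ⟨_, T.min'_mem hne, b, hb, _, T.max'_mem hne,
    lt_of_le_of_ne (T.min'_le b hb) (Ne.symm hbn.1), lt_of_le_of_ne (T.le_max' b hb) hbn.2⟩

theorem single_coord (x : E 1) : EuclideanSpace.single 0 (x 0) = x := by
  ext i
  obtain rfl := Subsingleton.elim i 0
  simp

namespace Setup

/-- A unique interpolant uses at least three distinct nodes, and the error of the fit has a zero at
each. It is then at most the oscillation of the second derivative times the square of the length of
the interval, however the nodes are placed. -/
theorem approx_close_of_eq_one {Θ : Set (E 1)} {A : Setup 1 m n Θ} [CompactSpace Θ]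
    (hA : A.Standing) (hS : A.Sufficient) {s : ℝ} (hs : 0 < s) :
    ∃ ε > 0, ∀ S : Finset Θ, IsCover ε S → ∀ y : Θ, |A.approx S y y - A.exact y| ≤ s := by
  classical
  refine approx_close_of_fit le_rfl hA hS hs ?_
  obtain ⟨G, U, hU, hΘU, hGU, hG⟩ := exact_smooth hA hS
  have hιeq : ∀ t : ℝ, EuclideanSpace.single (0 : Fin 1) t =
      (0 : E 1) + t • EuclideanSpace.single (0 : Fin 1) (1 : ℝ) := fun t => by
    ext i
    obtain rfl := Subsingleton.elim i 0
    simp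
  set ι : ℝ → E 1 := fun t => EuclideanSpace.single 0 t with hι
  have hιs : ContDiff ℝ ((⊤ : ℕ∞) : WithTop ℕ∞) ι := by
    rw [hι, funext hιeq]
    fun_prop
  set γ : ℝ → ℝ := G ∘ ι with hγ
  have hU' : IsOpen (ι ⁻¹' U) := hU.preimage hιs.continuous
  have hγs : ContDiffOn ℝ ((⊤ : ℕ∞) : WithTop ℕ∞) γ (ι ⁻¹' U) :=
    hGU.comp hιs.contDiffOn (Set.mapsTo_preimage _ _)
  have h2 : ContDiffOn ℝ 2 γ (ι ⁻¹' U) := hγs.of_le (WithTop.coe_le_coe.2 (le_top : (2 : ℕ∞) ≤ ⊤))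
  have h1' : ContDiffOn ℝ 1 (deriv γ) (ι ⁻¹' U) := h2.deriv_of_isOpen hU' (by norm_num)
  have h0'' : ContinuousOn (deriv (deriv γ)) (ι ⁻¹' U) :=
    h1'.continuousOn_deriv_of_isOpen hU' (by norm_num)
  set K : Set ℝ := (fun x : E 1 => x 0) '' Θ with hK
  have hKc : IsCompact K := hS.compact.image (by fun_prop)
  have hKU : K ⊆ ι ⁻¹' U := by
    rintro _ ⟨x, hx, rfl⟩
    change EuclideanSpace.single 0 (x 0) ∈ U
    rw [single_coord]
    exact hΘU hx
  obtain ⟨R₀, hR₀, hthick⟩ := hKc.exists_cthickening_subset_open hU' hKU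
  obtain ⟨M, hM⟩ := (hKc.cthickening (r := R₀)).exists_bound_of_continuousOn (h0''.mono hthick)
  have hM1 : 0 < 8 * |M| + 1 := by positivity
  -- The oscillation is at most 2|M| on an interval of length 2R, which gives the error 8|M|R² ≤ s
  -- when R ≤ 1.
  refine ⟨min (min R₀ 1) (s / (8 * |M| + 1)), by positivity, fun y Y hY P hP hex => ?_⟩
  set R := min (min R₀ 1) (s / (8 * |M| + 1)) with hR
  have hRpos : 0 < R := by positivity
  have hR0 : R ≤ R₀ := (min_le_left _ _).trans (min_le_left _ _)
  have hR1 : R ≤ 1 := (min_le_left _ _).trans (min_le_right _ _)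
  have hRs : R * (8 * |M| + 1) ≤ s := by
    rw [← le_div_iff₀ hM1]; exact min_le_right _ _
  set ty : ℝ := (y : E 1) 0 with hty
  have hI : Set.Ioo (ty - R) (ty + R) ⊆ Metric.cthickening R₀ K := fun t ht => by
    refine Metric.mem_cthickening_of_dist_le t ty R₀ K ⟨y, y.2, rfl⟩ ?_
    rw [Real.dist_eq, abs_le]
    constructor <;> linarith [ht.1, ht.2]
  obtain ⟨a, b, c, hline⟩ := hP.1.line 0 (EuclideanSpace.single (0 : Fin 1) (1 : ℝ))
  have hPι : ∀ t, P (ι t) = a + b * t + c * t ^ 2 := fun t => by rw [← hline, ← hιeq]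
  have hd1 : ∀ t ∈ Set.Ioo (ty - R) (ty + R),
      HasDerivAt (fun t => γ t - (a + b * t + c * t ^ 2)) (deriv γ t - (b + 2 * c * t)) t := by
    intro t ht
    have e1 := ((h2.contDiffAt (hU'.mem_nhds (hthick (hI ht)))).differentiableAt
      (by norm_num)).hasDerivAt
    have e2 := (((hasDerivAt_id t).const_mul b).const_add a).add
      (((hasDerivAt_id t).pow 2).const_mul c)
    have e3 : HasDerivAt (fun t => γ t - (a + b * t + c * t ^ 2)) _ t := e1.sub e2
    refine e3.congr_deriv ?_
    simp
    ring
  have hd2 : ∀ t ∈ Set.Ioo (ty - R) (ty + R),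
      HasDerivAt (fun t => deriv γ t - (b + 2 * c * t)) (deriv (deriv γ) t - 2 * c) t := by
    intro t ht
    have e1 := ((h1'.contDiffAt (hU'.mem_nhds (hthick (hI ht)))).differentiableAt
      (by norm_num)).hasDerivAt
    have e2 := ((hasDerivAt_id t).const_mul (2 * c)).const_add b
    have e3 : HasDerivAt (fun t => deriv γ t - (b + 2 * c * t)) _ t := e1.sub e2
    refine e3.congr_deriv ?_
    simp
  have hosc : ∀ t ∈ Set.Ioo (ty - R) (ty + R), ∀ u ∈ Set.Ioo (ty - R) (ty + R),
      |(deriv (deriv γ) t - 2 * c) - (deriv (deriv γ) u - 2 * c)| ≤ 2 * |M| := by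
    intro t ht u hu
    have e1 := hM t (hI ht)
    have e2 := hM u (hI hu)
    rw [Real.norm_eq_abs] at e1 e2
    have e3 := abs_sub (deriv (deriv γ) t) (deriv (deriv γ) u)
    have e4 := le_abs_self M
    rw [sub_sub_sub_cancel_right]
    linarith
  have hcoord : ∀ x : Θ, ι ((x : E 1) 0) = x := fun x => single_coord _
  set T : Finset ℝ := Y.image fun t : Θ => (t : E 1) 0 with hT
  have hTc : 2 < T.card := by
    rw [hT, Finset.card_image_of_injective _ fun x y hxy => Subtype.ext (by
      rw [← hcoord x, ← hcoord y]; exact congrArg ι hxy)]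
    have := numNodes_le_card hex
    have h3 : numNodes 1 = 3 := rfl
    omega
  have hTI : ∀ t ∈ T, t ∈ Set.Ioo (ty - R) (ty + R) ∧ γ t - (a + b * t + c * t ^ 2) = 0 := by
    intro t ht
    obtain ⟨x, hx, rfl⟩ := Finset.mem_image.1 ht
    constructor
    · have h3 := hY x hx
      rw [Subtype.dist_eq, EuclideanSpace.dist_eq] at h3
      simp only [Fin.sum_univ_one, Fin.isValue, Real.dist_eq, sq_abs, Real.sqrt_sq_eq_abs] at h3
      rw [abs_lt] at h3
      constructor <;> linarith [h3.1, h3.2]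
    · rw [← hPι, hγ, Function.comp_apply, hcoord, hP.2 x hx, hG, sub_self]
  obtain ⟨t₁, ht₁, t₂, ht₂, t₃, ht₃, h12, h23⟩ := exists_lt_lt_of_two_lt_card hTc
  have hyI : ty ∈ Set.Ioo (ty - R) (ty + R) := ⟨by linarith, by linarith⟩
  have key := abs_le_of_three_zeros hd1 hd2 hosc (hTI _ ht₁).1 (hTI _ ht₂).1 (hTI _ ht₃).1 hyI
    h12 h23 (hTI _ ht₁).2 (hTI _ ht₂).2 (hTI _ ht₃).2
  rw [← hPι, hγ, Function.comp_apply, hcoord, ← hG, abs_sub_comm] at key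
  refine key.trans ?_
  have : ty + R - (ty - R) = 2 * R := by ring
  rw [this]
  nlinarith [abs_nonneg M, mul_nonneg (abs_nonneg M) hRpos.le]

theorem approx_close {A : Setup d m n Θ} [CompactSpace Θ] (hd : 1 ≤ d) (hA : A.Standing)
    (hC : A.Convergence) {s : ℝ} (hs : 0 < s) :
    ∃ ε > 0, ∀ S : Finset Θ, IsCover ε S → ∀ y : Θ, |A.approx S y y - A.exact y| ≤ s := by
  rcases Nat.lt_or_ge 1 d with h | h
  · exact approx_close_of_two_le h hA hC hs
  · obtain rfl : d = 1 := le_antisymm h hd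
    exact approx_close_of_eq_one hA hC.sufficient hs

end Setup

end LAMCMC

/-! ### Couplings along a partition of unity and Wasserstein convergence -/

namespace LAMCMC

section Coupling

variable {X ι : Type*}

theorem sum_smul_withDensity [MeasurableSpace X] {s : Finset ι} {φ : ι → X → ℝ≥0∞}
    (hφ : ∀ i ∈ s, Measurable (φ i)) (hsum : ∀ x, ∑ i ∈ s, φ i x = 1) (μ : Measure X) :
    ∑ i ∈ s, μ.withDensity (φ i) = μ := by
  ext t ht
  rw [Measure.finsetSum_apply]
  simp only [withDensity_apply _ ht]
  rw [← lintegral_finsetSum _ hφ]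
  simp [hsum]

theorem lintegral_edist_prod_le [PseudoMetricSpace X] [MeasurableSpace X] [BorelSpace X]
    [SecondCountableTopology X] {μ ν : Measure X} [SFinite μ] [SFinite ν] {φ : X → ℝ≥0∞}
    (hφ : Measurable φ) {ρ : ℝ≥0∞} (hρ : ∀ x y, φ x ≠ 0 → φ y ≠ 0 → edist x y ≤ ρ) :
    ∫⁻ p, edist p.1 p.2 ∂((μ.withDensity φ).prod (ν.withDensity φ)) ≤
      ρ * ((∫⁻ x, φ x ∂μ) * ∫⁻ x, φ x ∂ν) := by
  have h2 : Measurable fun z : X × X => φ z.1 * φ z.2 := by fun_prop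
  rw [prod_withDensity hφ hφ, lintegral_withDensity_eq_lintegral_mul _ h2 measurable_edist,
    ← lintegral_prod_mul hφ.aemeasurable hφ.aemeasurable, ← lintegral_const_mul _ h2]
  refine lintegral_mono fun z => ?_
  simp only [Pi.mul_apply]
  rw [mul_comm ρ]
  rcases eq_or_ne (φ z.1) 0 with h | h
  · simp [h]
  rcases eq_or_ne (φ z.2) 0 with h' | h'
  · simp [h']
  · gcongr
    exact hρ _ _ h h'

/-- In cell i a multiple of the product of the localized measures transports the common mass min (a
i) (b i) at cost at most ρ per unit. The rest, of mass ∑ (a i - b i) with truncated subtraction, is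
coupled independently at cost at most D per unit. -/
theorem wasserstein_le_of_partition [PseudoMetricSpace X] [MeasurableSpace X] [BorelSpace X]
    [SecondCountableTopology X] (μ ν : Measure X) [IsProbabilityMeasure μ]
    [IsProbabilityMeasure ν] {s : Finset ι} {φ : ι → X → ℝ≥0∞}
    (hφ : ∀ i ∈ s, Measurable (φ i)) (hsum : ∀ x, ∑ i ∈ s, φ i x = 1) {ρ D : ℝ≥0∞}
    (hρ : ∀ i ∈ s, ∀ x y, φ i x ≠ 0 → φ i y ≠ 0 → edist x y ≤ ρ)
    (hD : ∀ x y : X, edist x y ≤ D) :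
    wasserstein μ ν ≤ ρ + D * ∑ i ∈ s, (∫⁻ x, φ i x ∂μ - ∫⁻ x, φ i x ∂ν) := by
  set a : ι → ℝ≥0∞ := fun i => ∫⁻ x, φ i x ∂μ with ha
  set b : ι → ℝ≥0∞ := fun i => ∫⁻ x, φ i x ∂ν with hb
  set μi : ι → Measure X := fun i => μ.withDensity (φ i) with hμi
  set νi : ι → Measure X := fun i => ν.withDensity (φ i) with hνi
  have hμu : ∀ i, μi i Set.univ = a i := fun i => by simp [hμi, ha]
  have hνu : ∀ i, νi i Set.univ = b i := fun i => by simp [hνi, hb]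
  have hasum : ∑ i ∈ s, a i = 1 := by
    rw [ha, ← lintegral_finsetSum _ hφ]; simp [hsum]
  have hbsum : ∑ i ∈ s, b i = 1 := by
    rw [hb, ← lintegral_finsetSum _ hφ]; simp [hsum]
  have hal : ∀ i ∈ s, a i ≠ ⊤ := fun i hi => ne_top_of_le_ne_top ENNReal.one_ne_top
    (hasum ▸ Finset.single_le_sum (fun _ _ => zero_le) hi)
  have hbl : ∀ i ∈ s, b i ≠ ⊤ := fun i hi => ne_top_of_le_ne_top ENNReal.one_ne_top
    (hbsum ▸ Finset.single_le_sum (fun _ _ => zero_le) hi)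
  -- This factor turns the product mass a i * b i into the minimum of the two. If both masses vanish
  -- it is ∞, but then it only multiplies zero masses.
  set c : ι → ℝ≥0∞ := fun i => (max (a i) (b i))⁻¹ with hc
  have hmn : ∀ i ∈ s, c i * b i * a i = min (a i) (b i) := by
    intro i hi
    have e : c i * b i * a i = (max (a i) (b i))⁻¹ * max (a i) (b i) * min (a i) (b i) := by
      rw [mul_assoc, mul_assoc, max_mul_min, mul_comm (b i)]
    rw [e]
    rcases eq_or_ne (max (a i) (b i)) 0 with h | h
    · have h1 : a i = 0 := le_antisymm (h ▸ le_max_left _ _) (zero_le)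
      simp [h1]
    · rw [ENNReal.inv_mul_cancel h (by simp [hal i hi, hbl i hi, max_eq_top]), one_mul]
  have hca : ∀ i, c i * a i ≤ 1 := fun i => by
    rw [hc, mul_comm, ← ENNReal.div_eq_inv_mul.trans (mul_comm _ _)]
    exact ENNReal.div_le_of_le_mul (by simp)
  have hcb : ∀ i, c i * b i ≤ 1 := fun i => by
    rw [hc, mul_comm, ← ENNReal.div_eq_inv_mul.trans (mul_comm _ _)]
    exact ENNReal.div_le_of_le_mul (by simp)
  set μ' : Measure X := ∑ i ∈ s, (1 - c i * b i) • μi i with hμ'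
  set ν' : Measure X := ∑ i ∈ s, (1 - c i * a i) • νi i with hν'
  set M : ℝ≥0∞ := ∑ i ∈ s, (a i - b i) with hM
  have hμ'u : μ' Set.univ = M := by
    rw [hμ', Measure.finsetSum_apply]
    refine Finset.sum_congr rfl fun i hi => ?_
    rw [Measure.smul_apply, hμu, smul_eq_mul, ENNReal.sub_mul fun _ _ => hal i hi, one_mul,
      hmn i hi, tsub_min]
  have hν'u0 : ν' Set.univ = ∑ i ∈ s, (b i - a i) := by
    rw [hν', Measure.finsetSum_apply]
    refine Finset.sum_congr rfl fun i hi => ?_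
    rw [Measure.smul_apply, hνu, smul_eq_mul, ENNReal.sub_mul fun _ _ => hbl i hi, one_mul,
      mul_right_comm, hmn i hi, min_comm, tsub_min]
  have hν'u : ν' Set.univ = M := by
    rw [hν'u0]
    have e : M + 1 = ∑ i ∈ s, (b i - a i) + 1 := by
      calc M + 1 = ∑ i ∈ s, (a i - b i + b i) := by rw [Finset.sum_add_distrib, hbsum]
        _ = ∑ i ∈ s, (b i - a i + a i) := by
          refine Finset.sum_congr rfl fun i _ => ?_
          rw [tsub_add_eq_max, tsub_add_eq_max, max_comm]
        _ = _ := by rw [Finset.sum_add_distrib, hasum]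
    exact ((ENNReal.add_left_inj ENNReal.one_ne_top).1 e).symm
  have hM1 : M ≤ 1 := hasum ▸ Finset.sum_le_sum fun i _ => tsub_le_self
  have hMt : M ≠ ⊤ := ne_top_of_le_ne_top ENNReal.one_ne_top hM1
  have : IsFiniteMeasure μ' := ⟨by rw [hμ'u]; exact hMt.lt_top⟩
  have : IsFiniteMeasure ν' := ⟨by rw [hν'u]; exact hMt.lt_top⟩
  -- For M = 0 the inverse is ∞, but the remainders are then zero measures.
  have hMs : ∀ η : Measure X, η Set.univ = M → (M⁻¹ * M) • η = η := by
    intro η hη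
    rcases eq_or_ne M 0 with h | h
    · rw [Measure.measure_univ_eq_zero.1 (hη.trans h), smul_zero]
    · rw [ENNReal.inv_mul_cancel h hMt, one_smul]
  have hfst : ∀ (p q : Measure X) [SFinite p] [SFinite q],
      (p.prod q).map Prod.fst = q Set.univ • p := fun p q _ _ => Measure.map_fst_prod
  have hsnd : ∀ (p q : Measure X) [SFinite p] [SFinite q],
      (p.prod q).map Prod.snd = p Set.univ • q := fun p q _ _ => Measure.map_snd_prod
  set κ : Measure (X × X) := ∑ i ∈ s, c i • (μi i).prod (νi i) + M⁻¹ • μ'.prod ν' with hκ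
  have hmapsum : ∀ (f : X × X → X), Measurable f →
      κ.map f = ∑ i ∈ s, c i • ((μi i).prod (νi i)).map f + M⁻¹ • (μ'.prod ν').map f := by
    intro f hf
    rw [hκ, Measure.map_add _ _ hf, Measure.map_smul]
    congr 1
    ext t ht
    rw [Measure.map_apply hf ht, Measure.finsetSum_apply, Measure.finsetSum_apply]
    refine Finset.sum_congr rfl fun i _ => ?_
    rw [Measure.smul_apply, Measure.smul_apply, Measure.map_apply hf ht]
  have hκ1 : κ.map Prod.fst = μ := by
    rw [hmapsum _ measurable_fst, hfst, hν'u, smul_smul, hMs _ hμ'u, hμ', ← Finset.sum_add_distrib]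
    conv_rhs => rw [← sum_smul_withDensity hφ hsum μ]
    refine Finset.sum_congr rfl fun i _ => ?_
    rw [hfst, hνu, smul_smul, ← add_smul, add_tsub_cancel_of_le (hcb i), one_smul]
  have hκ2 : κ.map Prod.snd = ν := by
    rw [hmapsum _ measurable_snd, hsnd, hμ'u, smul_smul, hMs _ hν'u, hν', ← Finset.sum_add_distrib]
    conv_rhs => rw [← sum_smul_withDensity hφ hsum ν]
    refine Finset.sum_congr rfl fun i _ => ?_
    rw [hsnd, hμu, smul_smul, ← add_smul, add_tsub_cancel_of_le (hca i), one_smul]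
  refine (iInf₂_le κ ⟨hκ1, hκ2⟩).trans ?_
  rw [hκ, lintegral_add_measure, lintegral_finsetSum_measure, lintegral_smul_measure]
  refine add_le_add ?_ ?_
  · calc ∑ i ∈ s, ∫⁻ p, edist p.1 p.2 ∂(c i • (μi i).prod (νi i))
        ≤ ∑ i ∈ s, ρ * a i := by
          refine Finset.sum_le_sum fun i hi => ?_
          rw [lintegral_smul_measure, smul_eq_mul]
          calc c i * ∫⁻ p, edist p.1 p.2 ∂(μi i).prod (νi i) ≤ c i * (ρ * (a i * b i)) := by
                gcongr
                exact lintegral_edist_prod_le (hφ i hi) (hρ i hi)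
            _ = ρ * (c i * b i * a i) := by ring
            _ ≤ ρ * a i := by rw [hmn i hi]; gcongr; exact min_le_left _ _
      _ = ρ := by rw [← Finset.mul_sum, hasum, mul_one]
  · calc M⁻¹ • ∫⁻ p, edist p.1 p.2 ∂(μ'.prod ν') ≤ M⁻¹ * ∫⁻ _, D ∂(μ'.prod ν') := by
          rw [smul_eq_mul]
          gcongr
          exact hD _ _
      _ = M⁻¹ * M * (D * M) := by
          rw [lintegral_const, ← Set.univ_prod_univ, Measure.prod_prod, hμ'u, hν'u]; ring
      _ ≤ 1 * (D * M) := by gcongr; exact ENNReal.inv_mul_le_one _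
      _ = D * M := one_mul _

/-- Tent functions of radius η around the centres of a finite cover, divided by their sum. -/
theorem exists_continuous_partition [MetricSpace X] [CompactSpace X] {η : ℝ} (hη : 0 < η) :
    ∃ (s : Finset X) (φ : X → C(X, ℝ)), (∀ i x, 0 ≤ φ i x) ∧ (∀ x, ∑ i ∈ s, φ i x = 1) ∧
      ∀ i x, φ i x ≠ 0 → dist x i < η := by
  obtain ⟨t, -, ht, hcov⟩ := finite_cover_balls_of_compact (X := X) isCompact_univ hη
  set h : X → X → ℝ := fun i x => max 0 (η - dist x i) with hh
  have hc : ∀ i, Continuous (h i) := fun i => by rw [hh]; fun_prop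
  have h0 : ∀ i x, 0 ≤ h i x := fun i x => le_max_left _ _
  have hH : ∀ x, 0 < ∑ i ∈ ht.toFinset, h i x := fun x => by
    have hx := hcov (Set.mem_univ x)
    simp only [Set.mem_iUnion] at hx
    obtain ⟨i, hi, hxi⟩ := hx
    exact Finset.sum_pos' (fun i _ => h0 i x)
      ⟨i, ht.mem_toFinset.2 hi, lt_max_of_lt_right (sub_pos.2 hxi)⟩
  refine ⟨ht.toFinset, fun i => ⟨fun x => h i x / ∑ j ∈ ht.toFinset, h j x, ?_⟩, fun i x => ?_,
    fun x => ?_, fun i x hx => ?_⟩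
  · exact (hc i).div (continuous_finsetSum _ fun j _ => hc j) fun x => (hH x).ne'
  · exact div_nonneg (h0 i x) (hH x).le
  · simp only [ContinuousMap.coe_mk]
    rw [← Finset.sum_div, div_self (hH x).ne']
  · by_contra hd
    refine hx ?_
    have : h i x = 0 := max_eq_left (by linarith)
    simp [this]

/-- For a fixed fine partition only finitely many integrals matter, and their truncated differences
tend to zero. -/
theorem tendsto_wasserstein [MetricSpace X] [CompactSpace X] [MeasurableSpace X] [BorelSpace X]
    {μ : ℕ → Measure X} {ν : Measure X} (hμ : ∀ t, IsProbabilityMeasure (μ t))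
    (hν : IsProbabilityMeasure ν)
    (h : ∀ f : C(X, ℝ), Tendsto (fun t => ∫ x, f x ∂(μ t)) atTop (𝓝 (∫ x, f x ∂ν))) :
    Tendsto (fun t => wasserstein (μ t) ν) atTop (𝓝 0) := by
  rw [ENNReal.tendsto_nhds_zero]
  intro ε hε
  obtain ⟨η, hη0, hηε⟩ := ENNReal.lt_iff_exists_real_btwn.1 hε
  obtain ⟨hηp, hηε⟩ := hηε
  have hη : 0 < η := by simpa using hηp
  obtain ⟨s, φ, hφ0, hφ1, hφd⟩ := exists_continuous_partition (X := X) (η := η / 4) (by positivity)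
  set D : ℝ≥0∞ := Metric.ediam (Set.univ : Set X) with hDdef
  have hDt : D ≠ ⊤ := (isCompact_univ.isBounded).ediam_ne_top
  have hli : ∀ (i : X) (m : Measure X), IsProbabilityMeasure m →
      ∫⁻ x, ENNReal.ofReal (φ i x) ∂m = ENNReal.ofReal (∫ x, φ i x ∂m) := fun i m _ =>
    (ofReal_integral_eq_lintegral_ofReal
      ((φ i).continuous.integrable_of_hasCompactSupport (HasCompactSupport.of_compactSpace _))
      (.of_forall (hφ0 i))).symm
  have hW : ∀ t, wasserstein (μ t) ν ≤ ENNReal.ofReal (η / 2) +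
      D * ∑ i ∈ s, (ENNReal.ofReal (∫ x, φ i x ∂(μ t)) - ENNReal.ofReal (∫ x, φ i x ∂ν)) := by
    intro t
    have := hμ t
    have key := wasserstein_le_of_partition (μ t) ν (s := s) (φ := fun i x => ENNReal.ofReal (φ i x))
      (ρ := ENNReal.ofReal (η / 2)) (D := D) (fun i _ => by fun_prop)
      (fun x => by
        rw [← ENNReal.ofReal_sum_of_nonneg fun i _ => hφ0 i x, hφ1, ENNReal.ofReal_one])
      (fun i _ x y hx hy => by
        have hx' := hφd i x fun e => hx (by rw [e, ENNReal.ofReal_zero])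
        have hy' := hφd i y fun e => hy (by rw [e, ENNReal.ofReal_zero])
        rw [edist_dist]
        refine ENNReal.ofReal_le_ofReal ((dist_triangle_right x y i).trans ?_)
        linarith)
      (fun x y => Metric.edist_le_ediam_of_mem (Set.mem_univ _) (Set.mem_univ _))
    simpa only [hli _ _ (hμ t), hli _ _ hν] using key
  have hlim : Tendsto (fun t => ENNReal.ofReal (η / 2) +
      D * ∑ i ∈ s, (ENNReal.ofReal (∫ x, φ i x ∂(μ t)) - ENNReal.ofReal (∫ x, φ i x ∂ν))) atTop
      (𝓝 (ENNReal.ofReal (η / 2) + D * ∑ i ∈ s, (ENNReal.ofReal (∫ x, φ i x ∂ν) -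
        ENNReal.ofReal (∫ x, φ i x ∂ν)))) := by
    refine tendsto_const_nhds.add (ENNReal.Tendsto.const_mul ?_ (Or.inr hDt))
    refine tendsto_finsetSum _ fun i _ => ?_
    exact ENNReal.Tendsto.sub (ENNReal.tendsto_ofReal (h (φ i))) tendsto_const_nhds
      (Or.inl ENNReal.ofReal_ne_top)
  simp only [tsub_self, Finset.sum_const_zero, mul_zero, add_zero] at hlim
  have hlt : ENNReal.ofReal (η / 2) < ε :=
    (ENNReal.ofReal_le_ofReal (by linarith)).trans_lt hηε
  filter_upwards [hlim.eventually_lt_const hlt] with t ht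
  exact (hW t).trans ht.le

end Coupling

end LAMCMC

namespace LAMCMC

/-! ### The refinement loop -/

instance (m : ℕ) : IsProbabilityMeasure (noiseLaw m) := by
  unfold noiseLaw
  infer_instance

theorem unif_Ici {a : ℝ} (h0 : 0 ≤ a) : unif {u | a ≤ u} = ENNReal.ofReal (1 - a) := by
  have hset : MeasurableSet {u : ℝ | a ≤ u} := measurableSet_Ici
  rw [unif, Measure.restrict_apply hset]
  have : {u : ℝ | a ≤ u} ∩ Set.Icc 0 1 = Set.Icc a 1 := by
    ext u
    simp only [Set.mem_inter_iff, Set.mem_ofPred_eq, Set.mem_Icc]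
    exact ⟨fun h => ⟨h.1, h.2.2⟩, fun h => ⟨h.1, h0.trans h.1, h.2⟩⟩
  rw [this, Real.volume_Icc]

theorem unif_prod_lt_lt {b c : ℝ} (h1 : b ≤ 1) (c1 : c ≤ 1) :
    (unif.prod unif) {p | p.1 < b ∧ p.2 < c} = ENNReal.ofReal b * ENNReal.ofReal c := by
  have : {p : ℝ × ℝ | p.1 < b ∧ p.2 < c} = {u | u < b} ×ˢ {u | u < c} := rfl
  rw [this, Measure.prod_prod, unif_lt h1, unif_lt c1]

theorem unif_prod_lt_le {b c : ℝ} (h1 : b ≤ 1) (c0 : 0 ≤ c) :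
    (unif.prod unif) {p | p.1 < b ∧ c ≤ p.2} = ENNReal.ofReal b * ENNReal.ofReal (1 - c) := by
  have : {p : ℝ × ℝ | p.1 < b ∧ c ≤ p.2} = {u | u < b} ×ˢ {u | c ≤ u} := rfl
  rw [this, Measure.prod_prod, unif_lt h1, unif_Ici c0]

/-- An event of positive probability happens infinitely often in independent trials. -/
theorem ae_frequently_mem {X : Type*} [MeasurableSpace X] (μ : Measure X) [IsProbabilityMeasure μ]
    {s : Set X} (hs : MeasurableSet s) (h0 : μ s ≠ 0) :
    ∀ᵐ v ∂(Measure.infinitePi fun _ : ℕ => μ), ∃ᶠ k in atTop, v k ∈ s := by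
  have hm : ∀ k : ℕ, MeasurableSet {v : ℕ → X | v k ∈ s} := fun k => measurable_pi_apply k hs
  have hμ : ∀ k : ℕ, (Measure.infinitePi fun _ : ℕ => μ) {v : ℕ → X | v k ∈ s} = μ s := fun k => by
    have := congrArg (fun ν => ν s) (Measure.infinitePi_map_eval (fun _ : ℕ => μ) k)
    rwa [Measure.map_apply (measurable_pi_apply k) hs] at this
  have hind : iIndepSet (fun k : ℕ => {v : ℕ → X | v k ∈ s})
      (Measure.infinitePi fun _ : ℕ => μ) := by
    rw [iIndepSet_iff_meas_biInter hm]
    intro t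
    have := (iIndepFun_infinitePi (P := fun _ : ℕ => μ) (X := fun _ x => x)
      fun _ => measurable_id)
    exact (iIndepFun_iff_measure_inter_preimage_eq_mul.1 this) t (sets := fun _ => s)
      fun _ _ => hs
  have key := measure_limsup_eq_one hm hind (by
    simp only [hμ]
    exact ENNReal.tsum_const_eq_top_of_ne_zero h0)
  rw [← prob_compl_eq_zero_iff (MeasurableSet.measurableSet_limsup hm)] at key
  filter_upwards [compl_mem_ae_iff.2 key] with v hv
  simp only [compl_compl] at hv
  rwa [mem_limsup_iff_frequently_mem] at hv

namespace Setup

variable {d m n : ℕ} {Θ : Set (E d)} {A : Setup d m n Θ}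

theorem subset_pass (t : ℕ) (θ : Θ) (z : E m) (S : Finset Θ) (w : ℝ × ℝ) :
    S ⊆ A.pass t θ z S w := by
  unfold pass
  dsimp only
  split_ifs
  exacts [Finset.subset_insert _ _, Finset.subset_insert _ _, Finset.subset_insert _ _,
    Finset.subset_insert _ _, Finset.Subset.refl _]

theorem passes_mono (t : ℕ) (θ : Θ) (z : E m) (S : Finset Θ) (w : ℕ → ℝ × ℝ) :
    Monotone (A.passes t θ z S w) :=
  monotone_nat_of_le_succ fun _ => subset_pass _ _ _ _ _

theorem subset_passes (t : ℕ) (θ : Θ) (z : E m) (S : Finset Θ) (w : ℕ → ℝ × ℝ) (k : ℕ) :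
    S ⊆ A.passes t θ z S w k :=
  passes_mono t θ z S w (Nat.zero_le k)

theorem mem_passes_one {t : ℕ} {θ : Θ} {z : E m} {S : Finset Θ} {w : ℕ → ℝ × ℝ}
    (h1 : (w 0).1 < A.β t) (h2 : (w 0).2 < 1 / 2) : A.rS S θ z ∈ A.passes t θ z S w 1 := by
  classical
  unfold passes pass
  dsimp only
  rw [if_pos h1, if_pos h2]
  exact Finset.mem_insert_self _ _

theorem pass_eq_insert {t : ℕ} {θ : Θ} {z : E m} {S : Finset Θ} {w : ℝ × ℝ}
    (h1 : w.1 < A.β t) (h2 : 1 / 2 ≤ w.2) : θ ∈ A.pass t θ z S w ∧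
      (θ ∈ S → A.pass t θ z S w = S) := by
  classical
  unfold pass
  dsimp only
  rw [if_pos h1, if_neg h2.not_gt]
  exact ⟨Finset.mem_insert_self _ _, fun h => Finset.insert_eq_of_mem h⟩

/-- Almost surely, random refinement at the current point θ occurs at least twice among the
independent draws. The second time θ already belongs to the set, so nothing is added and the loop
ends. -/
theorem ae_exists_passes_eq (hS : A.Sufficient) (t : ℕ) (θ : Θ) (z : E m) (S : Finset Θ) :
    ∀ᵐ v ∂(Measure.infinitePi fun _ : ℕ => unif.prod unif),
      ∃ k, A.passes t θ z S v (k + 1) = A.passes t θ z S v k := by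
  obtain ⟨b, hb0, hb1, hb⟩ := hS.β_const
  have hset : MeasurableSet {p : ℝ × ℝ | p.1 < b ∧ 1 / 2 ≤ p.2} :=
    (measurableSet_lt measurable_fst measurable_const).inter
      (measurableSet_le measurable_const measurable_snd)
  have hpos : (unif.prod unif) {p : ℝ × ℝ | p.1 < b ∧ 1 / 2 ≤ p.2} ≠ 0 := by
    rw [unif_prod_lt_le hb1 (by norm_num)]
    have h2 : (0 : ℝ) < 1 - 1 / 2 := by norm_num
    exact mul_ne_zero (by simpa using hb0) (by simpa using h2)
  filter_upwards [ae_frequently_mem (unif.prod unif) hset hpos] with v hv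
  rw [frequently_atTop] at hv
  obtain ⟨i, -, hi⟩ := hv 0
  obtain ⟨j, hij, hj⟩ := hv (i + 1)
  have hθ : θ ∈ A.passes t θ z S v j := passes_mono t θ z S v hij
    (pass_eq_insert (by rw [hb]; exact hi.1) hi.2).1
  exact ⟨j, (pass_eq_insert (by rw [hb]; exact hj.1) hj.2).2 hθ⟩

theorem step_of_exists {t : ℕ} {θ : Θ} {S : Finset Θ} {w : Noise m}
    (h : ∃ k, A.passes t θ w.1 S w.2.1 (k + 1) = A.passes t θ w.1 S w.2.1 k) :
    ∃ S' : Finset Θ, A.passes t θ w.1 S w.2.1 1 ⊆ S' ∧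
      ∀ u, A.step t (θ, S) (w.1, w.2.1, u) = (A.moveS S' θ w.1 u, S') := by
  classical
  refine ⟨A.passes t θ w.1 S w.2.1 (Nat.find h), ?_, fun u => ?_⟩
  -- The loop may stop at index 0; passing to the equal set at the next index ensures that the first
  -- pass is included.
  · rw [← Nat.find_spec h]
    exact passes_mono t θ w.1 S w.2.1 (by omega)
  · unfold step
    rw [dif_pos h]

/-! ### Closeness of the acceptance probabilities -/

/-- The approximate ratio is the exact one times the exponential of the difference of the two model
errors, at y and at θ, and truncation at 1 is 1-Lipschitz. -/
theorem αS_close [CompactSpace Θ] (hd : 1 ≤ d) (hA : A.Standing) (hC : A.Convergence) {s : ℝ}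
    (hs : 0 < s) : ∃ ε > 0, ∀ S : Finset Θ, IsCover ε S → ∀ θ y : Θ,
      |A.αS S θ y - A.αInf θ y| ≤ s := by
  obtain ⟨c, C, hc, hC0, hb⟩ := ratio_exact_bounds hA hC.sufficient
  -- The bound 1/2 keeps |e| ≤ 1, so that |exp e - 1| ≤ 2|e|; the bound s/(4C) makes the product C *
  -- 2|e| at most s.
  have hτ : 0 < min (1 / 2) (s / (4 * C)) := by positivity
  obtain ⟨ε, hε, h⟩ := approx_close hd hA hC hτ
  refine ⟨ε, hε, fun S hSc θ y => ?_⟩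
  have h1 := h S hSc θ
  have h2 := h S hSc y
  set e := (A.approx S y y - A.exact y) - (A.approx S θ θ - A.exact θ) with he
  have he2 : |e| ≤ 2 * min (1 / 2) (s / (4 * C)) := (abs_sub _ _).trans (by linarith)
  have he1 : |e| ≤ 1 := he2.trans (by linarith [min_le_left (1 / 2) (s / (4 * C))])
  have he3 : |e| ≤ 2 * (s / (4 * C)) := he2.trans (by linarith [min_le_right (1 / 2) (s / (4 * C))])
  unfold αS αInf
  rw [ratio_eq_exact_mul hC.sufficient θ y (A.approx S θ)]
  have hr := ratio_pos hC.sufficient θ y A.exact A.exact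
  set R := A.ratio θ y A.exact A.exact with hR
  refine (abs_min_sub_min_le_max _ _ _ _).trans ?_
  rw [sub_self, abs_zero, max_eq_right (abs_nonneg _)]
  have e1 : R * Real.exp e - R = R * (Real.exp e - 1) := by ring
  rw [e1, abs_mul, abs_of_pos hr]
  calc R * |Real.exp e - 1| ≤ C * (2 * (2 * (s / (4 * C)))) :=
        mul_le_mul (hb θ y).2 ((Real.abs_exp_sub_one_le he1).trans (by linarith)) (abs_nonneg _)
          hC0.le
    _ = s := by field_simp; ring

end Setup

end LAMCMC

/-! ### One step of the algorithm compared with the exact operator -/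

namespace LAMCMC

section Integrals

variable {X Y : Type*} [MeasurableSpace X] [MeasurableSpace Y]

theorem abs_integral_sub_integral_le {μ : Measure X} {F g b : X → ℝ} (hF : Integrable F μ)
    (hg : Integrable g μ) (hb : Integrable b μ) (h : ∀ᵐ x ∂μ, |F x - g x| ≤ b x) :
    |∫ x, F x ∂μ - ∫ x, g x ∂μ| ≤ ∫ x, b x ∂μ := by
  rw [← integral_sub hF hg]
  exact norm_integral_le_of_norm_le (f := fun x => F x - g x) hb h

theorem abs_integral_sub_le {μ : Measure X} [IsProbabilityMeasure μ] {F : X → ℝ} {c b : ℝ}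
    (hF : Integrable F μ) (h : ∀ᵐ x ∂μ, |F x - c| ≤ b) : |∫ x, F x ∂μ - c| ≤ b := by
  simpa using abs_integral_sub_integral_le hF (integrable_const c) (integrable_const b) h

theorem integrable_of_abs_le {μ : Measure X} [IsFiniteMeasure μ] {F : X → ℝ} (hF : Measurable F)
    {C : ℝ} (h : ∀ x, |F x| ≤ C) : Integrable F μ :=
  Integrable.of_bound hF.aestronglyMeasurable C (.of_forall h)

theorem integral_unif_ite {a : ℝ} (h0 : 0 ≤ a) (h1 : a ≤ 1) (p q : ℝ) :
    ∫ u, (open Classical in if u < a then p else q) ∂unif = q + a * (p - q) := by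
  classical
  have hm : MeasurableSet {u : ℝ | u < a} := measurableSet_Iio
  have e : (fun u => if u < a then p else q) =
      fun u => q + ({u : ℝ | u < a}.indicator (fun _ => p - q)) u := by
    funext u
    by_cases hu : u < a <;> simp [Set.indicator, hu]
  have e2 : ∫ u, (if u < a then p else q) ∂unif = q + a * (p - q) := by
    rw [e, integral_add (integrable_const q) ((integrable_const _).indicator hm),
      integral_indicator hm, integral_const, integral_const, measureReal_restrict_apply_univ,
      measureReal_def, measureReal_def, unif_lt h1, ENNReal.toReal_ofReal h0]
    simp
  convert e2

theorem exists_stdGaussian_tail_le (m : ℕ) {ε : ℝ} (hε : 0 < ε) :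
    ∃ φ : ℝ, (stdGaussian (E m)).real {z | φ < ‖z‖} ≤ ε := by
  have hm : ∀ k : ℕ, MeasurableSet {z : E m | (k : ℝ) < ‖z‖} := fun k =>
    measurableSet_lt measurable_const measurable_norm
  have h := tendsto_measure_iInter_atTop (μ := stdGaussian (E m))
    (s := fun k : ℕ => {z : E m | (k : ℝ) < ‖z‖}) (fun k => (hm k).nullMeasurableSet)
    (fun i j hij z (hz : (j : ℝ) < ‖z‖) => lt_of_le_of_lt (Nat.cast_le.2 hij : (i : ℝ) ≤ j) hz) ⟨0, measure_ne_top _ _⟩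
  have h0 : ⋂ k : ℕ, {z : E m | (k : ℝ) < ‖z‖} = ∅ := by
    refine Set.eq_empty_of_forall_notMem fun z hz => ?_
    obtain ⟨k, hk⟩ := exists_nat_gt ‖z‖
    exact lt_asymm hk (Set.mem_iInter.1 hz k)
  rw [h0, measure_empty] at h
  obtain ⟨k, hk⟩ := ((ENNReal.tendsto_nhds_zero.1 h) (ENNReal.ofReal ε) (by simpa using hε)).exists
  exact ⟨k, ENNReal.toReal_le_of_le_ofReal hε.le hk⟩

end Integrals

namespace Setup

variable {d m n : ℕ} {Θ : Set (E d)} {A : Setup d m n Θ}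

/-- The transition operator of the Metropolis-Hastings chain with the exact model. -/
def exactOp (A : Setup d m n Θ) (f : Θ → ℝ) (θ : Θ) : ℝ :=
  f θ + ∫ y, A.q θ y A.exact * (A.αInf θ y * (f y - f θ)) ∂(vol Θ)

theorem measurable_rS [CompactSpace Θ] (hA : A.Standing) (hS : A.Sufficient) (S : Finset Θ)
    (θ : Θ) : Measurable (A.rS S θ) := by
  have : Nonempty Θ := ⟨θ⟩
  obtain ⟨a, rfl⟩ := Enum.exists_toFinset_eq S
  exact (measOn_rS hA hS).measurable.comp (f := fun z : E m => ((θ, z), a)) (by fun_prop)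

theorem integral_comp_rS [CompactSpace Θ] (hA : A.Standing) (hS : A.Sufficient) (S : Finset Θ)
    (θ : Θ) {h : Θ → ℝ} (hh : Continuous h) :
    ∫ z, h (A.rS S θ z) ∂(stdGaussian (E m)) = ∫ y, A.q θ y A.exact * h y ∂(vol Θ) := by
  have hr := measurable_rS hA hS S θ
  have hq : Measurable fun y => A.q θ y A.exact :=
    (hS.q_cont.comp (f := fun y : Θ => (θ, y)) (by fun_prop)).measurable
  rw [← integral_map hr.aemeasurable hh.aestronglyMeasurable, map_rS hA hS,
    integral_withDensity_eq_integral_toReal_smul]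
  · refine integral_congr_ae (.of_forall fun y => ?_)
    simp [ENNReal.toReal_ofReal (q_pos hS θ y A.exact).le]
  · exact hq.ennreal_ofReal
  · exact .of_forall fun y => ENNReal.ofReal_lt_top

theorem integral_moveS (hS : A.Sufficient) (S : Finset Θ) (θ : Θ) (z : E m) (f : Θ → ℝ) :
    ∫ u, f (A.moveS S θ z u) ∂unif =
      f θ + A.αS S θ (A.rS S θ z) * (f (A.rS S θ z) - f θ) := by
  classical
  rw [← integral_unif_ite (αS_pos hS _ _ _).le (αS_le_one _ _ _)]
  refine integral_congr_ae (.of_forall fun u => ?_)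
  simp only [moveS]
  split_ifs <;> rfl

/-- From a fine sample set, one step of the algorithm acts on continuous functions almost like the
exact transition operator. -/
theorem abs_integral_lstep_sub_exactOp_le [CompactSpace Θ] (hd : 1 ≤ d) (hA : A.Standing)
    (hC : A.Convergence) {f : Θ → ℝ} (hf : Continuous f) {τ : ℝ} (hτ : 0 < τ) :
    ∃ ε > 0, ∀ (t : ℕ) (x : Θ × Enum Θ), IsCover ε x.2.toFinset →
      |∫ w, f (A.lstep t x w).1 ∂(noiseLaw m) - A.exactOp f x.1| ≤ τ := by
  have hS := hC.sufficient
  obtain ⟨F₀, hF₀⟩ := (isCompact_univ (X := Θ)).exists_bound_of_continuousOn hf.continuousOn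
  set F := max F₀ 1 with hFdef
  have hF : ∀ y, |f y| ≤ F := fun y => (hF₀ y (Set.mem_univ _)).trans (le_max_left _ _)
  have hFpos : 0 < F := by positivity
  have hdiff : ∀ y y', |f y - f y'| ≤ 2 * F := fun y y' =>
    (abs_sub _ _).trans (by linarith [hF y, hF y'])
  set h : Θ × Θ → ℝ := fun p => A.αInf p.1 p.2 * (f p.2 - f p.1) with hh
  have hhc : Continuous h := (αInf_continuous hA hS).mul (by fun_prop)
  have hhb : ∀ p, |h p| ≤ 2 * F := fun p => by
    rw [hh, abs_mul, abs_of_pos (αInf_pos hS _ _)]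
    exact (mul_le_of_le_one_left (abs_nonneg _) (αInf_le_one _ _)).trans (hdiff _ _)
  have hhu := CompactSpace.uniformContinuous_of_continuous hhc
  obtain ⟨δ, hδ, hhδ⟩ := Metric.uniformContinuous_iff.1 hhu (τ / 4) (by positivity)
  obtain ⟨φ₀, hφ₀⟩ := exists_stdGaussian_tail_le m (ε := τ / (16 * F)) (by positivity)
  obtain ⟨ε₁, hε₁, hα⟩ := αS_close hd hA hC (s := τ / (8 * F)) (by positivity)
  obtain ⟨ε₂, hε₂, hr⟩ := hC.proposal_close φ₀ (δ / 2) (by positivity)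
  have hcm : ∀ {ε ε' : ℝ} {S : Finset Θ}, ε ≤ ε' → IsCover ε S → IsCover ε' S :=
    fun h hc => lt_of_lt_of_le hc (ENNReal.ofReal_le_ofReal h)
  refine ⟨min ε₁ ε₂, lt_min hε₁ hε₂, fun t x hx => ?_⟩
  obtain ⟨θ, a⟩ := x
  dsimp only at hx ⊢
  set S := a.toFinset with hSdef
  set T : Set (E m) := {z | φ₀ < ‖z‖} with hT
  have hTm : MeasurableSet T := measurableSet_lt measurable_const measurable_norm
  -- For ‖z‖ ≤ φ₀ the errors of acceptance and proposal are τ/4 each. In the Gaussian tail a trivial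
  -- bound is used, which costs τ/4 after integration.
  set bd : E m → ℝ := fun z => τ / 2 + T.indicator (fun _ => 4 * F) z with hbd
  have hmG : Measurable fun w : Noise m => f (A.lstep t (θ, a) w).1 :=
    hf.measurable.comp (measurable_fst.comp ((measurable_lstep hA hS t).comp
      (f := fun w : Noise m => ((θ, a), w)) (by fun_prop)))
  have hstep : ∀ w : Noise m, (A.lstep t (θ, a) w).1 = (A.step t (θ, S) w).1 := fun w =>
    (congrArg Prod.fst (step_eq t (θ, a) w)).symm
  have hinner : ∀ z : E m, ∀ᵐ v ∂(Measure.infinitePi fun _ : ℕ => unif.prod unif),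
      |∫ u, f (A.lstep t (θ, a) (z, v, u)).1 ∂unif - (f θ + h (θ, A.rS S θ z))| ≤ bd z := by
    intro z
    filter_upwards [ae_exists_passes_eq hS t θ z S] with v hv
    obtain ⟨S', hSS', hs⟩ := step_of_exists (w := (z, v, 0)) hv
    have hsub : S ⊆ S' := (subset_passes t θ z S v 1).trans hSS'
    simp only [hstep, hs, integral_moveS hS]
    have hx' := hx.mono hsub
    -- The decision uses the proposal y' from the final set S', which depends on the noise; y comes
    -- from the initial set, and its law is exactly q. Both sets are fine covers, so
    -- `proposal_close` compares the two.
    set y := A.rS S θ z with hy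
    set y' := A.rS S' θ z with hy'
    have e1 : |(A.αS S' θ y' - A.αInf θ y') * (f y' - f θ)| ≤ τ / 4 := by
      rw [abs_mul]
      calc |A.αS S' θ y' - A.αInf θ y'| * |f y' - f θ| ≤ τ / (8 * F) * (2 * F) :=
            mul_le_mul (hα S' (hcm (min_le_left _ _) hx') θ y') (hdiff _ _) (abs_nonneg _)
              (by positivity)
        _ = τ / 4 := by field_simp; ring
    have e3 : f θ + A.αS S' θ y' * (f y' - f θ) - (f θ + h (θ, y)) =
        (A.αS S' θ y' - A.αInf θ y') * (f y' - f θ) + (h (θ, y') - h (θ, y)) := by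
      simp only [hh]; ring
    rw [e3]
    refine (abs_add_le _ _).trans ?_
    simp only [hbd]
    by_cases hz : z ∈ T
    · rw [Set.indicator_of_mem hz]
      have e2 := (abs_sub (h (θ, y')) (h (θ, y)))
      linarith [hhb (θ, y'), hhb (θ, y)]
    · rw [Set.indicator_of_notMem hz]
      have hd' := hr S' S (hcm (min_le_right _ _) hx') (hcm (min_le_right _ _) hx) z
        (not_lt.1 hz) θ
      have e2 := hhδ (a := (θ, y')) (b := (θ, y)) (by
        rw [Prod.dist_eq, dist_self, max_eq_right dist_nonneg]
        change dist y' y < δ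
        linarith)
      rw [Real.dist_eq] at e2
      linarith
  have hI : Integrable (fun w : Noise m => f (A.lstep t (θ, a) w).1) (noiseLaw m) :=
    integrable_of_abs_le hmG fun w => hF _
  have hIz : ∀ z : E m, Integrable
      (fun p : (ℕ → ℝ × ℝ) × ℝ => f (A.lstep t (θ, a) (z, p)).1)
      ((Measure.infinitePi fun _ : ℕ => unif.prod unif).prod unif) := fun z =>
    integrable_of_abs_le (hmG.comp (f := fun p : (ℕ → ℝ × ℝ) × ℝ => ((z, p) : Noise m))
      (by fun_prop)) fun w => hF _
  have hmid : ∀ z : E m, |∫ p, f (A.lstep t (θ, a) (z, p)).1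
      ∂((Measure.infinitePi fun _ : ℕ => unif.prod unif).prod unif) -
      (f θ + h (θ, A.rS S θ z))| ≤ bd z := fun z => by
    rw [integral_prod _ (hIz z)]
    exact abs_integral_sub_le (hIz z).integral_prod_left (hinner z)
  have hhi : Integrable (fun z => h (θ, A.rS S θ z)) (stdGaussian (E m)) :=
    integrable_of_abs_le (hhc.measurable.comp
      (measurable_const.prodMk (measurable_rS hA hS S θ))) fun z => hhb _
  have hgi : Integrable (fun z => f θ + h (θ, A.rS S θ z)) (stdGaussian (E m)) :=
    (integrable_const _).add hhi
  have hbi : Integrable bd (stdGaussian (E m)) :=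
    (integrable_const _).add ((integrable_const _).indicator hTm)
  have hex : ∫ z, (f θ + h (θ, A.rS S θ z)) ∂(stdGaussian (E m)) = A.exactOp f θ := by
    rw [integral_add (integrable_const _) hhi,
      integral_comp_rS hA hS S θ (h := fun y => h (θ, y)) (by fun_prop), integral_const]
    simp [exactOp, hh]
  have hbint : ∫ z, bd z ∂(stdGaussian (E m)) ≤ τ := by
    simp only [hbd]
    rw [integral_add (integrable_const _) ((integrable_const _).indicator hTm),
      integral_indicator hTm, integral_const, integral_const, measureReal_restrict_apply_univ]
    simp only [probReal_univ, smul_eq_mul]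
    have : (stdGaussian (E m)).real T * (4 * F) ≤ τ / (16 * F) * (4 * F) := by gcongr
    have e : τ / (16 * F) * (4 * F) = τ / 4 := by field_simp; ring
    linarith
  rw [← hex]
  unfold noiseLaw at hI ⊢
  rw [integral_prod _ hI]
  exact (abs_integral_sub_integral_le hI.integral_prod_left hgi hbi (.of_forall hmid)).trans hbint

end Setup

end LAMCMC

/-! ### The exact chain: reversibility, contraction, uniform ergodicity -/

namespace LAMCMC

namespace Setup

variable {d m n : ℕ} {Θ : Set (E d)} {A : Setup d m n Θ}

theorem integrable_of_continuous [CompactSpace Θ] (hS : A.Sufficient) {f : Θ → ℝ}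
    (hf : Continuous f) : Integrable f (vol Θ) := by
  have := isFiniteMeasure_vol hS.compact
  exact hf.integrable_of_hasCompactSupport (HasCompactSupport.of_compactSpace _)

theorem integral_q [CompactSpace Θ] (hA : A.Standing) (hS : A.Sufficient) (θ : Θ) :
    ∫ y, A.q θ y A.exact ∂(vol Θ) = 1 := by
  simpa using (integral_comp_rS hA hS ∅ θ (h := fun _ => 1) continuous_const).symm

/-- The transition density of the accepted moves of the exact chain. -/
def flow (A : Setup d m n Θ) (p : Θ × Θ) : ℝ := A.q p.1 p.2 A.exact * A.αInf p.1 p.2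

theorem flow_continuous (hA : A.Standing) (hS : A.Sufficient) : Continuous A.flow :=
  hS.q_cont.mul (αInf_continuous hA hS)

theorem flow_lower (hA : A.Standing) (hS : A.Sufficient) : ∃ k > 0, ∀ p, k ≤ A.flow p := by
  obtain ⟨a, ha, hα⟩ := αInf_lower hA hS
  obtain ⟨c, hc, hq⟩ := hS.q_lower
  exact ⟨c * a, by positivity, fun p => mul_le_mul (hq _ _) (hα _ _) ha.le
    (q_pos hS _ _ _).le⟩

theorem integral_flow_le_one [CompactSpace Θ] (hA : A.Standing) (hS : A.Sufficient) (θ : Θ) :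
    ∫ y, A.flow (θ, y) ∂(vol Θ) ≤ 1 := by
  rw [← integral_q hA hS θ]
  refine integral_mono (integrable_of_continuous hS ((flow_continuous hA hS).comp (by fun_prop)))
    (integrable_of_continuous hS (hS.q_cont.comp (f := fun y : Θ => (θ, y)) (by fun_prop)))
    fun y => ?_
  exact mul_le_of_le_one_right (q_pos hS _ _ _).le (αInf_le_one _ _)

/-- Detailed balance. -/
theorem density_mul_flow_comm (hA : A.Standing) (hS : A.Sufficient) (θ y : Θ) :
    A.density θ * A.flow (θ, y) = A.density y * A.flow (y, θ) := by
  -- The accepted flux is the minimum of the two proposed fluxes, a symmetric expression.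
  have hb : ∀ θ y : Θ, A.density θ * A.flow (θ, y) =
      min (A.density θ * A.q θ y A.exact) (A.density y * A.q y θ A.exact) := by
    intro θ y
    have h1 := density_pos hS θ
    have h2 := q_pos hS θ y A.exact
    have hn := normConst_pos hA hS θ
    have h3 : A.ratio θ y A.exact A.exact =
        (A.density y * A.q y θ A.exact) / (A.density θ * A.q θ y A.exact) := by
      rw [ratio, exp_exact hA hS, exp_exact hA hS, post_eq hA hS, post_eq hA hS]
      field_simp
    simp only [flow, αInf]
    rw [h3, ← mul_assoc, mul_min_of_nonneg _ _ (by positivity), mul_one,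
      mul_div_cancel₀ _ (by positivity)]
  rw [hb, hb, min_comm]

theorem exactOp_eq (f : Θ → ℝ) (θ : Θ) :
    A.exactOp f θ = f θ + ∫ y, A.flow (θ, y) * (f y - f θ) ∂(vol Θ) := by
  simp only [exactOp, flow, mul_assoc]

theorem exactOp_continuous [CompactSpace Θ] (hA : A.Standing) (hS : A.Sufficient) {f : Θ → ℝ}
    (hf : Continuous f) : Continuous (A.exactOp f) := by
  have := isFiniteMeasure_vol hS.compact
  have hc := flow_continuous hA hS
  have h := continuous_parametric_integral_of_continuous (μ := vol Θ)
    (f := fun θ y : Θ => A.flow (θ, y) * (f y - f θ)) (by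
      change Continuous fun p : Θ × Θ => A.flow (p.1, p.2) * (f p.2 - f p.1)
      fun_prop) (isCompact_univ)
  simp only [Measure.restrict_univ] at h
  rw [funext (exactOp_eq f)]
  exact hf.add h

/-- The Doeblin condition: the exact transition operator contracts oscillations. -/
theorem exactOp_contract [CompactSpace Θ] [Nonempty Θ] (hA : A.Standing) (hS : A.Sufficient) :
    ∃ κ : ℝ, 0 < κ ∧ κ ≤ 1 ∧ ∀ f : Θ → ℝ, Continuous f → ∀ a D : ℝ, (∀ θ, a ≤ f θ) →
      (∀ θ, f θ ≤ a + D) → ∃ a', (∀ θ, a' ≤ A.exactOp f θ) ∧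
        ∀ θ, A.exactOp f θ ≤ a' + (1 - κ) * D := by
  have := isFiniteMeasure_vol hS.compact
  obtain ⟨k, hk, hfl⟩ := flow_lower hA hS
  set V := (vol Θ).real Set.univ with hV
  have hVpos : 0 < V := ENNReal.toReal_pos
    (vol_pos_of_isOpen hS.compact hS.regular isOpen_univ Set.univ_nonempty).ne' (measure_ne_top _ _)
  have hfi : ∀ θ, Integrable (fun y => A.flow (θ, y)) (vol Θ) := fun θ =>
    integrable_of_continuous hS ((flow_continuous hA hS).comp (by fun_prop))
  have hkV : k * V ≤ 1 := by
    obtain ⟨θ⟩ := ‹Nonempty Θ›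
    refine le_trans ?_ (integral_flow_le_one hA hS θ)
    calc k * V = ∫ _, k ∂(vol Θ) := by rw [integral_const, smul_eq_mul, mul_comm]
      _ ≤ _ := integral_mono (integrable_const _) (hfi θ) fun y => hfl _
  refine ⟨k * V, by positivity, hkV, fun f hf a D h0 h1 => ?_⟩
  -- The part k of the flow contributes k ∫ f from every starting point. Once this and a (1 - kV)
  -- are split off, what remains lies between 0 and (1 - kV) D.
  refine ⟨k * ∫ y, f y ∂(vol Θ) + a * (1 - k * V), ?_⟩
  have hfint := integrable_of_continuous hS hf
  have hfc := flow_continuous hA hS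
  have hfm : ∀ θ, Integrable (fun y => A.flow (θ, y) * f y) (vol Θ) := fun θ =>
    integrable_of_continuous hS (by fun_prop)
  have key : ∀ θ, A.exactOp f θ = k * ∫ y, f y ∂(vol Θ) + a * (1 - k * V) +
      ((f θ - a) * (1 - ∫ y, A.flow (θ, y) ∂(vol Θ)) +
        ∫ y, (A.flow (θ, y) - k) * (f y - a) ∂(vol Θ)) := by
    intro θ
    have e1 : ∫ y, A.flow (θ, y) * (f y - f θ) ∂(vol Θ) =
        ∫ y, A.flow (θ, y) * f y ∂(vol Θ) - (∫ y, A.flow (θ, y) ∂(vol Θ)) * f θ := by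
      simp only [mul_sub]
      rw [integral_sub (hfm θ) ((hfi θ).mul_const _), integral_mul_const]
    have e2 : ∫ y, (A.flow (θ, y) - k) * (f y - a) ∂(vol Θ) =
        ∫ y, A.flow (θ, y) * f y ∂(vol Θ) - (∫ y, A.flow (θ, y) ∂(vol Θ)) * a -
          (k * ∫ y, f y ∂(vol Θ) - V * (k * a)) := by
      have : ∀ y, (A.flow (θ, y) - k) * (f y - a) =
          (A.flow (θ, y) * f y - A.flow (θ, y) * a) - (k * f y - k * a) := fun y => by ring
      simp only [this]
      rw [integral_sub (f := fun y => A.flow (θ, y) * f y - A.flow (θ, y) * a)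
          (g := fun y => k * f y - k * a) ((hfm θ).sub ((hfi θ).mul_const _))
          ((hfint.const_mul _).sub (integrable_const _)),
        integral_sub (hfm θ) ((hfi θ).mul_const _), integral_mul_const,
        integral_sub (hfint.const_mul _) (integrable_const _), integral_const_mul, integral_const,
        smul_eq_mul]
    rw [exactOp_eq, e1, e2]
    ring
  have hD : ∀ θ, 0 ≤ ∫ y, (A.flow (θ, y) - k) * (f y - a) ∂(vol Θ) ∧
      ∫ y, (A.flow (θ, y) - k) * (f y - a) ∂(vol Θ) ≤
        (∫ y, A.flow (θ, y) ∂(vol Θ) - k * V) * D := by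
    intro θ
    refine ⟨integral_nonneg fun y => mul_nonneg (sub_nonneg.2 (hfl _)) (sub_nonneg.2 (h0 _)), ?_⟩
    have : (∫ y, A.flow (θ, y) ∂(vol Θ) - k * V) * D = ∫ y, (A.flow (θ, y) - k) * D ∂(vol Θ) := by
      rw [integral_mul_const, integral_sub (hfi θ) (integrable_const _), integral_const,
        smul_eq_mul, mul_comm k]
    rw [this]
    refine integral_mono (integrable_of_continuous hS (by fun_prop))
      (integrable_of_continuous hS (by fun_prop)) fun y => ?_
    exact mul_le_mul_of_nonneg_left (by linarith [h1 y]) (sub_nonneg.2 (hfl _))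
  refine ⟨fun θ => ?_, fun θ => ?_⟩
  · rw [key]
    have := mul_nonneg (sub_nonneg.2 (h0 θ)) (sub_nonneg.2 (integral_flow_le_one hA hS θ))
    linarith [(hD θ).1]
  · rw [key]
    have := mul_le_mul_of_nonneg_right (show f θ - a ≤ D by linarith [h1 θ])
      (sub_nonneg.2 (integral_flow_le_one hA hS θ))
    have e : D * (1 - ∫ y, A.flow (θ, y) ∂(vol Θ)) +
        (∫ y, A.flow (θ, y) ∂(vol Θ) - k * V) * D = (1 - k * V) * D := by ring
    linarith [(hD θ).2]

/-- The posterior is invariant under the exact chain. -/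
theorem integral_exactOp [CompactSpace Θ] (hA : A.Standing) (hS : A.Sufficient) {f : Θ → ℝ}
    (hf : Continuous f) : ∫ θ, A.exactOp f θ ∂A.target = ∫ θ, f θ ∂A.target := by
  have := isFiniteMeasure_vol hS.compact
  have hfc := flow_continuous hA hS
  have hdc := density_continuous hS
  rw [integral_target hS, integral_target hS]
  set K : Θ × Θ → ℝ := fun p => A.density p.1 * A.flow p * (f p.2 - f p.1) with hK
  have hKc : Continuous K := by fun_prop
  have hKi : Integrable K ((vol Θ).prod (vol Θ)) :=
    hKc.integrable_of_hasCompactSupport (HasCompactSupport.of_compactSpace _)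
  -- Detailed balance makes the integrand antisymmetric, so its double integral vanishes by Fubini's
  -- theorem.
  have hanti : ∀ θ y, K (y, θ) = -K (θ, y) := fun θ y => by
    simp only [hK]
    rw [density_mul_flow_comm hA hS y θ]
    ring
  have hzero : ∫ θ, ∫ y, K (θ, y) ∂(vol Θ) ∂(vol Θ) = 0 := by
    have h := integral_integral_swap (f := fun θ y => K (θ, y)) hKi
    have h2 : ∫ y, ∫ θ, K (θ, y) ∂(vol Θ) ∂(vol Θ) = -∫ θ, ∫ y, K (θ, y) ∂(vol Θ) ∂(vol Θ) := by
      rw [← integral_neg]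
      refine integral_congr_ae (.of_forall fun y => ?_)
      simp only [← integral_neg, ← hanti]
    linarith
  have e : ∀ θ, A.density θ * A.exactOp f θ = A.density θ * f θ + ∫ y, K (θ, y) ∂(vol Θ) := by
    intro θ
    simp only [hK, mul_assoc]
    rw [exactOp_eq, integral_const_mul]
    ring
  simp only [e]
  rw [integral_add (f := fun θ => A.density θ * f θ) (integrable_of_continuous hS (hdc.mul hf)) hKi.integral_prod_left, hzero,
    add_zero]

theorem iterate_exactOp_continuous [CompactSpace Θ] (hA : A.Standing) (hS : A.Sufficient)
    {f : Θ → ℝ} (hf : Continuous f) (k : ℕ) : Continuous (A.exactOp^[k] f) := by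
  induction k with
  | zero => exact hf
  | succ k ih =>
    rw [Function.iterate_succ_apply']
    exact exactOp_continuous hA hS ih

theorem integral_iterate_exactOp [CompactSpace Θ] (hA : A.Standing) (hS : A.Sufficient)
    {f : Θ → ℝ} (hf : Continuous f) (k : ℕ) :
    ∫ θ, A.exactOp^[k] f θ ∂A.target = ∫ θ, f θ ∂A.target := by
  induction k with
  | zero => rfl
  | succ k ih =>
    rw [Function.iterate_succ_apply',
      integral_exactOp hA hS (iterate_exactOp_continuous hA hS hf k), ih]

/-- Uniform ergodicity of the exact chain. -/
theorem exists_iterate_exactOp_close [CompactSpace Θ] [Nonempty Θ] (hA : A.Standing)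
    (hS : A.Sufficient) {f : Θ → ℝ} (hf : Continuous f) {τ : ℝ} (hτ : 0 < τ) :
    ∃ k, ∀ θ, |A.exactOp^[k] f θ - ∫ θ, f θ ∂A.target| ≤ τ := by
  obtain ⟨κ, hκ0, hκ1, hκ⟩ := exactOp_contract hA hS
  obtain ⟨F, hF⟩ := (isCompact_univ (X := Θ)).exists_bound_of_continuousOn hf.continuousOn
  have hosc : ∀ k, ∃ a, (∀ θ, a ≤ A.exactOp^[k] f θ) ∧
      ∀ θ, A.exactOp^[k] f θ ≤ a + (1 - κ) ^ k * (2 * F) := by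
    intro k
    induction k with
    | zero =>
      refine ⟨-F, fun θ => (abs_le.1 (hF θ (Set.mem_univ _))).1, fun θ => ?_⟩
      have := (abs_le.1 (hF θ (Set.mem_univ _))).2
      simp only [Function.iterate_zero, id_eq, pow_zero]
      linarith
    | succ k ih =>
      obtain ⟨a, h1, h2⟩ := ih
      obtain ⟨a', h1', h2'⟩ := hκ _ (iterate_exactOp_continuous hA hS hf k) a _ h1 h2
      refine ⟨a', fun θ => ?_, fun θ => ?_⟩
      · rw [Function.iterate_succ_apply']; exact h1' θ
      · rw [Function.iterate_succ_apply', pow_succ', mul_assoc]; exact h2' θ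
  have hlim : Tendsto (fun k => (1 - κ) ^ k * (2 * F)) atTop (𝓝 0) := by
    simpa using (tendsto_pow_atTop_nhds_zero_of_lt_one (sub_nonneg.2 hκ1)
      (by linarith)).mul_const (2 * F)
  obtain ⟨k, hk⟩ := (hlim.eventually_le_const hτ).exists
  obtain ⟨a, h1, h2⟩ := hosc k
  refine ⟨k, fun θ => ?_⟩
  have := isProbabilityMeasure_target hA hS (Classical.arbitrary Θ)
  have hi : Integrable (A.exactOp^[k] f) A.target :=
    (iterate_exactOp_continuous hA hS hf k).integrable_of_hasCompactSupport
      (HasCompactSupport.of_compactSpace _)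
  rw [← integral_iterate_exactOp hA hS hf k, abs_sub_comm]
  refine abs_integral_sub_le hi (.of_forall fun y => ?_)
  rw [abs_le]
  constructor <;> linarith [h1 θ, h1 y, h2 θ, h2 y]

end Setup

end LAMCMC

/-! ### Random refinement makes the sample set fine in probability -/

namespace LAMCMC

namespace Setup

variable {d m n : ℕ} {Θ : Set (E d)} {A : Setup d m n Θ}

/-- The sample set of the enumeration misses `U`. -/
def Misses (U : Set Θ) (x : Θ × Enum Θ) : Prop := ∀ i < x.2.2, x.2.1 i ∉ U

theorem misses_iff {U : Set Θ} {x : Θ × Enum Θ} : Misses U x ↔ ∀ s ∈ x.2.toFinset, s ∉ U := by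
  simp [Misses, Enum.toFinset]

theorem measurableSet_misses {U : Set Θ} (hU : MeasurableSet U) :
    MeasurableSet {x : Θ × Enum Θ | Misses U x} := by
  have : {x : Θ × Enum Θ | Misses U x} =
      ⋂ i : ℕ, {x : Θ × Enum Θ | x.2.2 ≤ i} ∪ {x : Θ × Enum Θ | x.2.1 i ∈ U}ᶜ := by
    ext x
    simp only [Misses, Set.mem_ofPred_eq, Set.mem_iInter, Set.mem_union, Set.mem_compl_iff]
    refine forall_congr' fun i => ?_
    rw [← not_lt, imp_iff_not_or]
  rw [this]
  refine MeasurableSet.iInter fun i => MeasurableSet.union ?_ (MeasurableSet.compl ?_)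
  · exact measurableSet_le (f := fun x : Θ × Enum Θ => x.2.2) (by fun_prop) measurable_const
  · have hm : Measurable fun x : Θ × Enum Θ => x.2.1 i :=
      (measurable_pi_apply i).comp (measurable_fst.comp measurable_snd)
    exact hm hU

theorem integral_misses {X : Type*} [MeasurableSpace X] (μ : Measure X) {U : Set Θ}
    (hU : MeasurableSet U) {F : X → Θ × Enum Θ} (hF : Measurable F) :
    ∫ y, {x : Θ × Enum Θ | Misses U x}.indicator (1 : Θ × Enum Θ → ℝ) (F y) ∂μ =
      μ.real {y | Misses U (F y)} :=
  integral_indicator_one (μ := μ) (s := {y | Misses U (F y)}) (hF (measurableSet_misses hU))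

theorem toFinset_subset_lstep (t : ℕ) (x : Θ × Enum Θ) (w : Noise m) :
    x.2.toFinset ⊆ (A.lstep t x w).2.toFinset := by
  classical
  unfold lstep
  split_ifs with h
  · rw [toFinset_lpasses]
    exact subset_passes _ _ _ _ _ _
  · exact Finset.Subset.refl _

theorem ae_exists_lStop [CompactSpace Θ] (hA : A.Standing) (hS : A.Sufficient) (t : ℕ)
    (x : Θ × Enum Θ) : ∀ᵐ w ∂(noiseLaw m), ∃ k, A.LStop t x w k := by
  have hm : MeasurableSet {w : Noise m | ∃ k, A.LStop t x w k} := by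
    rw [Set.ofPred_exists]
    exact MeasurableSet.iUnion fun k => (measurable_prodMk_left (x := x))
      (measurableSet_lStop hA hS t k)
  have hae : ∀ z : E m, ∀ᵐ p ∂((Measure.infinitePi fun _ : ℕ => unif.prod unif).prod unif),
      ∃ k, A.LStop t x (z, p) k := by
    intro z
    have h := ae_exists_passes_eq hS t x.1 z x.2.toFinset
    have h' := (Measure.quasiMeasurePreserving_fst (μ := Measure.infinitePi fun _ : ℕ =>
      unif.prod unif) (ν := unif)).ae h
    filter_upwards [h'] with p hp
    obtain ⟨k, hk⟩ := hp
    refine ⟨k, ?_⟩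
    rw [LStop, toFinset_lpasses, toFinset_lpasses]
    exact hk
  exact (Measure.ae_prod_mem_iff_ae_ae_mem hm).2 (.of_forall hae)

/-- The random refinement puts points into every open set. -/
theorem exists_integral_misses_le [CompactSpace Θ] (hA : A.Standing) (hS : A.Sufficient)
    {U : Set Θ} (hU : IsOpen U) (hne : U.Nonempty) : ∃ p : ℝ, 0 < p ∧ p ≤ 1 ∧
      ∀ (t : ℕ) (x : Θ × Enum Θ), (noiseLaw m).real {w | Misses U (A.lstep t x w)} ≤
        (1 - p) * {x | Misses U x}.indicator 1 x := by
  classical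
  have := isFiniteMeasure_vol hS.compact
  obtain ⟨c, hc, hq⟩ := hS.q_lower
  obtain ⟨b, hb0, hb1, hb⟩ := hS.β_const
  have hV : 0 < (vol Θ).real U :=
    ENNReal.toReal_pos (vol_pos_of_isOpen hS.compact hS.regular hU hne).ne' (measure_ne_top _ _)
  set B : Set (ℝ × ℝ) := {p | p.1 < b ∧ p.2 < 1 / 2} with hB
  have hBm : MeasurableSet B :=
    (measurableSet_lt measurable_fst measurable_const).inter
      (measurableSet_lt measurable_snd measurable_const)
  have hBreal : (unif.prod unif).real B = b * (1 / 2) := by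
    rw [measureReal_def, hB, unif_prod_lt_lt hb1 (by norm_num), ENNReal.toReal_mul,
      ENNReal.toReal_ofReal hb0.le, ENNReal.toReal_ofReal (by norm_num)]
  -- On this event the proposal from the initial set lies in U and the first pass inserts it. The
  -- event depends on z and the first pass variables, which are independent.
  set D : Θ × Enum Θ → Set (Noise m) := fun x =>
    (A.rS x.2.toFinset x.1 ⁻¹' U) ×ˢ (((fun v : ℕ → ℝ × ℝ => v 0) ⁻¹' B) ×ˢ Set.univ) with hD
  have hDm : ∀ x, MeasurableSet (D x) := fun x =>
    (measurable_rS hA hS _ _ hU.measurableSet).prod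
      ((measurable_pi_apply 0 hBm).prod MeasurableSet.univ)
  have hr : ∀ x : Θ × Enum Θ, c * (vol Θ).real U ≤
      (stdGaussian (E m)).real (A.rS x.2.toFinset x.1 ⁻¹' U) := by
    intro x
    rw [measureReal_def, measureReal_def, ← Measure.map_apply (measurable_rS hA hS _ _) hU.measurableSet,
      map_rS hA hS, withDensity_apply _ hU.measurableSet]
    have h1 : ENNReal.ofReal c * vol Θ U ≤
        ∫⁻ y in U, ENNReal.ofReal (A.q x.1 y A.exact) ∂(vol Θ) := by
      rw [← setLIntegral_const]
      exact lintegral_mono fun y => ENNReal.ofReal_le_ofReal (hq _ _)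
    have h2 : ∫⁻ y in U, ENNReal.ofReal (A.q x.1 y A.exact) ∂(vol Θ) ≠ ⊤ := by
      rw [← withDensity_apply _ hU.measurableSet, ← map_rS hA hS x.2.toFinset x.1,
        Measure.map_apply (measurable_rS hA hS _ _) hU.measurableSet]
      exact measure_ne_top _ _
    have h3 := ENNReal.toReal_mono h2 h1
    rwa [ENNReal.toReal_mul, ENNReal.toReal_ofReal hc.le] at h3
  have hDr : ∀ x, c * (vol Θ).real U * (b * (1 / 2)) ≤ (noiseLaw m).real (D x) := by
    intro x
    have e : (noiseLaw m).real (D x) =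
        (stdGaussian (E m)).real (A.rS x.2.toFinset x.1 ⁻¹' U) * (b * (1 / 2)) := by
      have h0 : (Measure.infinitePi fun _ : ℕ => unif.prod unif)
          ((fun v : ℕ → ℝ × ℝ => v 0) ⁻¹' B) = (unif.prod unif) B := by
        rw [← Measure.map_apply (measurable_pi_apply 0) hBm, Measure.infinitePi_map_eval]
      rw [← hBreal, measureReal_def, measureReal_def, measureReal_def, noiseLaw, hD,
        Measure.prod_prod, Measure.prod_prod, h0, measure_univ, mul_one, ENNReal.toReal_mul]
    rw [e]
    gcongr
    exact hr x
  refine ⟨min 1 (c * (vol Θ).real U * (b * (1 / 2))), by positivity, min_le_left _ _,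
    fun t x => ?_⟩
  by_cases hx : Misses U x
  · rw [Set.indicator_of_mem hx, Pi.one_apply, mul_one]
    have hle : (noiseLaw m).real {w | Misses U (A.lstep t x w)} ≤ (noiseLaw m).real (D x)ᶜ := by
      refine ENNReal.toReal_mono (measure_ne_top _ _) (measure_mono_ae ?_)
      filter_upwards [ae_exists_lStop hA hS t x] with w hw hmiss hwD
      obtain ⟨k, hk⟩ := hw
      rw [LStop, toFinset_lpasses, toFinset_lpasses] at hk
      obtain ⟨S', hS', hst⟩ := step_of_exists (A := A) (w := w) ⟨k, hk⟩
      obtain ⟨hz, hv, -⟩ := hwD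
      have hmem : A.rS x.2.toFinset x.1 w.1 ∈ S' :=
        hS' (mem_passes_one (by rw [hb]; exact hv.1) hv.2)
      have e := (congrArg Prod.snd (step_eq t x w)).symm.trans (congrArg Prod.snd (hst w.2.2))
      dsimp only at e
      exact misses_iff.1 hmiss _ (e ▸ hmem) hz
    rw [probReal_compl_eq_one_sub (hDm x)] at hle
    linarith [hDr x, min_le_right 1 (c * (vol Θ).real U * (b * (1 / 2)))]
  · have : {w | Misses U (A.lstep t x w)} = ∅ := by
      refine Set.eq_empty_of_forall_notMem fun w hw => hx ?_
      rw [Set.mem_ofPred_eq, misses_iff] at hw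
      exact misses_iff.2 fun s hs => hw s (toFinset_subset_lstep t x w hs)
    rw [this, Set.indicator_of_notMem hx]
    simp

/-! ### The chain driven by independent noise -/

theorem lrun_congr (x : Θ × Enum Θ) {w w' : ℕ → Noise m} {t : ℕ} (h : ∀ s < t, w s = w' s) :
    A.lrun x w t = A.lrun x w' t := by
  induction t with
  | zero => rfl
  | succ t ih =>
    rw [lrun, lrun, ih fun s hs => h s (hs.trans (Nat.lt_succ_self t)), h t (Nat.lt_succ_self t)]

variable {Ω : Type*} [MeasurableSpace Ω] {P : Measure Ω} [IsProbabilityMeasure P]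
  {W : ℕ → Ω → Noise m}

theorem measurable_lrun_comp [CompactSpace Θ] (hA : A.Standing) (hS : A.Sufficient)
    (hW : ∀ t, Measurable (W t)) (x : Θ × Enum Θ) (t : ℕ) :
    Measurable fun ω => A.lrun x (fun s => W s ω) t :=
  (measurable_lrun hA hS x t).comp (measurable_pi_lambda _ hW)

/-- The state at time t is a function of the noises before t, hence independent of the one at t. In
the proof the later noises are replaced by 0. -/
theorem map_lrun_noise [CompactSpace Θ] (hA : A.Standing) (hS : A.Sufficient)
    (hW : ∀ t, Measurable (W t)) (hlaw : ∀ t, P.map (W t) = noiseLaw m) (hind : iIndepFun W P)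
    (x : Θ × Enum Θ) (t : ℕ) :
    P.map (fun ω => (A.lrun x (fun s => W s ω) t, W t ω)) =
      (P.map fun ω => A.lrun x (fun s => W s ω) t).prod (noiseLaw m) := by
  classical
  have hm := measurable_lrun_comp hA hS hW x t
  set g : (∀ _ : Finset.range t, Noise m) → Θ × Enum Θ := fun v =>
    A.lrun x (fun s => if h : s ∈ Finset.range t then v ⟨s, h⟩ else 0) t with hg
  have hgm : Measurable g := (measurable_lrun hA hS x t).comp (measurable_pi_lambda _ fun s => by
    by_cases h : s ∈ Finset.range t
    · simp only [dif_pos h]; fun_prop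
    · simp only [dif_neg h]; fun_prop)
  have h1 := hind.indepFun_finset (Finset.range t) {t} (by simp) hW
  have h2 := h1.comp hgm (measurable_pi_apply (⟨t, Finset.mem_singleton_self t⟩ : ({t} : Finset ℕ)))
  have h3 : (fun ω => A.lrun x (fun s => W s ω) t) ⟂ᵢ[P] W t := by
    have e : (g ∘ fun ω (i : Finset.range t) => W i ω) = fun ω => A.lrun x (fun s => W s ω) t := by
      funext ω
      refine lrun_congr x fun s hs => ?_
      simp [hs]
    rw [e] at h2
    exact h2
  rw [(indepFun_iff_map_prod_eq_prod_map_map hm.aemeasurable (hW t).aemeasurable).1 h3, hlaw]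

theorem integral_lrun_succ [CompactSpace Θ] (hA : A.Standing) (hS : A.Sufficient)
    (hW : ∀ t, Measurable (W t)) (hlaw : ∀ t, P.map (W t) = noiseLaw m) (hind : iIndepFun W P)
    (x : Θ × Enum Θ) (t : ℕ) {G : Θ × Enum Θ → ℝ} (hG : Measurable G) {C : ℝ}
    (hC : ∀ x, |G x| ≤ C) :
    Integrable (fun ω => ∫ w, G (A.lstep t (A.lrun x (fun s => W s ω) t) w) ∂(noiseLaw m)) P ∧
    ∫ ω, G (A.lrun x (fun s => W s ω) (t + 1)) ∂P =
      ∫ ω, ∫ w, G (A.lstep t (A.lrun x (fun s => W s ω) t) w) ∂(noiseLaw m) ∂P := by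
  have hm := measurable_lrun_comp hA hS hW x t
  have hstep := measurable_lstep hA hS t
  have hGs : Measurable fun p : (Θ × Enum Θ) × Noise m => G (A.lstep t p.1 p.2) := hG.comp hstep
  have := Measure.isProbabilityMeasure_map (μ := P) hm.aemeasurable
  have hI : Integrable (fun p : (Θ × Enum Θ) × Noise m => G (A.lstep t p.1 p.2))
      ((P.map fun ω => A.lrun x (fun s => W s ω) t).prod (noiseLaw m)) :=
    integrable_of_abs_le hGs fun p => hC _
  have hsm : AEStronglyMeasurable (fun x => ∫ w, G (A.lstep t x w) ∂(noiseLaw m))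
      (P.map fun ω => A.lrun x (fun s => W s ω) t) := hI.integral_prod_left.aestronglyMeasurable
  refine ⟨?_, ?_⟩
  · exact (integrable_map_measure hsm hm.aemeasurable).1 hI.integral_prod_left
  · rw [← integral_map hm.aemeasurable hsm, ← integral_prod _ hI,
      ← map_lrun_noise hA hS hW hlaw hind x t,
      integral_map (hm.prodMk (hW t)).aemeasurable hGs.aestronglyMeasurable]
    rfl

/-- Whatever the state, the conditional probability of still missing U shrinks by the factor 1 - p
at each step. -/
theorem tendsto_misses [CompactSpace Θ] (hA : A.Standing) (hS : A.Sufficient)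
    (hW : ∀ t, Measurable (W t)) (hlaw : ∀ t, P.map (W t) = noiseLaw m) (hind : iIndepFun W P)
    (x : Θ × Enum Θ) {U : Set Θ} (hU : IsOpen U) (hne : U.Nonempty) :
    Tendsto (fun t => P.real {ω | Misses U (A.lrun x (fun s => W s ω) t)}) atTop (𝓝 0) := by
  obtain ⟨p, hp0, hp1, hp⟩ := exists_integral_misses_le (A := A) hA hS hU hne
  have hMm : MeasurableSet {x : Θ × Enum Θ | Misses U x} := measurableSet_misses hU.measurableSet
  set G : Θ × Enum Θ → ℝ := {x | Misses U x}.indicator 1 with hG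
  have hGm : Measurable G := measurable_one.indicator hMm
  have hG1 : ∀ x, |G x| ≤ 1 := fun x => by
    by_cases hx : Misses U x <;> simp [hG, hx]
  have hrec : ∀ t, P.real {ω | Misses U (A.lrun x (fun s => W s ω) (t + 1))} ≤
      (1 - p) * P.real {ω | Misses U (A.lrun x (fun s => W s ω) t)} := by
    intro t
    have hm := measurable_lrun_comp hA hS hW x t
    obtain ⟨hint, heq⟩ := integral_lrun_succ hA hS hW hlaw hind x t hGm hG1
    rw [← integral_misses P hU.measurableSet (measurable_lrun_comp hA hS hW x (t + 1)), heq, ← integral_misses P hU.measurableSet hm, ← integral_const_mul]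
    refine integral_mono hint ((integrable_of_abs_le (hGm.comp hm) fun ω => hG1 _).const_mul _)
      fun ω => ?_
    dsimp only
    have hl : Measurable fun w => A.lstep t (A.lrun x (fun s => W s ω) t) w :=
      (measurable_lstep hA hS t).comp (f := fun w => (A.lrun x (fun s => W s ω) t, w))
        measurable_prodMk_left
    have e := integral_misses (noiseLaw m) hU.measurableSet hl
    have h := hp t (A.lrun x (fun s => W s ω) t)
    rw [← e] at h
    exact h
  have hpow : ∀ t, P.real {ω | Misses U (A.lrun x (fun s => W s ω) t)} ≤ (1 - p) ^ t := by
    intro t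
    induction t with
    | zero => simp
    | succ t ih =>
      rw [pow_succ']
      exact (hrec t).trans (mul_le_mul_of_nonneg_left ih (sub_nonneg.2 hp1))
  exact squeeze_zero (fun t => measureReal_nonneg) hpow
    (tendsto_pow_atTop_nhds_zero_of_lt_one (sub_nonneg.2 hp1) (by linarith))

/-- The sample set becomes arbitrarily fine in probability. -/
theorem exists_tendsto_isCover [CompactSpace Θ] (hA : A.Standing) (hS : A.Sufficient)
    (hW : ∀ t, Measurable (W t)) (hlaw : ∀ t, P.map (W t) = noiseLaw m) (hind : iIndepFun W P)
    (x : Θ × Enum Θ) {ε : ℝ} (hε : 0 < ε) : ∃ N : ℕ → Set Ω, (∀ t, MeasurableSet (N t)) ∧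
      Tendsto (fun t => P.real (N t)) atTop (𝓝 0) ∧
      ∀ t, ∀ ω ∉ N t, IsCover ε (A.lrun x (fun s => W s ω) t).2.toFinset := by
  obtain ⟨T, -, hTf, hcov⟩ := finite_cover_balls_of_compact (X := Θ) isCompact_univ
    (e := ε / 3) (by positivity)
  set F := hTf.toFinset with hF
  set N : ℕ → Set Ω := fun t =>
    ⋃ c ∈ F, {ω | Misses (Metric.ball c (ε / 3)) (A.lrun x (fun s => W s ω) t)} with hN
  refine ⟨N, fun t => ?_, ?_, fun t ω hω => ?_⟩
  · exact F.measurableSet_biUnion fun c _ =>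
      measurable_lrun_comp hA hS hW x t (measurableSet_misses Metric.isOpen_ball.measurableSet)
  · have hlim : Tendsto (fun t => ∑ c ∈ F,
        P.real {ω | Misses (Metric.ball c (ε / 3)) (A.lrun x (fun s => W s ω) t)}) atTop (𝓝 0) := by
      simpa using tendsto_finsetSum F fun c _ => tendsto_misses hA hS hW hlaw hind x
        (U := Metric.ball c (ε / 3)) Metric.isOpen_ball ⟨c, Metric.mem_ball_self (by positivity)⟩
    exact squeeze_zero (fun t => measureReal_nonneg) (fun t => measureReal_biUnion_finset_le _ _)
      hlim
  · refine isCover_of_dist_lt hε (r := 2 * ε / 3) (by linarith) fun θ => ?_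
    have hθ := hcov (Set.mem_univ θ)
    simp only [Set.mem_iUnion] at hθ
    obtain ⟨c, hc, hθc⟩ := hθ
    have hmiss : ¬ Misses (Metric.ball c (ε / 3)) (A.lrun x (fun s => W s ω) t) := fun hm =>
      hω (Set.mem_biUnion (hTf.mem_toFinset.2 hc) hm)
    rw [misses_iff] at hmiss
    push Not at hmiss
    obtain ⟨s, hs, hsc⟩ := hmiss
    refine ⟨s, hs, (dist_triangle_right θ s c).trans_lt ?_⟩
    linarith [Metric.mem_ball.1 hθc, Metric.mem_ball.1 hsc]

end Setup

end LAMCMC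

/-! ### Convergence of expectations along the run -/

namespace LAMCMC

namespace Setup

variable {d m n : ℕ} {Θ : Set (E d)} {A : Setup d m n Θ}
  {Ω : Type*} [MeasurableSpace Ω] {P : Measure Ω} [IsProbabilityMeasure P] {W : ℕ → Ω → Noise m}

/-- Asymptotically, one step of the algorithm acts on expectations like the exact transition
operator. -/
theorem tendsto_integral_lrun_succ_sub [CompactSpace Θ] (hd : 1 ≤ d) (hA : A.Standing)
    (hC : A.Convergence) (hW : ∀ t, Measurable (W t)) (hlaw : ∀ t, P.map (W t) = noiseLaw m)
    (hind : iIndepFun W P) (x : Θ × Enum Θ) {f : Θ → ℝ} (hf : Continuous f) :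
    Tendsto (fun t => ∫ ω, f (A.lrun x (fun s => W s ω) (t + 1)).1 ∂P -
      ∫ ω, A.exactOp f (A.lrun x (fun s => W s ω) t).1 ∂P) atTop (𝓝 0) := by
  have hS := hC.sufficient
  have hPf := exactOp_continuous hA hS hf
  obtain ⟨F₁, hF₁⟩ := (isCompact_univ (X := Θ)).exists_bound_of_continuousOn hf.continuousOn
  obtain ⟨F₂, hF₂⟩ := (isCompact_univ (X := Θ)).exists_bound_of_continuousOn hPf.continuousOn
  have hb1 : ∀ y, |f y| ≤ F₁ := fun y => hF₁ y (Set.mem_univ _)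
  have hb2 : ∀ y, |A.exactOp f y| ≤ F₂ := fun y => hF₂ y (Set.mem_univ _)
  rw [Metric.tendsto_atTop']
  intro τ hτ
  obtain ⟨ε, hε, hstep⟩ := abs_integral_lstep_sub_exactOp_le hd hA hC hf (τ := τ / 2) (by positivity)
  obtain ⟨N, hNm, hN, hcov⟩ := exists_tendsto_isCover (A := A) hA hS hW hlaw hind x hε
  -- Off the exceptional event N t the one-step error is at most τ/2; on it a crude bound suffices,
  -- since its probability tends to zero.
  have hlim : Tendsto (fun t => τ / 2 + P.real (N t) * (F₁ + F₂)) atTop (𝓝 (τ / 2)) := by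
    simpa using (hN.mul_const (F₁ + F₂)).const_add (τ / 2)
  obtain ⟨t₀, ht₀⟩ := eventually_atTop.1 (hlim.eventually_lt_const (show τ / 2 < τ by linarith))
  refine ⟨t₀, fun t ht => ?_⟩
  rw [Real.dist_eq, sub_zero]
  refine lt_of_le_of_lt ?_ (ht₀ t ht.le)
  obtain ⟨hint, heq⟩ := integral_lrun_succ hA hS hW hlaw hind x t
    (G := fun x => f x.1) (hf.measurable.comp measurable_fst) fun x => hb1 x.1
  rw [heq]
  have hm := measurable_lrun_comp hA hS hW x t
  have hb : ∫ ω, (τ / 2 + (N t).indicator (fun _ => F₁ + F₂) ω) ∂P =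
      τ / 2 + P.real (N t) * (F₁ + F₂) := by
    rw [integral_add (integrable_const _) ((integrable_const _).indicator (hNm t)),
      integral_indicator (hNm t), integral_const, integral_const, measureReal_restrict_apply_univ]
    simp
  rw [← hb]
  refine abs_integral_sub_integral_le hint
    (integrable_of_abs_le (hPf.measurable.comp (measurable_fst.comp hm)) fun ω => hb2 _)
    ((integrable_const _).add ((integrable_const _).indicator (hNm t))) (.of_forall fun ω => ?_)
  by_cases hω : ω ∈ N t
  · rw [Set.indicator_of_mem hω]
    refine (abs_sub _ _).trans ?_
    have h1 : |∫ w, f (A.lstep t (A.lrun x (fun s => W s ω) t) w).1 ∂(noiseLaw m)| ≤ F₁ := by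
      simpa using norm_integral_le_of_norm_le_const (μ := noiseLaw m)
        (f := fun w => f (A.lstep t (A.lrun x (fun s => W s ω) t) w).1) (.of_forall fun w => hb1 _)
    linarith [hb2 (A.lrun x (fun s => W s ω) t).1]
  · rw [Set.indicator_of_notMem hω, add_zero]
    exact hstep t _ (hcov t ω hω)

theorem tendsto_integral_lrun_add_sub [CompactSpace Θ] (hd : 1 ≤ d) (hA : A.Standing)
    (hC : A.Convergence) (hW : ∀ t, Measurable (W t)) (hlaw : ∀ t, P.map (W t) = noiseLaw m)
    (hind : iIndepFun W P) (x : Θ × Enum Θ) (k : ℕ) {f : Θ → ℝ} (hf : Continuous f) :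
    Tendsto (fun t => ∫ ω, f (A.lrun x (fun s => W s ω) (t + k)).1 ∂P -
      ∫ ω, A.exactOp^[k] f (A.lrun x (fun s => W s ω) t).1 ∂P) atTop (𝓝 0) := by
  induction k generalizing f with
  | zero => simp
  | succ k ih =>
    have h1 := (tendsto_add_atTop_iff_nat k).2
      (tendsto_integral_lrun_succ_sub hd hA hC hW hlaw hind x hf)
    have h2 := ih (exactOp_continuous hA hC.sufficient hf)
    simpa [Function.iterate_succ_apply, add_assoc] using h1.add h2

/-- Expectations of continuous functions converge to their posterior means. -/
theorem tendsto_integral_lrun [CompactSpace Θ] (hd : 1 ≤ d) (hA : A.Standing)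
    (hC : A.Convergence) (hW : ∀ t, Measurable (W t)) (hlaw : ∀ t, P.map (W t) = noiseLaw m)
    (hind : iIndepFun W P) (x : Θ × Enum Θ) {f : Θ → ℝ} (hf : Continuous f) :
    Tendsto (fun t => ∫ ω, f (A.lrun x (fun s => W s ω) t).1 ∂P) atTop
      (𝓝 (∫ θ, f θ ∂A.target)) := by
  have hS := hC.sufficient
  have : Nonempty Θ := ⟨x.1⟩
  rw [Metric.tendsto_atTop']
  intro τ hτ
  -- k depends only on f and τ and works for every starting point, so it can be fixed before t tends
  -- to infinity.
  obtain ⟨k, hk⟩ := exists_iterate_exactOp_close hA hS hf (τ := τ / 2) (by positivity)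
  have hlim := tendsto_integral_lrun_add_sub hd hA hC hW hlaw hind x k hf
  obtain ⟨t₀, ht₀⟩ := Metric.tendsto_atTop'.1 hlim (τ / 2) (by positivity)
  refine ⟨t₀ + k, fun t ht => ?_⟩
  obtain ⟨s, rfl⟩ : ∃ s, t = s + k := ⟨t - k, by omega⟩
  have h1 := ht₀ s (by omega)
  rw [Real.dist_eq, sub_zero] at h1
  have hc := iterate_exactOp_continuous hA hS hf k
  obtain ⟨F, hF⟩ := (isCompact_univ (X := Θ)).exists_bound_of_continuousOn hc.continuousOn
  have h2 := abs_integral_sub_le (μ := P)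
    (F := fun ω => A.exactOp^[k] f (A.lrun x (fun s => W s ω) s).1)
    (integrable_of_abs_le (hc.measurable.comp
      (measurable_fst.comp (measurable_lrun_comp hA hS hW x s))) fun ω => hF _ (Set.mem_univ _))
    (.of_forall fun ω => hk _)
  rw [Real.dist_eq]
  refine (abs_sub_le _ _ _).trans_lt (lt_of_lt_of_le (add_lt_add_of_lt_of_le h1 h2) ?_)
  linarith

end Setup

end LAMCMC

end

/-! ### Conclusion -/

theorem mainTheorem2 {d m n : ℕ} {Θ : Set (LAMCMC.E d)} (A : LAMCMC.Setup d m n Θ)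
    (hA : A.Standing) (hconv : A.Convergence)
    (θ₁ : Θ) (S₁ : Finset Θ)
    {Ω : Type*} [MeasurableSpace Ω] (P : Measure Ω) [IsProbabilityMeasure P]
    (W : ℕ → Ω → LAMCMC.Noise m) (hW_meas : ∀ t, Measurable (W t))
    (hW_law : ∀ t, P.map (W t) = LAMCMC.noiseLaw m) (hW_indep : iIndepFun W P) :
    Tendsto (fun t => LAMCMC.wasserstein
      (P.map fun ω => (A.run (θ₁, S₁) (fun s => W s ω) t).1) A.target) atTop (𝓝 0) := by
  have hS := hconv.sufficient
  have : CompactSpace Θ := isCompact_iff_compactSpace.1 hS.compact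
  have : Nonempty Θ := ⟨θ₁⟩
  obtain ⟨a, rfl⟩ := LAMCMC.Enum.exists_toFinset_eq S₁
  have hrun : ∀ t, (fun ω => (A.run (θ₁, a.toFinset) (fun s => W s ω) t).1) =
      fun ω => (A.lrun (θ₁, a) (fun s => W s ω) t).1 := fun t => by
    funext ω
    rw [LAMCMC.Setup.run_eq (θ₁, a)]
  simp only [hrun]
  have hm : ∀ t, Measurable fun ω => (A.lrun (θ₁, a) (fun s => W s ω) t).1 := fun t =>
    measurable_fst.comp (LAMCMC.Setup.measurable_lrun_comp hA hS hW_meas (θ₁, a) t)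
  have hprob : ∀ t, IsProbabilityMeasure
      (P.map fun ω => (A.lrun (θ₁, a) (fun s => W s ω) t).1) := fun t =>
    Measure.isProbabilityMeasure_map (hm t).aemeasurable
  have htarget := LAMCMC.Setup.isProbabilityMeasure_target hA hS θ₁
  refine LAMCMC.tendsto_wasserstein hprob htarget fun f => ?_
  rcases Nat.eq_zero_or_pos d with rfl | hd
  -- In dimension 0 the state space is a single point, so both expectations equal f θ₁.
  · have hf : ∀ θ, f θ = f θ₁ := fun θ => congrArg f (Subsingleton.elim θ θ₁)
    simp [hf]
  · have h := LAMCMC.Setup.tendsto_integral_lrun hd hA hconv hW_meas hW_law hW_indep (θ₁, a)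
      f.continuous
    refine h.congr fun t => ?_
    rw [integral_map (hm t).aemeasurable f.continuous.aestronglyMeasurable]
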